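/- Let $G=(V,E)$ be a finite directed acyclic network (parallel edges allowed) whose edges have unit capacity, i.e. each edge carries one symbol of a finite field $\mathbb F$. Let $s_1,s_2,s_3$ be three distinct sources and $t_1,t_2,t_3$ three distinct terminals; no edge enters a source and no edge leaves a terminal. Let $X_i\in\mathbb F$ be the symbol present at $s_i$. In a linear network code over $\mathbb F$, the symbol on an edge leaving $s_i$ is a fixed multiple of $X_i$, and the symbol on an edge leaving any other node $v$ is a fixed linear combination of the symbols on the edges entering $v$; a terminal obtains $X_1+X_2+X_3$ if this sum is, for all values of $X_1,X_2,X_3$, a fixed linear combination of the symbols on the edges entering the terminal. Suppose that for all $i,j\in\{1,2,3\}$ there are two edge-disjoint directed paths from $s_i$ to $t_j$. Then there is an $m_0$ such that for every $m\ge m_0$ there is a linear network code over the field $\mathrm{GF}(2^m)$ with which every terminal obtains $X_1+X_2+X_3$. Moreover, such a code can be found efficiently: there is a deterministic algorithm (a random-access machine with unit-cost addition, truncated subtraction, tests and memory access) that, given any such $G$ with its sources and terminals, outputs, in time polynomial in $|V|+|E|$, an irreducible polynomial $f$ over $\mathrm{GF}(2)$ together with all coefficients, including those used by the terminals, of a linear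 network code over $\mathrm{GF}(2)[x]/(f)\cong \mathrm{GF}(2^{\deg f})$ with which every terminal obtains $X_1+X_2+X_3$. -/

import Mathlib

/-! ### Networks -/

/-- A directed multigraph (parallel edges model integer capacities; every edge has unit capacity)
with three sources and three terminals. -/
structure SumNetwork (V E : Type*) where
  tail : E → V
  head : E → V
  source : Fin 3 → V
  terminal : Fin 3 → V

namespace SumNetwork

variable {V E : Type*}

/-- `IsWalk N u v p`: the edge sequence `p` leads from `u` to `v`. -/
def IsWalk (N : SumNetwork V E) : V → V → List E → Prop
  | u, v, [] => u = v
  | u, v, e :: p => N.tail e = u ∧ IsWalk N (N.head e) v p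

/-- A path is a nonempty sequence of consecutive edges. -/
def IsPath (N : SumNetwork V E) (u v : V) (p : List E) : Prop :=
  p ≠ [] ∧ N.IsWalk u v p

/-- The standing assumptions on a network: it is acyclic, the three sources are distinct nodes, so
are the three terminals, no edge enters a source and no edge leaves a terminal. -/
structure IsAdmissible (N : SumNetwork V E) : Prop where
  acyclic : ∀ v p, ¬ N.IsPath v v p
  source_injective : Function.Injective N.source
  terminal_injective : Function.Injective N.terminal
  head_ne_source : ∀ e i, N.head e ≠ N.source i
  tail_ne_terminal : ∀ e j, N.tail e ≠ N.terminal j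

/-- Every source/terminal pair is connected by two edge-disjoint paths. -/
def TwoEdgeDisjointPaths (N : SumNetwork V E) : Prop :=
  ∀ i j, ∃ p q, N.IsPath (N.source i) (N.terminal j) p ∧
    N.IsPath (N.source i) (N.terminal j) q ∧ List.Disjoint p q

end SumNetwork

/-! ### Linear network codes -/

/-- The coefficients of a scalar linear network code: `inject i e` multiplies the source symbol
`X i` on an edge `e` that leaves source `i`, `transfer e' e` multiplies the signal of `e'` on an
edge `e` that leaves the head of `e'`, and `decode j e` multiplies the signal of an edge `e`
entering terminal `j` in the linear combination formed by that terminal. All other values of the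
three functions are ignored. -/
structure LinearCode (E F : Type*) where
  inject : Fin 3 → E → F
  transfer : E → E → F
  decode : Fin 3 → E → F

namespace SumNetwork

variable {V E F : Type*} [DecidableEq V] [Fintype E] [CommRing F]

/-- `Y` is the family of edge signals when the source symbols are `X`. -/
def IsSignal (N : SumNetwork V E) (c : LinearCode E F) (X : Fin 3 → F) (Y : E → F) : Prop :=
  ∀ e, Y e =
    (∑ i, if N.source i = N.tail e then c.inject i e * X i else 0) +
    (∑ e', if N.head e' = N.tail e then c.transfer e' e * Y e' else 0)

/-- For all source symbols the edge signals exist, and from them every terminal obtains the sum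
of the source symbols as a linear combination of the signals on its incoming edges. -/
def ComputesSum (N : SumNetwork V E) (c : LinearCode E F) : Prop :=
  ∀ X : Fin 3 → F, (∃ Y, N.IsSignal c X Y) ∧
    ∀ Y, N.IsSignal c X Y → ∀ j,
      (∑ e, if N.head e = N.terminal j then c.decode j e * Y e else 0) = ∑ i, X i

end SumNetwork

/-! ### A machine model with a step count

A deterministic random-access machine with structured control flow. Its memory consists of
two-dimensional arrays of natural numbers; arrays are named by numerals, and an array cell is
addressed by two computed indices. Expressions are built from numerals, cells, addition and
truncated subtraction, and every operation takes one unit of time. There is no multiplication, so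
in `t` steps numbers grow by `O(t)` bits only, and polynomial time has its usual meaning. -/

namespace RAM

/-- Memory contents: array name, row, column. -/
abbrev Memory := ℕ → ℕ → ℕ → ℕ

inductive Expr : Type
  | const (k : ℕ)
  | cell (a : ℕ) (i j : Expr)
  | add (x y : Expr)
  | sub (x y : Expr)

def Expr.eval (σ : Memory) : Expr → ℕ
  | const k => k
  | cell a i j => σ a (i.eval σ) (j.eval σ)
  | add x y => x.eval σ + y.eval σ
  | sub x y => x.eval σ - y.eval σ

/-- The time for evaluating an expression: the number of its operations. -/
def Expr.time : Expr → ℕ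
  | const _ => 1
  | cell _ i j => i.time + j.time + 1
  | add x y => x.time + y.time + 1
  | sub x y => x.time + y.time + 1

/-- Programs. A test `b` in `ite` and `loop` is passed if its value is not zero. -/
inductive Program : Type
  | skip
  | assign (a : ℕ) (i j x : Expr)
  | seq (c d : Program)
  | ite (b : Expr) (c d : Program)
  | loop (b : Expr) (c : Program)

def Memory.write (σ : Memory) (a i j x : ℕ) : Memory :=
  fun a' i' j' => if a' = a ∧ i' = i ∧ j' = j then x else σ a' i' j'

/-- `Runs c σ τ t`: started with memory `σ`, the program `c` halts after exactly `t` steps with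
memory `τ`. -/
inductive Runs : Program → Memory → Memory → ℕ → Prop
  | skip (σ : Memory) : Runs .skip σ σ 1
  | assign (a : ℕ) (i j x : Expr) (σ : Memory) :
      Runs (.assign a i j x) σ (σ.write a (i.eval σ) (j.eval σ) (x.eval σ))
        (i.time + j.time + x.time + 1)
  | seq {c d : Program} {σ τ υ : Memory} {s t : ℕ} :
      Runs c σ τ s → Runs d τ υ t → Runs (.seq c d) σ υ (s + t)
  | ite_true {b : Expr} {c d : Program} {σ τ : Memory} {t : ℕ} :
      b.eval σ ≠ 0 → Runs c σ τ t → Runs (.ite b c d) σ τ (b.time + 1 + t)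
  | ite_false {b : Expr} {c d : Program} {σ τ : Memory} {t : ℕ} :
      b.eval σ = 0 → Runs d σ τ t → Runs (.ite b c d) σ τ (b.time + 1 + t)
  | loop_done {b : Expr} {c : Program} {σ : Memory} :
      b.eval σ = 0 → Runs (.loop b c) σ σ (b.time + 1)
  | loop_step {b : Expr} {c : Program} {σ τ υ : Memory} {s t : ℕ} :
      b.eval σ ≠ 0 → Runs c σ τ s → Runs (.loop b c) τ υ t →
      Runs (.loop b c) σ υ (b.time + 1 + s + t)

end RAM

/-! ### Input and output formats -/

/-- The initial memory that describes a network with nodes `0, …, n - 1` and edges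
`0, …, k - 1`. Array 0 holds `n` and `k` in row 0; array 1 holds the tails of the edges in row 0
and their heads in row 1; array 2 holds the sources in row 0 and the terminals in row 1. All other
cells are 0. -/
def SumNetwork.input {n k : ℕ} (N : SumNetwork (Fin n) (Fin k)) : RAM.Memory
  | 0, 0, 0 => n
  | 0, 0, 1 => k
  | 1, 0, e => if h : e < k then N.tail ⟨e, h⟩ else 0
  | 1, 1, e => if h : e < k then N.head ⟨e, h⟩ else 0
  | 2, 0, i => if h : i < 3 then N.source ⟨i, h⟩ else 0
  | 2, 1, j => if h : j < 3 then N.terminal ⟨j, h⟩ else 0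
  | _, _, _ => 0

/-- The polynomial over the field with two elements whose coefficients are the binary digits
of `x`. -/
noncomputable def binaryPoly (x : ℕ) : Polynomial (ZMod 2) :=
  ∑ l ∈ Finset.range x.size, if x.testBit l then Polynomial.X ^ l else 0

/-- The modulus announced by a final memory: the polynomial encoded in array 3. -/
noncomputable def outputModulus (τ : RAM.Memory) : Polynomial (ZMod 2) :=
  binaryPoly (τ 3 0 0)

/-- The linear code described by a final memory, with coefficients in the quotient of the
polynomial ring over the two-element field by the announced modulus. Each coefficient is given by a
representing polynomial: those for the source symbols in array 4, for the edges in array 5, and for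
the terminals in array 6. -/
noncomputable def outputCode (k : ℕ) (τ : RAM.Memory) :
    LinearCode (Fin k) (AdjoinRoot (outputModulus τ)) where
  inject i e := AdjoinRoot.mk _ (binaryPoly (τ 4 i e))
  transfer e' e := AdjoinRoot.mk _ (binaryPoly (τ 5 e' e))
  decode j e := AdjoinRoot.mk _ (binaryPoly (τ 6 j e))

/-! The network is replaced by its line digraph, whose vertices are the edges, the three sources and
the three terminals. Of two edge-disjoint paths at most one uses a given edge, so no inner vertex of
the line digraph separates a source from a terminal (`SumNetwork.line_isGood`). A network code is
then a weighting of arcs, and it suffices to solve the sum problem on such acyclic digraphs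
(`SumNetwork.computesSum_of_solves`). There are two cases.

Suppose there is a hub pair: two equal or incomparable vertices that all sources reach and that
together reach all terminals. Each vertex in front of the hubs forwards what it receives so that
each source symbol arrives exactly once at each hub, and the vertices behind the hubs copy the sum.
Coefficients 0 and 1 suffice (`solves_of_hub`).

Suppose there is none. A vertex is shared if it reaches at least two terminals; beyond the shared
vertices lie disjoint regions, each leading to one terminal. The gates of a terminal are the shared
vertices with an arc into its region. If the vectors carried by the gates of each terminal span the
whole space of dimension 3, the gates can be weighted so that the weighted signals add up to the sum
of the sources. The region only has to add up and forward what it gets (`solves_of_multicast`). So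
the task is a multicast of three symbols to three sets of gates.

The shared vertices choose their vectors one after another in topological order. The invariant
`Open` is a rank version of Menger's condition: the rank of the processed vectors on a closed set of
vertices, plus the size of the corresponding cut, is at least 3. By submodularity the tight sets are
closed under union, so each terminal forbids only the vectors of one subspace, which does not
contain all available vectors (`Open.exists_forbidden`). Three proper subspaces do not cover a space
over a field with at least four elements, so a choice exists (`Open.exists_step`). The invariant
holds initially (`open_init`): cuts of size 0 and 1 are handled by connectivity, and for size 2 the
absence of a hub pair provides a source that does not reach one of the two cut vertices.

For the algorithm the field with four elements is fixed, so all choices can be made by exhaustive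
search. Cuts with three or more vertices satisfy the invariant trivially; hence `Open` is tested
over polynomially many cuts, each by a reachability computation and a search for independent vectors
(`open_iff_tail`, `forall_passes_iff`). The algorithm is written in a loop language whose loop
bounds are constants or the number of edges plus a constant, so every program has a polynomial time
bound by recursion on its syntax (`Cmd.runs_compile`). -/

/-! ### A loop language

A small structured language with lexically scoped loop variables, tests given by formulas with
bounded quantifiers, and loops and quantifiers whose range is a constant or the number of edges plus
a constant. It is compiled to the random-access machine; all its programs run in polynomial
time. -/

namespace LoopLang

open RAM

/-- The range of a loop or a quantifier: `c`, or `k + c` where `k` is the number of edges. -/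
inductive Range
  | num (c : ℕ)
  | edges (c : ℕ)

def Range.val (k : ℕ) : Range → ℕ
  | num c => c
  | edges c => k + c

inductive Tm
  | const (c : ℕ)
  | var (x : ℕ)
  | cell (a : ℕ) (i j : Tm)
  | add (s t : Tm)
  | sub (s t : Tm)

inductive Fm
  | nz (t : Tm)
  | neg (φ : Fm)
  | and (φ ψ : Fm)
  | ex (x : ℕ) (b : Range) (φ : Fm)

inductive Cmd
  | skip
  | set (a : ℕ) (i j t : Tm)
  | seq (c d : Cmd)
  | ite (φ : Fm) (c d : Cmd)
  | for (x : ℕ) (b : Range) (c : Cmd)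

/-- Values of the loop variables. -/
abbrev Env := ℕ → ℕ

@[simp] def Tm.eval (ρ : Env) (σ : Memory) : Tm → ℕ
  | const c => c
  | var x => ρ x
  | cell a i j => σ a (i.eval ρ σ) (j.eval ρ σ)
  | add s t => s.eval ρ σ + t.eval ρ σ
  | sub s t => s.eval ρ σ - t.eval ρ σ

@[simp] def Fm.Holds (k : ℕ) (ρ : Env) (σ : Memory) : Fm → Prop
  | nz t => t.eval ρ σ ≠ 0
  | neg φ => ¬ φ.Holds k ρ σ
  | and φ ψ => φ.Holds k ρ σ ∧ ψ.Holds k ρ σ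
  | ex x b φ => ∃ i < b.val k, φ.Holds k (Function.update ρ x i) σ

/-- `n`-fold iteration of a state transformer that depends on the iteration number. -/
def iter (f : ℕ → Memory → Memory) : ℕ → Memory → Memory
  | 0, σ => σ
  | n + 1, σ => f n (iter f n σ)

open Classical in
/-- The memory after the execution of a command. -/
noncomputable def Cmd.den (k : ℕ) : Cmd → Env → Memory → Memory
  | skip, _, σ => σ
  | set a i j t, ρ, σ => σ.write a (i.eval ρ σ) (j.eval ρ σ) (t.eval ρ σ)
  | seq c d, ρ, σ => d.den k ρ (c.den k ρ σ)
  | ite φ c d, ρ, σ => if φ.Holds k ρ σ then c.den k ρ σ else d.den k ρ σ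
  | .for x b c, ρ, σ => iter (fun i τ => c.den k (Function.update ρ x i) τ) (b.val k) σ

/-! Well-formedness: variables are bound and bound only once, arrays 7 and 8 are reserved for the
loop variables and the truth values, and array 0 is not written. -/

def Tm.wf (L : List ℕ) : Tm → Bool
  | const _ => true
  | var x => decide (x ∈ L)
  | cell a i j => decide (a ≠ 7 ∧ a ≠ 8) && i.wf L && j.wf L
  | add s t => s.wf L && t.wf L
  | sub s t => s.wf L && t.wf L

def Fm.wf (L : List ℕ) : Fm → Bool
  | nz t => t.wf L
  | neg φ => φ.wf L
  | and φ ψ => φ.wf L && ψ.wf L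
  | ex x _ φ => decide (x ∉ L) && φ.wf (x :: L)

def Cmd.wf (L : List ℕ) : Cmd → Bool
  | skip => true
  | set a i j t => decide (a ≠ 0 ∧ a ≠ 7 ∧ a ≠ 8) && i.wf L && j.wf L && t.wf L
  | seq c d => c.wf L && d.wf L
  | ite φ c d => φ.wf L && c.wf L && d.wf L
  | .for x _ c => decide (x ∉ L) && c.wf (x :: L)

/-! Compilation -/

def Range.compile : Range → Expr
  | num c => .const c
  | edges c => .add (.cell 0 (.const 0) (.const 1)) (.const c)

def varCell (x : ℕ) : Expr := .cell 7 (.const x) (.const 0)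

def resCell (d : ℕ) : Expr := .cell 8 (.const d) (.const 0)

def setVar (x : ℕ) (e : Expr) : Program := .assign 7 (.const x) (.const 0) e

def setRes (d : ℕ) (e : Expr) : Program := .assign 8 (.const d) (.const 0) e

def Tm.compile : Tm → Expr
  | const c => .const c
  | var x => varCell x
  | cell a i j => .cell a i.compile j.compile
  | add s t => .add s.compile t.compile
  | sub s t => .sub s.compile t.compile

def forProgram (x : ℕ) (b : Range) (c : Program) : Program :=
  .seq (setVar x (.const 0))
    (.loop (.sub b.compile (varCell x)) (.seq c (setVar x (.add (varCell x) (.const 1)))))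

/-- The truth value is left in row `d` of array 8. -/
def Fm.compile : Fm → ℕ → Program
  | nz t, d => setRes d t.compile
  | neg φ, d => .seq (φ.compile d) (setRes d (.sub (.const 1) (resCell d)))
  | and φ ψ, d => .seq (φ.compile d) (.seq (ψ.compile (d + 1))
      (.ite (resCell d) (setRes d (resCell (d + 1))) .skip))
  | ex x b φ, d => .seq (setRes d (.const 0)) (forProgram x b
      (.seq (φ.compile (d + 1)) (.ite (resCell (d + 1)) (setRes d (.const 1)) .skip)))

def Cmd.compile : Cmd → Program
  | skip => .skip
  | set a i j t => .assign a i.compile j.compile t.compile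
  | seq c d => .seq c.compile d.compile
  | ite φ c d => .seq (φ.compile 0) (.ite (resCell 0) c.compile d.compile)
  | .for x b c => forProgram x b c.compile

/-! Time bounds, as polynomials in the number of edges -/

noncomputable def Range.cost : Range → Polynomial ℕ
  | num c => (c : Polynomial ℕ)
  | edges c => Polynomial.X + (c : Polynomial ℕ)

/-- Setting the counter to zero takes 4 steps. Besides its body, a pass takes at most 10 steps for
the test and 8 for the increment, so 20 per pass and 20 for the last test are safe. -/
noncomputable def forCost (b : Range) (p : Polynomial ℕ) : Polynomial ℕ :=
  4 + (b.cost * (p + 20) + 20)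

noncomputable def Fm.cost : Fm → Polynomial ℕ
  | nz t => (t.compile.time + 3 : ℕ)
  | neg φ => φ.cost + 8
  | and φ ψ => φ.cost + (ψ.cost + 12)
  | ex _ b φ => 4 + forCost b (φ.cost + 12)

noncomputable def Cmd.cost : Cmd → Polynomial ℕ
  | skip => 1
  | set _ i j t => (i.compile.time + j.compile.time + t.compile.time + 1 : ℕ)
  | seq c d => c.cost + d.cost
  | ite φ c d => φ.cost + (c.cost + d.cost + 4)
  | .for _ b c => forCost b c.cost

/-! ### Correctness and running time of the compiled programs -/

/-- The machine memory `μ` represents the data memory `σ` and the values `ρ` of the variables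
in `L`. -/
structure Sim (k : ℕ) (L : List ℕ) (ρ : Env) (σ μ : Memory) : Prop where
  data : ∀ a, a ≠ 7 → a ≠ 8 → μ a = σ a
  vars : ∀ x ∈ L, μ 7 x 0 = ρ x
  size : μ 0 0 1 = k

theorem write_of_ne {σ : Memory} {a a' : ℕ} (i j x : ℕ) (h : a' ≠ a) :
    σ.write a i j x a' = σ a' := by
  funext i' j'
  simp [Memory.write, h]

theorem Sim.setRes {k L ρ σ μ} (h : Sim k L ρ σ μ) (d x : ℕ) :
    Sim k L ρ σ (μ.write 8 d 0 x) where
  data a h7 h8 := by rw [write_of_ne _ _ _ h8, h.data a h7 h8]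
  vars y hy := by rw [write_of_ne _ _ _ (by decide), h.vars y hy]
  size := by rw [write_of_ne _ _ _ (by decide), h.size]

theorem Sim.setVar {k L ρ σ μ} (h : Sim k L ρ σ μ) {x : ℕ} (hx : x ∉ L) (i : ℕ) :
    Sim k (x :: L) (Function.update ρ x i) σ (μ.write 7 x 0 i) where
  data a h7 h8 := by rw [write_of_ne _ _ _ h7, h.data a h7 h8]
  vars y hy := by
    by_cases hyx : y = x
    · subst hyx; simp [Memory.write]
    · have hyL : y ∈ L := by simpa [hyx] using hy
      simp [Memory.write, hyx, h.vars y hyL]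
  size := by rw [write_of_ne _ _ _ (by decide), h.size]

/-- On leaving a scope the machine cell of `x` keeps a stale value. This is harmless because `x ∉
L`: no variable that is still visible has its value there. -/
theorem Sim.tail {k L ρ σ μ x i} (h : Sim k (x :: L) (Function.update ρ x i) σ μ) (hx : x ∉ L) :
    Sim k L ρ σ μ where
  data := h.data
  vars y hy := by
    rw [h.vars y (List.mem_cons_of_mem _ hy), Function.update_of_ne]
    rintro rfl; exact hx hy
  size := h.size

theorem Sim.write {k L ρ σ μ} (h : Sim k L ρ σ μ) {a : ℕ} (ha : a ≠ 0 ∧ a ≠ 7 ∧ a ≠ 8)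
    (i j x : ℕ) : Sim k L ρ (σ.write a i j x) (μ.write a i j x) where
  data b h7 h8 := by
    funext i' j'
    simp [Memory.write, h.data b h7 h8]
  vars y hy := by rw [write_of_ne _ _ _ ha.2.1.symm, h.vars y hy]
  size := by rw [write_of_ne _ _ _ ha.1.symm, h.size]

theorem Tm.eval_compile {k L ρ σ μ} (h : Sim k L ρ σ μ) :
    ∀ t : Tm, t.wf L = true → t.compile.eval μ = t.eval ρ σ
  | const _, _ => rfl
  | var x, hw => h.vars x (by simpa [Tm.wf] using hw)
  | cell a i j, hw => by
    simp only [Tm.wf, Bool.and_eq_true, decide_eq_true_eq] at hw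
    simp only [compile, Expr.eval, eval, eval_compile h i hw.1.2, eval_compile h j hw.2,
      h.data a hw.1.1.1 hw.1.1.2]
  | add s t, hw => by
    simp only [Tm.wf, Bool.and_eq_true] at hw
    simp only [compile, Expr.eval, eval, eval_compile h s hw.1, eval_compile h t hw.2]
  | sub s t, hw => by
    simp only [Tm.wf, Bool.and_eq_true] at hw
    simp only [compile, Expr.eval, eval, eval_compile h s hw.1, eval_compile h t hw.2]

theorem Range.eval_compile {k L ρ σ μ} (h : Sim k L ρ σ μ) (b : Range) :
    b.compile.eval μ = b.val k := by
  cases b <;> simp [compile, Expr.eval, val, h.size]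

theorem Range.time_compile_le (b : Range) : b.compile.time ≤ 5 := by
  cases b <;> simp [compile, Expr.time]

theorem Range.eval_cost (k : ℕ) (b : Range) : b.cost.eval k = b.val k := by
  cases b <;> simp [cost, val]

/-- Compiled loops keep an invariant `I` that their bodies keep. -/
theorem runs_forProgram {k L ρ x} {b : Range} {c : Program} {t : ℕ} (hx : x ∉ L)
    (I : ℕ → Memory → Memory → Prop)
    (hvar : ∀ i σ μ i', I i σ μ → I i σ (μ.write 7 x 0 i'))
    (f : ℕ → Memory → Memory)
    (hc : ∀ i σ μ, i < b.val k → I i σ μ → Sim k (x :: L) (Function.update ρ x i) σ μ →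
      ∃ μ' t', Runs c μ μ' t' ∧ t' ≤ t ∧ I (i + 1) (f i σ) μ' ∧
        Sim k (x :: L) (Function.update ρ x i) (f i σ) μ')
    {σ μ : Memory} (hI : I 0 σ μ) (hs : Sim k L ρ σ μ) :
    ∃ μ' t', Runs (forProgram x b c) μ μ' t' ∧ t' ≤ 4 + (b.val k * (t + 20) + 20) ∧
      I (b.val k) (iter f (b.val k) σ) μ' ∧ Sim k L ρ (iter f (b.val k) σ) μ' := by
  -- Induction on the number `m` of passes still to be made, with `i` the current value of the
  -- counter.
  have key : ∀ m i μ₁, i + m = b.val k → I i (iter f i σ) μ₁ →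
      Sim k (x :: L) (Function.update ρ x i) (iter f i σ) μ₁ →
      ∃ μ' t', Runs (.loop (.sub b.compile (varCell x))
        (.seq c (LoopLang.setVar x (.add (varCell x) (.const 1))))) μ₁ μ' t' ∧
        t' ≤ m * (t + 20) + 20 ∧
        I (b.val k) (iter f (b.val k) σ) μ' ∧ Sim k L ρ (iter f (b.val k) σ) μ' := by
    intro m
    have hbt := b.time_compile_le
    induction m with
    | zero =>
      intro i μ₁ hi hI hs
      obtain rfl : i = b.val k := by simpa using hi
      refine ⟨μ₁, _, .loop_done ?_, ?_, hI, hs.tail hx⟩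
      · have := hs.vars x (by simp)
        simp only [Function.update_self] at this
        simp [Expr.eval, b.eval_compile hs, varCell, this]
      · simp [Expr.time, varCell]; omega
    | succ m ih =>
      intro i μ₁ hi hI hs
      have hlt : i < b.val k := by omega
      obtain ⟨μ₂, t₂, hr, ht, hI₂, hs₂⟩ := hc i _ μ₁ hlt hI hs
      have hxv := hs.vars x (by simp)
      have hxv₂ := hs₂.vars x (by simp)
      simp only [Function.update_self] at hxv hxv₂
      have hs₃ := (hs₂.tail hx).setVar hx (i + 1)
      obtain ⟨μ', t', hr', ht', h'⟩ := ih (i + 1) (μ₂.write 7 x 0 (i + 1)) (by omega)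
        (hvar _ _ _ _ hI₂) hs₃
      refine ⟨μ', _, .loop_step (t := t') ?_ (.seq hr (.assign 7 _ _ _ μ₂)) ?_, ?_, h'⟩
      · simp [Expr.eval, b.eval_compile hs, varCell, hxv]; omega
      · simp only [Expr.eval, varCell, hxv₂]; exact hr'
      · simp [Expr.time, varCell, add_mul]; omega
  obtain ⟨μ', t', hr, ht, h'⟩ := key (b.val k) 0 (μ.write 7 x 0 0) (by simp) (hvar _ _ _ _ hI)
    (hs.setVar hx 0)
  exact ⟨μ', _, .seq (.assign 7 _ _ _ μ) hr, by simp [Expr.time]; omega, h'⟩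

theorem iter_id (n : ℕ) (σ : Memory) : iter (fun _ τ => τ) n σ = σ := by
  induction n with
  | zero => rfl
  | succ n ih => simpa [iter] using ih

/-- The rows of array 8 serve as a stack. A formula evaluated at depth `d` leaves the rows below `d`
alone, so a conjunct, or the partial result of a quantifier, survives while a subformula is
evaluated at depth `d + 1`. -/
theorem Fm.runs_compile {k : ℕ} : ∀ (φ : Fm) (d : ℕ) {L ρ σ μ}, φ.wf L = true →
    Sim k L ρ σ μ → ∃ μ' t, Runs (φ.compile d) μ μ' t ∧ t ≤ φ.cost.eval k ∧ Sim k L ρ σ μ' ∧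
      (μ' 8 d 0 ≠ 0 ↔ φ.Holds k ρ σ) ∧ ∀ d' < d, μ' 8 d' 0 = μ 8 d' 0
  | nz t, d, L, ρ, σ, μ, hw, hs => by
    refine ⟨_, _, .assign 8 _ _ _ μ, ?_, hs.setRes _ _, ?_, ?_⟩
    · simp [cost, Expr.time]; omega
    · simp [Memory.write, Expr.eval, t.eval_compile hs hw]
    · intro d' hd'
      simp [Memory.write, Expr.eval, hd'.ne]
  | neg φ, d, L, ρ, σ, μ, hw, hs => by
    obtain ⟨μ', t, hr, ht, hs', hv, hlow⟩ := φ.runs_compile d hw hs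
    refine ⟨_, _, .seq hr (.assign 8 _ _ _ μ'), ?_, hs'.setRes _ _, ?_, ?_⟩
    · simp [cost, Expr.time, resCell]; omega
    · rw [Holds, ← hv]
      simp [Memory.write, Expr.eval, resCell]
      omega
    · intro d' hd'
      simp [Memory.write, Expr.eval, hd'.ne, hlow d' hd']
  | and φ ψ, d, L, ρ, σ, μ, hw, hs => by
    simp only [Fm.wf, Bool.and_eq_true] at hw
    obtain ⟨μ₁, t₁, hr₁, ht₁, hs₁, hv₁, hlow₁⟩ := φ.runs_compile d hw.1 hs
    obtain ⟨μ₂, t₂, hr₂, ht₂, hs₂, hv₂, hlow₂⟩ := ψ.runs_compile (d + 1) hw.2 hs₁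
    have hd : μ₂ 8 d 0 = μ₁ 8 d 0 := hlow₂ d (by omega)
    by_cases h : μ₂ 8 d 0 = 0
    · refine ⟨_, _, .seq hr₁ (.seq hr₂ (.ite_false ?_ (.skip _))), ?_, hs₂, ?_, ?_⟩
      · simpa [resCell, Expr.eval] using h
      · simp [cost, Expr.time, resCell]; omega
      · rw [Holds, ← hv₁, ← hd]; simp [h]
      · intro d' hd'
        rw [hlow₂ d' (by omega), hlow₁ d' hd']
    · refine ⟨_, _, .seq hr₁ (.seq hr₂ (.ite_true ?_ (.assign 8 _ _ _ μ₂))), ?_,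
        hs₂.setRes _ _, ?_, ?_⟩
      · simpa [resCell, Expr.eval] using h
      · simp [cost, Expr.time, resCell]; omega
      · rw [Holds, ← hv₁, ← hd, ← hv₂]; simp [h, Memory.write, Expr.eval, resCell]
      · intro d' hd'
        simp [Memory.write, Expr.eval, hd'.ne, hlow₂ d' (by omega), hlow₁ d' hd']
  | ex x b φ, d, L, ρ, σ, μ, hw, hs => by
    simp only [Fm.wf, Bool.and_eq_true, decide_eq_true_eq] at hw
    obtain ⟨μ', t', hr, ht, hI, hs'⟩ := runs_forProgram (k := k) (ρ := ρ) (b := b)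
      (t := (φ.cost + 12).eval k)
      (c := .seq (φ.compile (d + 1)) (.ite (resCell (d + 1)) (LoopLang.setRes d (.const 1)) .skip))
      hw.1
      -- Invariant of the search: the data are unchanged, row `d` tells whether a witness below `i`
      -- exists, and the lower rows are intact.
      (fun i τ ν => τ = σ ∧ (ν 8 d 0 ≠ 0 ↔ ∃ i' < i, φ.Holds k (Function.update ρ x i') σ) ∧
        ∀ d' < d, ν 8 d' 0 = μ 8 d' 0)
      (by
        intro i τ ν i' h
        simpa [write_of_ne] using h)
      (fun _ τ => τ)
      (by
        rintro i τ ν hi ⟨rfl, hd, hlow⟩ hsν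
        obtain ⟨ν₁, t₁, hr₁, ht₁, hs₁, hv₁, hlow₁⟩ := φ.runs_compile (d + 1) hw.2 hsν
        by_cases h : ν₁ 8 (d + 1) 0 = 0
        · refine ⟨_, _, .seq hr₁ (.ite_false ?_ (.skip _)), ?_, ⟨rfl, ?_, ?_⟩, hs₁⟩
          · simpa [resCell, Expr.eval] using h
          · simp [Expr.time, resCell]; omega
          · rw [hlow₁ d (by omega), hd]
            have : ¬ φ.Holds k (Function.update ρ x i) τ := by rw [← hv₁]; simpa using h
            constructor
            · rintro ⟨j, hj, hφ⟩; exact ⟨j, by omega, hφ⟩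
            · rintro ⟨j, hj, hφ⟩
              refine ⟨j, lt_of_le_of_ne (by omega) ?_, hφ⟩
              rintro rfl; exact this hφ
          · intro d' hd'
            rw [hlow₁ d' (by omega), hlow d' hd']
        · refine ⟨_, _, .seq hr₁ (.ite_true ?_ (.assign 8 _ _ _ ν₁)), ?_, ⟨rfl, ?_, ?_⟩,
            hs₁.setRes _ _⟩
          · simpa [resCell, Expr.eval] using h
          · simp [Expr.time, resCell]; omega
          · have : ∃ i' < i + 1, φ.Holds k (Function.update ρ x i') τ :=
              ⟨i, by omega, hv₁.1 h⟩
            simpa [Memory.write, Expr.eval] using this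
          · intro d' hd'
            simp [Memory.write, Expr.eval, hd'.ne, hlow₁ d' (by omega), hlow d' hd'])
      (σ := σ) (μ := μ.write 8 d 0 0)
      (by
        refine ⟨rfl, ?_, ?_⟩
        · simp [Memory.write]
        · intro d' hd'
          simp [Memory.write, hd'.ne])
      (hs.setRes _ _)
    rw [iter_id] at hs'
    refine ⟨μ', _, .seq (.assign 8 _ _ _ μ) hr, ?_, hs', hI.2.1, hI.2.2⟩
    simp only [cost, forCost, Polynomial.eval_add, Polynomial.eval_mul, b.eval_cost,
      Polynomial.eval_ofNat, Expr.time] at ht ⊢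
    omega

/-- Compiled commands do what they should, in time polynomial in the number of edges. -/
theorem Cmd.runs_compile {k : ℕ} : ∀ (c : Cmd) {L ρ σ μ}, c.wf L = true → Sim k L ρ σ μ →
    ∃ μ' t, Runs c.compile μ μ' t ∧ t ≤ c.cost.eval k ∧ Sim k L ρ (c.den k ρ σ) μ'
  | skip, L, ρ, σ, μ, _, hs => ⟨μ, _, .skip μ, by simp [cost], hs⟩
  | set a i j t, L, ρ, σ, μ, hw, hs => by
    simp only [Cmd.wf, Bool.and_eq_true, decide_eq_true_eq] at hw
    refine ⟨_, _, .assign _ _ _ _ μ, by simp [cost], ?_⟩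
    rw [i.eval_compile hs hw.1.1.2, j.eval_compile hs hw.1.2, t.eval_compile hs hw.2]
    exact hs.write hw.1.1.1 _ _ _
  | seq c d, L, ρ, σ, μ, hw, hs => by
    simp only [Cmd.wf, Bool.and_eq_true] at hw
    obtain ⟨μ₁, t₁, hr₁, ht₁, hs₁⟩ := c.runs_compile hw.1 hs
    obtain ⟨μ₂, t₂, hr₂, ht₂, hs₂⟩ := d.runs_compile hw.2 hs₁
    exact ⟨μ₂, _, .seq hr₁ hr₂, by simp [cost]; omega, hs₂⟩
  | ite φ c d, L, ρ, σ, μ, hw, hs => by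
    simp only [Cmd.wf, Bool.and_eq_true] at hw
    obtain ⟨μ₁, t₁, hr₁, ht₁, hs₁, hv, -⟩ := φ.runs_compile 0 hw.1.1 hs
    by_cases h : φ.Holds k ρ σ
    · obtain ⟨μ₂, t₂, hr₂, ht₂, hs₂⟩ := c.runs_compile hw.1.2 hs₁
      refine ⟨μ₂, _, .seq hr₁ (.ite_true (by simpa [resCell, Expr.eval] using hv.2 h) hr₂), ?_, ?_⟩
      · simp [cost, resCell, Expr.time]; omega
      · simpa [den, h] using hs₂
    · obtain ⟨μ₂, t₂, hr₂, ht₂, hs₂⟩ := d.runs_compile hw.2 hs₁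
      refine ⟨μ₂, _, .seq hr₁ (.ite_false ?_ hr₂), ?_, ?_⟩
      · have := mt hv.1 h
        simpa [resCell, Expr.eval] using this
      · simp [cost, resCell, Expr.time]; omega
      · simpa [den, h] using hs₂
  | .for x b c, L, ρ, σ, μ, hw, hs => by
    simp only [Cmd.wf, Bool.and_eq_true, decide_eq_true_eq] at hw
    obtain ⟨μ', t', hr, ht, -, hs'⟩ := runs_forProgram (k := k) (ρ := ρ) (b := b)
      (t := c.cost.eval k) (c := c.compile) hw.1 (fun _ _ _ => True) (by simp)
      (fun i τ => c.den k (Function.update ρ x i) τ)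
      (by
        intro i τ ν _ _ hsν
        obtain ⟨ν', t', hr, ht, hs'⟩ := c.runs_compile hw.2 hsν
        exact ⟨ν', t', hr, ht, trivial, hs'⟩)
      trivial hs
    refine ⟨μ', t', hr, ?_, hs'⟩
    simpa [cost, forCost, b.eval_cost] using ht

theorem eval_mono (p : Polynomial ℕ) {x y : ℕ} (h : x ≤ y) : p.eval x ≤ p.eval y := by
  rw [Polynomial.eval_eq_sum, Polynomial.eval_eq_sum]
  exact Finset.sum_le_sum fun i _ => Nat.mul_le_mul_left _ (Nat.pow_le_pow_left h i)

/-! Reasoning about commands -/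

/-- The arrays that a command may change. -/
def Cmd.writes : Cmd → List ℕ
  | skip => []
  | set a _ _ _ => [a]
  | seq c d => c.writes ++ d.writes
  | ite _ c d => c.writes ++ d.writes
  | .for _ _ c => c.writes

theorem iter_induction {f : ℕ → Memory → Memory} {n : ℕ} {σ : Memory} (I : ℕ → Memory → Prop)
    (h0 : I 0 σ) (hs : ∀ i τ, i < n → I i τ → I (i + 1) (f i τ)) : I n (iter f n σ) := by
  have : ∀ m ≤ n, I m (iter f m σ) := by
    intro m
    induction m with
    | zero => intro _; exact h0
    | succ m ih => intro hm; exact hs m _ (by omega) (ih (by omega))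
  exact this n le_rfl

/-- A frame rule: which arrays survive a command is read off its syntax, so for concrete commands
the hypothesis can be decided by computation. -/
theorem Cmd.den_of_notMem_writes (k : ℕ) {a : ℕ} : ∀ (c : Cmd) (ρ : Env) (σ : Memory),
    a ∉ c.writes → c.den k ρ σ a = σ a
  | skip, _, _, _ => rfl
  | set b i j t, ρ, σ, h => write_of_ne _ _ _ (by simpa [writes] using h)
  | seq c d, ρ, σ, h => by
    simp only [writes, List.mem_append, not_or] at h
    rw [den, d.den_of_notMem_writes k _ _ h.2, c.den_of_notMem_writes k _ _ h.1]
  | ite φ c d, ρ, σ, h => by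
    simp only [writes, List.mem_append, not_or] at h
    rw [den]
    split
    · exact c.den_of_notMem_writes k _ _ h.1
    · exact d.den_of_notMem_writes k _ _ h.2
  | .for x b c, ρ, σ, h => by
    rw [den]
    exact iter_induction (fun _ τ => τ a = σ a) rfl fun i τ _ hτ =>
      (c.den_of_notMem_writes k _ _ h).trans hτ

theorem Cmd.den_for_induction {k x : ℕ} {b : Range} {c : Cmd} {ρ : Env} {σ : Memory}
    (I : ℕ → Memory → Prop) (h0 : I 0 σ)
    (hs : ∀ i τ, i < b.val k → I i τ → I (i + 1) (c.den k (Function.update ρ x i) τ)) :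
    I (b.val k) ((Cmd.for x b c).den k ρ σ) :=
  iter_induction I h0 hs

/-- A loop keeps what its body keeps. -/
theorem Cmd.den_for_keeps {k x : ℕ} {b : Range} {c : Cmd} {ρ : Env} {σ : Memory}
    (I : Memory → Prop) (h0 : I σ)
    (hs : ∀ i τ, i < b.val k → I τ → I (c.den k (Function.update ρ x i) τ)) :
    I ((Cmd.for x b c).den k ρ σ) :=
  iter_induction (fun _ => I) h0 hs

/-- A loop that tries something, keeps the possibility of success and keeps success, succeeds if
some of its passes does. -/
theorem Cmd.den_for_search {k x : ℕ} {b : Range} {c : Cmd} {ρ : Env} {σ : Memory}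
    (I D : Memory → Prop) (h0 : I σ)
    (hI : ∀ i τ, i < b.val k → I τ → I (c.den k (Function.update ρ x i) τ))
    (hD : ∀ i τ, i < b.val k → I τ → D τ → D (c.den k (Function.update ρ x i) τ))
    {i : ℕ} (hi : i < b.val k) (hit : ∀ τ, I τ → D (c.den k (Function.update ρ x i) τ)) :
    D ((Cmd.for x b c).den k ρ σ) := by
  have := Cmd.den_for_induction (k := k) (x := x) (b := b) (c := c) (ρ := ρ) (σ := σ)
    (fun m τ => I τ ∧ (i < m → D τ)) ⟨h0, by simp⟩ (by
      rintro m τ hm ⟨hIτ, hDτ⟩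
      refine ⟨hI m τ hm hIτ, fun h => ?_⟩
      rcases eq_or_ne i m with rfl | hne
      · exact hit τ hIτ
      · exact hD m τ hm hIτ (hDτ (by omega)))
  exact this.2 hi

end LoopLang

/-! ### Sum problems on acyclic digraphs -/

/-- A digraph with three sources and three terminals. -/
structure SumDigraph (W : Type*) where
  arc : W → W → Prop
  src : Fin 3 → W
  term : Fin 3 → W

namespace SumDigraph

open Relation

variable {W : Type*} (D : SumDigraph W)

def Reach : W → W → Prop := ReflTransGen D.arc

/-- Acyclic digraphs in which no inner vertex separates a source from a terminal. -/
structure IsGood : Prop where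
  height : ∃ h : W → ℕ, ∀ u v, D.arc u v → h u < h v
  src_injective : Function.Injective D.src
  term_injective : Function.Injective D.term
  src_ne_term : ∀ i j, D.src i ≠ D.term j
  not_arc_src : ∀ u i, ¬ D.arc u (D.src i)
  not_term_arc : ∀ j v, ¬ D.arc (D.term j) v
  reach : ∀ i j, D.Reach (D.src i) (D.term j)
  connected : ∀ i j c, (∀ i, c ≠ D.src i) → (∀ j, c ≠ D.term j) →
    ReflTransGen (fun u v => D.arc u v ∧ u ≠ c) (D.src i) (D.term j)

/-- Vertices that reach at least two terminals. -/
def Shared (v : W) : Prop := ∃ j j', j ≠ j' ∧ D.Reach v (D.term j) ∧ D.Reach v (D.term j')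

/-- Vertices that reach terminal `j` only. -/
def Own (j : Fin 3) (v : W) : Prop := D.Reach v (D.term j) ∧ ¬ D.Shared v

/-- Shared vertices with an arc to a vertex that reaches terminal `j` only. -/
def Gate (j : Fin 3) (u : W) : Prop := D.Shared u ∧ ∃ x, D.arc u x ∧ D.Own j x

/-- A pair of vertices that all sources reach, that do not reach each other, and that together
reach all terminals. -/
structure IsHubPair (y z : W) : Prop where
  src_left : ∀ i, D.Reach (D.src i) y
  src_right : ∀ i, D.Reach (D.src i) z
  incomparable : y = z ∨ (¬ D.Reach y z ∧ ¬ D.Reach z y)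
  term : ∀ j, D.Reach y (D.term j) ∨ D.Reach z (D.term j)

/-- The coefficients `c` are supported on the arcs and let every terminal obtain the sum. -/
def Solves [Fintype W] {F : Type*} [CommRing F] (c : W → W → F) : Prop :=
  (∀ u v, ¬ D.arc u v → c u v = 0) ∧
  ∀ Y : W → F, (∀ v, (∀ i, v ≠ D.src i) → Y v = ∑ u, c u v * Y u) →
    ∀ j, Y (D.term j) = ∑ i, Y (D.src i)

variable {D}

theorem Reach.head {u v w : W} (h : D.arc u v) (h' : D.Reach v w) : D.Reach u w :=
  ReflTransGen.head h h'

theorem Reach.cases_head {u w : W} (h : D.Reach u w) : u = w ∨ ∃ v, D.arc u v ∧ D.Reach v w :=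
  ReflTransGen.cases_head h

theorem Reach.trans {u v w : W} (h : D.Reach u v) (h' : D.Reach v w) : D.Reach u w :=
  ReflTransGen.trans h h'

theorem Shared.of_arc {u v : W} (h : D.arc u v) : D.Shared v → D.Shared u := by
  rintro ⟨j, j', hj, h₁, h₂⟩
  exact ⟨j, j', hj, h₁.head h, h₂.head h⟩

/-- `v` has property `p` and is the first such vertex in the enumeration `o`. -/
def First (o : W → ℕ) (p : W → Prop) (v : W) : Prop := p v ∧ ∀ x, p x → o v ≤ o x

theorem First.unique {o : W → ℕ} (ho : Function.Injective o) {p : W → Prop} {v w : W}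
    (hv : First o p v) (hw : First o p w) : v = w :=
  ho (le_antisymm (hv.2 w hw.1) (hw.2 v hv.1))

theorem First.exists {o : W → ℕ} {p : W → Prop} (h : ∃ x, p x) : ∃ v, First o p v := by
  obtain ⟨v, hv, hmin⟩ := (InvImage.wf o Nat.lt_wfRel.wf).has_min {x | p x} h
  exact ⟨v, hv, fun x hx => not_lt.1 (hmin x hx)⟩

namespace IsGood

variable (hD : D.IsGood)
include hD

theorem reach_antisymm {u v : W} (h : D.Reach u v) (h' : D.Reach v u) : u = v := by
  obtain ⟨ht, hht⟩ := hD.height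
  have mono : ∀ {a b : W}, D.Reach a b → ht a ≤ ht b := by
    intro a b hab
    induction hab with
    | refl => exact le_rfl
    | tail _ h ih => exact ih.trans (hht _ _ h).le
  rcases h.cases_head with rfl | ⟨w, hw, hwv⟩
  · rfl
  · have := hht _ _ hw
    have := mono (hwv.trans h')
    omega

theorem not_arc_of_reach {u v : W} (h : D.Reach v u) : ¬ D.arc u v := by
  intro h'
  obtain rfl := hD.reach_antisymm h (ReflTransGen.single h')
  obtain ⟨ht, hht⟩ := hD.height
  exact (hht _ _ h').false

theorem reach_term_iff {j : Fin 3} {v : W} : D.Reach (D.term j) v ↔ D.term j = v := by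
  constructor
  · intro h
    rcases h.cases_head with h | ⟨x, hx, -⟩
    · exact h
    · exact (hD.not_term_arc _ _ hx).elim
  · rintro rfl; exact .refl

theorem not_shared_term (j : Fin 3) : ¬ D.Shared (D.term j) := by
  rintro ⟨j₁, j₂, hj, h₁, h₂⟩
  rw [hD.reach_term_iff] at h₁ h₂
  exact hj (hD.term_injective (h₁.symm.trans h₂))

theorem own_term (j : Fin 3) : D.Own j (D.term j) := ⟨.refl, hD.not_shared_term j⟩

end IsGood

end SumDigraph

namespace SumDigraph

open Relation

variable {W : Type*} {D : SumDigraph W}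

/-! ### The code of a hub pair -/

/-- The arcs used by the code that collects the sum at two hubs and spreads it from there:
behind the hubs every vertex listens to one predecessor, and before the hubs every vertex talks to
one successor, or, if none of its successors reaches both hubs, to one successor for each hub. -/
def HubArc (D : SumDigraph W) (o : W → ℕ) (y z u v : W) : Prop :=
  ((D.Reach y v ∨ D.Reach z v) ∧ v ≠ y ∧ v ≠ z ∧
    First o (fun x => D.arc x v ∧ (D.Reach y x ∨ D.Reach z x)) u) ∨
  ((∃ x, D.arc u x ∧ D.Reach x y ∧ D.Reach x z) ∧
    First o (fun x => D.arc u x ∧ D.Reach x y ∧ D.Reach x z) v) ∨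
  ((¬ ∃ x, D.arc u x ∧ D.Reach x y ∧ D.Reach x z) ∧
    (First o (fun x => D.arc u x ∧ D.Reach x y) v ∨ First o (fun x => D.arc u x ∧ D.Reach x z) v))

theorem HubArc.symm {o : W → ℕ} {y z u v : W} : D.HubArc o y z u v ↔ D.HubArc o z y u v := by
  have h : (fun x => D.arc u x ∧ D.Reach x y ∧ D.Reach x z) =
      fun x => D.arc u x ∧ D.Reach x z ∧ D.Reach x y := by
    funext x; rw [and_comm (a := D.Reach x y)]
  have h' : (fun x => D.arc x v ∧ (D.Reach y x ∨ D.Reach z x)) =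
      fun x => D.arc x v ∧ (D.Reach z x ∨ D.Reach y x) := by
    funext x; rw [or_comm]
  unfold HubArc
  rw [h, h', or_comm (a := D.Reach y v), and_left_comm (a := v ≠ y),
    or_comm (a := First o (fun x => D.arc u x ∧ D.Reach x y) v)]

theorem IsHubPair.symm {y z : W} (h : D.IsHubPair y z) : D.IsHubPair z y where
  src_left := h.src_right
  src_right := h.src_left
  incomparable := by
    rcases h.incomparable with h | h
    · exact .inl h.symm
    · exact .inr h.symm
  term j := (h.term j).symm

theorem HubArc.arc {o : W → ℕ} {y z u v : W} (h : D.HubArc o y z u v) : D.arc u v := by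
  rcases h with ⟨-, -, -, h⟩ | ⟨-, h⟩ | ⟨-, h | h⟩ <;> exact h.1.1

/-- A vertex behind a hub reaches no hub. -/
theorem IsHubPair.not_reach_left (hD : D.IsGood) {y z v : W} (h : D.IsHubPair y z)
    (hv : D.Reach y v ∨ D.Reach z v) (hy : v ≠ y) : ¬ D.Reach v y := by
  intro hvy
  rcases hv with hv | hv
  · exact hy (hD.reach_antisymm hvy hv)
  · rcases h.incomparable with rfl | ⟨-, h2⟩
    · exact hy (hD.reach_antisymm hvy hv)
    · exact h2 (hv.trans hvy)

/-- This is how the absence of a hub pair enters the multicast case. If all sources reach the shared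
vertex `a`, then `(a, a)` is a hub pair when `a` reaches all terminals. Otherwise `a` misses exactly
one terminal, and `a` together with that terminal is a hub pair. -/
theorem not_src_of_not_hub (hD : D.IsGood) (h : ¬ ∃ y z, D.IsHubPair y z) {a : W}
    (ha : D.Shared a) : ∃ i, ¬ D.Reach (D.src i) a := by
  by_contra! hs
  obtain ⟨j₁, j₂, hj, h₁, h₂⟩ := ha
  by_cases hall : ∀ j, D.Reach a (D.term j)
  · exact h ⟨a, a, hs, hs, .inl rfl, fun j => .inl (hall j)⟩
  push Not at hall
  obtain ⟨j, hj'⟩ := hall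
  refine h ⟨a, D.term j, hs, fun i => hD.reach i j, .inr ⟨hj', fun h => ?_⟩, fun j' => ?_⟩
  · rw [hD.reach_term_iff] at h
    exact hj' (h ▸ .refl)
  · by_cases hjj : j' = j
    · exact .inr (hjj ▸ .refl)
    · left
      have : j' = j₁ ∨ j' = j₂ := by
        have : j ≠ j₁ := by rintro rfl; exact hj' h₁
        have : j ≠ j₂ := by rintro rfl; exact hj' h₂
        omega
      rcases this with rfl | rfl <;> assumption

variable [Fintype W] {F : Type*} [CommRing F]

/-- A conservation law on the set of vertices that reach `y`. Every vertex of this set except `y`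
has exactly one used arc into the set, and vertices outside have none. Adding the signal equations
over the set, all signals cancel except that of `y` on one side and those of the sources on the
other. -/
theorem sum_src_eq_of_hub (hD : D.IsGood) {o : W → ℕ} (ho : Function.Injective o) {y z : W}
    (h : D.IsHubPair y z) {c : W → W → F} (hc1 : ∀ u v, D.HubArc o y z u v → c u v = 1)
    (hc0 : ∀ u v, ¬ D.HubArc o y z u v → c u v = 0) {Y : W → F}
    (hY : ∀ v, (∀ i, v ≠ D.src i) → Y v = ∑ u, c u v * Y u) : Y y = ∑ i, Y (D.src i) := by
  classical
  have key : ∀ u, (if D.Reach u y then (1 : F) else 0) =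
      (∑ v, c u v * if D.Reach v y then 1 else 0) + if u = y then 1 else 0 := by
    intro u
    by_cases hu : D.Reach u y
    swap
    · rw [if_neg hu, if_neg (by rintro rfl; exact hu .refl), add_zero, Finset.sum_eq_zero]
      intro v _
      by_cases hv : D.Reach v y
      · rw [hc0 u v (fun h => hu (hv.head h.arc)), zero_mul]
      · rw [if_neg hv, mul_zero]
    rw [if_pos hu]
    by_cases huy : u = y
    · rw [if_pos huy, Finset.sum_eq_zero, zero_add]
      intro v _
      by_cases hv : D.Reach v y
      · rw [hc0 u v (fun h => hD.not_arc_of_reach (huy ▸ hv) h.arc), zero_mul]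
      · rw [if_neg hv, mul_zero]
    rw [if_neg huy, add_zero]
    obtain ⟨x, hux, hxy⟩ : ∃ x, D.arc u x ∧ D.Reach x y := by
      rcases hu.cases_head with h | h
      · exact (huy h).elim
      · exact h
    -- A successor that reaches both hubs serves both; only if there is none does `u` use separate
    -- successors. Hence the arc chosen for `z` never brings a second copy to `y`.
    obtain ⟨w, hwy, huw, hw⟩ : ∃ w, D.Reach w y ∧ D.HubArc o y z u w ∧
        ∀ v, D.Reach v y → D.HubArc o y z u v → v = w := by
      have h1 : ∀ {v}, D.Reach v y → ¬ ((D.Reach y v ∨ D.Reach z v) ∧ v ≠ y ∧ v ≠ z ∧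
          First o (fun x => D.arc x v ∧ (D.Reach y x ∨ D.Reach z x)) u) :=
        fun hv h' => h.not_reach_left hD h'.1 h'.2.1 hv
      by_cases hR : ∃ x, D.arc u x ∧ D.Reach x y ∧ D.Reach x z
      · obtain ⟨w, hw⟩ := First.exists (o := o) hR
        refine ⟨w, hw.1.2.1, .inr (.inl ⟨hR, hw⟩), fun v hv huv => ?_⟩
        rcases huv with h' | ⟨-, h'⟩ | ⟨h', -⟩
        · exact (h1 hv h').elim
        · exact h'.unique ho hw
        · exact (h' hR).elim
      · obtain ⟨w, hw⟩ := First.exists (o := o) (p := fun x => D.arc u x ∧ D.Reach x y) ⟨x, hux, hxy⟩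
        refine ⟨w, hw.1.2, .inr (.inr ⟨hR, .inl hw⟩), fun v hv huv => ?_⟩
        rcases huv with h' | ⟨h', -⟩ | ⟨-, h' | h'⟩
        · exact (h1 hv h').elim
        · exact (hR h').elim
        · exact h'.unique ho hw
        · exact (hR ⟨v, h'.1.1, hv, h'.1.2⟩).elim
    rw [Finset.sum_eq_single w]
    · rw [hc1 _ _ huw, if_pos hwy, mul_one]
    · intro v _ hvw
      by_cases hv : D.Reach v y
      · rw [hc0 u v (fun h => hvw (hw v hv h)), zero_mul]
      · rw [if_neg hv, mul_zero]
    · simp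
  have hsrc : ∀ v, v ∉ Finset.univ.image D.src → ∀ i, v ≠ D.src i := by
    intro v hv i h
    exact hv (by simp [h])
  -- The sources receive nothing and contribute their own symbols; all other vertices satisfy the
  -- signal equation.
  have h1 : ∑ v, (if D.Reach v y then 1 else 0) * Y v =
      ∑ v, (if D.Reach v y then 1 else 0) * ∑ u, c u v * Y u + ∑ i, Y (D.src i) := by
    have h3 : ∀ v, (if D.Reach v y then 1 else 0) * Y v =
        (if D.Reach v y then 1 else 0) * (∑ u, c u v * Y u) +
          if v ∈ Finset.univ.image D.src then Y v else 0 := by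
      intro v
      by_cases hv : v ∈ Finset.univ.image D.src
      · obtain ⟨i, rfl⟩ : ∃ i, D.src i = v := by simpa using hv
        have : ∑ u, c u (D.src i) * Y u = 0 := Finset.sum_eq_zero fun u _ => by
          rw [hc0 _ _ (fun h => hD.not_arc_src _ _ h.arc), zero_mul]
        rw [if_pos hv, this, if_pos (h.src_left i)]; ring
      · rw [if_neg hv, add_zero, ← hY v (hsrc v hv)]
    rw [Finset.sum_congr rfl fun v _ => h3 v, Finset.sum_add_distrib, Finset.sum_ite_mem,
      Finset.univ_inter, Finset.sum_image fun a _ b _ hab => hD.src_injective hab]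
  have h2 : ∑ v, (if D.Reach v y then 1 else 0) * ∑ u, c u v * Y u =
      ∑ u, (∑ v, c u v * if D.Reach v y then 1 else 0) * Y u := by
    simp_rw [Finset.mul_sum, Finset.sum_mul]
    rw [Finset.sum_comm]
    exact Finset.sum_congr rfl fun _ _ => Finset.sum_congr rfl fun _ _ => by ring
  rw [h2, Finset.sum_congr rfl fun v _ => congrArg (· * Y v) (key v)] at h1
  simp only [add_mul, Finset.sum_add_distrib, ite_mul, one_mul, zero_mul, Finset.sum_ite_eq',
    Finset.mem_univ, if_true] at h1
  exact add_left_cancel h1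

/-- Both hubs hold the sum by the conservation law, applied to either order of the pair. Behind them
each vertex copies one predecessor that is a hub or behind one, so induction along the height
carries the sum to the terminals. -/
theorem solves_of_hub (hD : D.IsGood) {o : W → ℕ} (ho : Function.Injective o) {y z : W}
    (h : D.IsHubPair y z) {c : W → W → F} (hc1 : ∀ u v, D.HubArc o y z u v → c u v = 1)
    (hc0 : ∀ u v, ¬ D.HubArc o y z u v → c u v = 0) : D.Solves c := by
  refine ⟨fun u v huv => hc0 u v fun h => huv h.arc, fun Y hY j => ?_⟩
  have hy := sum_src_eq_of_hub hD ho h hc1 hc0 hY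
  have hz := sum_src_eq_of_hub hD ho h.symm (fun u v h => hc1 u v (HubArc.symm.1 h))
    (fun u v h => hc0 u v (mt HubArc.symm.1 h)) hY
  obtain ⟨ht, hht⟩ := hD.height
  have all : ∀ n v, ht v = n → (D.Reach y v ∨ D.Reach z v) → Y v = ∑ i, Y (D.src i) := by
    intro n
    induction n using Nat.strong_induction_on with
    | _ n ih =>
    rintro v rfl hv
    by_cases hvy : v = y
    · rw [hvy, hy]
    by_cases hvz : v = z
    · rw [hvz, hz]
    obtain ⟨x, hxv, hx⟩ : ∃ x, D.arc x v ∧ (D.Reach y x ∨ D.Reach z x) := by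
      rcases hv with hv | hv
      · rcases ReflTransGen.cases_tail hv with h | ⟨x, hx, hxv⟩
        · exact (hvy h).elim
        · exact ⟨x, hxv, .inl hx⟩
      · rcases ReflTransGen.cases_tail hv with h | ⟨x, hx, hxv⟩
        · exact (hvz h).elim
        · exact ⟨x, hxv, .inr hx⟩
    obtain ⟨w, hw⟩ := First.exists (o := o)
      (p := fun x => D.arc x v ∧ (D.Reach y x ∨ D.Reach z x)) ⟨x, hxv, hx⟩
    have hvs : ∀ i, v ≠ D.src i := by rintro i rfl; exact hD.not_arc_src _ _ hxv
    rw [hY v hvs, Finset.sum_eq_single w]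
    · rw [hc1 w v (.inl ⟨hv, hvy, hvz, hw⟩), one_mul, ih _ (hht _ _ hw.1.1) w rfl hw.1.2]
    · intro u _ huw
      rw [hc0 u v, zero_mul]
      have hny := h.not_reach_left hD hv hvy
      have hnz := h.symm.not_reach_left hD hv.symm hvz
      -- A vertex behind the hubs reaches no hub, so the collecting arcs cannot enter it.
      rintro (h' | ⟨-, h'⟩ | ⟨-, h' | h'⟩)
      · exact huw (h'.2.2.2.unique ho hw)
      · exact hny h'.1.2.1
      · exact hny h'.1.2
      · exact hnz h'.1.2
    · simp
  exact all _ _ rfl (h.term j)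

/-! ### The code of a multicast to the gates -/

/-- Coefficients that carry the sum: into shared vertices given by `val`, from the gates of a
terminal given by `val` at the terminal, and beyond them every vertex talks to one successor. -/
structure IsMulticastCode (D : SumDigraph W) (o : W → ℕ) (val c : W → W → F) :
    Prop where
  shared : ∀ u v, D.Shared v → (∀ i, v ≠ D.src i) → c u v = val v u
  src : ∀ u i, c u (D.src i) = 0
  own : ∀ u v j, D.Own j v → D.Own j u → First o (fun x => D.arc u x ∧ D.Own j x) v → c u v = 1
  gate : ∀ u v j, D.Own j v → ¬ D.Own j u → First o (fun x => D.arc u x ∧ D.Own j x) v →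
    c u v = val (D.term j) u
  not_first : ∀ u v j, D.Own j v → ¬ First o (fun x => D.arc u x ∧ D.Own j x) v → c u v = 0
  useless : ∀ u v, (∀ j, ¬ D.Reach v (D.term j)) → c u v = 0

theorem solves_of_multicast (hD : D.IsGood) {o : W → ℕ} (ho : Function.Injective o)
    {val c : W → W → F} {g : W → Fin 3 → F} (hc : D.IsMulticastCode o val c)
    (hg : ∀ i l, g (D.src i) l = if i = l then 1 else 0)
    (hval : ∀ u v, D.Shared v → (∀ i, v ≠ D.src i) → ¬ D.arc u v → val v u = 0)
    (hvalg : ∀ v l, D.Shared v → (∀ i, v ≠ D.src i) → ∑ u, val v u * g u l = g v l)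
    (hdec : ∀ j u, ¬ D.Gate j u → val (D.term j) u = 0)
    (hdecg : ∀ j l, ∑ u, val (D.term j) u * g u l = 1) : D.Solves c := by
  classical
  constructor
  · intro u v huv
    by_cases hsh : D.Shared v
    · by_cases hs : ∃ i, v = D.src i
      · obtain ⟨i, rfl⟩ := hs; exact hc.src u i
      · push Not at hs
        rw [hc.shared u v hsh hs, hval u v hsh hs huv]
    · by_cases hr : ∃ j, D.Reach v (D.term j)
      · obtain ⟨j, hj⟩ := hr
        exact hc.not_first u v j ⟨hj, hsh⟩ fun h => huv h.1.1
      · push Not at hr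
        exact hc.useless u v hr
  intro Y hY j
  obtain ⟨ht, hht⟩ := hD.height
  have hshared : ∀ n v, ht v = n → D.Shared v → Y v = ∑ l, g v l * Y (D.src l) := by
    intro n
    induction n using Nat.strong_induction_on with
    | _ n ih =>
    rintro v rfl hv
    by_cases hs : ∃ i, v = D.src i
    · obtain ⟨i, rfl⟩ := hs
      simp [hg]
    push Not at hs
    rw [hY v hs]
    have : ∀ u, c u v * Y u = val v u * ∑ l, g u l * Y (D.src l) := by
      intro u
      rw [hc.shared u v hv hs]
      by_cases hu : D.arc u v
      · rw [ih _ (hht _ _ hu) u rfl (hv.of_arc hu)]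
      · rw [hval u v hv hs hu]; simp
    simp_rw [this, Finset.mul_sum]
    rw [Finset.sum_comm]
    refine Finset.sum_congr rfl fun l _ => ?_
    rw [← hvalg v l hv hs, Finset.sum_mul]
    exact Finset.sum_congr rfl fun u _ => by ring
  -- The total weight that `u` sends into the region of `j`: 1 if `u` lies in the region and is not
  -- the terminal, the decoding weight if `u` is a gate, and 0 otherwise. Regions of different
  -- terminals are disjoint and each vertex uses one successor per region, so nothing is counted
  -- twice.
  have hcol : ∀ u, ∑ v, (if D.Own j v then c u v else 0) =
      (if D.Own j u then 1 else 0) - (if u = D.term j then 1 else 0) + val (D.term j) u := by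
    intro u
    by_cases hx : ∃ x, D.arc u x ∧ D.Own j x
    · obtain ⟨w, hw⟩ := First.exists (o := o) hx
      have hut : u ≠ D.term j := by rintro rfl; exact hD.not_term_arc _ _ hw.1.1
      rw [Finset.sum_eq_single w, if_pos hw.1.2, if_neg hut]
      · by_cases hu : D.Own j u
        · rw [hc.own u w j hw.1.2 hu hw, hdec j u (fun h => hu.2 h.1), if_pos hu]; ring
        · rw [hc.gate u w j hw.1.2 hu hw, if_neg hu]; ring
      · intro v _ hvw
        split
        · rename_i hv
          exact hc.not_first u v j hv fun h => hvw (h.unique ho hw)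
        · rfl
      · simp
    · rw [Finset.sum_eq_zero, hdec j u (fun h => hx h.2), add_zero]
      · by_cases hu : D.Own j u
        · rcases hu.1.cases_head with h | ⟨x, hux, hxt⟩
          · rw [if_pos hu, if_pos h, sub_self]
          · exact (hx ⟨x, hux, hxt, fun h => hu.2 (h.of_arc hux)⟩).elim
        · rw [if_neg hu, if_neg, sub_zero]
          rintro rfl; exact hu (hD.own_term j)
      · intro v _
        split
        · rename_i hv
          exact hc.not_first u v j hv fun h => hx ⟨v, h.1⟩
        · rfl
  have hsum : ∑ v, (if D.Own j v then Y v else 0) =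
      ∑ u, (∑ v, if D.Own j v then c u v else 0) * Y u := by
    simp_rw [Finset.sum_mul]
    rw [Finset.sum_comm]
    refine Finset.sum_congr rfl fun v _ => ?_
    split
    · rename_i hv
      refine hY v ?_
      rintro i rfl
      refine hv.2 ?_
      rcases (by omega : j ≠ 0 ∨ j ≠ 1) with h | h
      · exact ⟨j, 0, h, hD.reach _ _, hD.reach _ _⟩
      · exact ⟨j, 1, h, hD.reach _ _, hD.reach _ _⟩
    · simp
  simp_rw [hcol] at hsum
  simp only [add_mul, sub_mul, Finset.sum_add_distrib, Finset.sum_sub_distrib, ite_mul, one_mul,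
    zero_mul, Finset.sum_ite_eq', Finset.mem_univ, if_true] at hsum
  have hres : ∑ u, val (D.term j) u * Y u = ∑ i, Y (D.src i) := by
    have : ∀ u, val (D.term j) u * Y u = val (D.term j) u * ∑ l, g u l * Y (D.src l) := by
      intro u
      by_cases hu : D.Gate j u
      · rw [hshared _ u rfl hu.1]
      · rw [hdec j u hu]; simp
    simp_rw [this, Finset.mul_sum]
    rw [Finset.sum_comm]
    refine Finset.sum_congr rfl fun l _ => ?_
    have h1 : ∑ u, val (D.term j) u * (g u l * Y (D.src l)) =
        (∑ u, val (D.term j) u * g u l) * Y (D.src l) := by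
      rw [Finset.sum_mul]
      exact Finset.sum_congr rfl fun u _ => by ring
    rw [h1, hdecg, one_mul]
  rw [hres] at hsum
  linear_combination hsum

end SumDigraph

/-! ### Multicast to the gates -/

/-- Over a field with more than `s.card` elements, a subspace not contained in any of the subspaces
`H j` contains a vector outside all of them. -/
theorem Submodule.exists_mem_forall_notMem {ι F M : Type*} [Field F] [Finite F] [AddCommGroup M]
    [Module F M] (U : Submodule F M) (H : ι → Submodule F M) (s : Finset ι)
    (hs : s.card < Nat.card F) (h : ∀ j ∈ s, ¬ U ≤ H j) : ∃ x ∈ U, ∀ j ∈ s, x ∉ H j := by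
  classical
  have := Fintype.ofFinite F
  induction s using Finset.induction_on with
  | empty => exact ⟨0, U.zero_mem, by simp⟩
  | insert a s ha ih =>
    rw [Finset.card_insert_of_notMem ha] at hs
    obtain ⟨x, hxU, hx⟩ := ih (by omega) fun j hj => h j (Finset.mem_insert_of_mem hj)
    obtain ⟨y, hyU, hy⟩ := SetLike.not_le_iff_exists.1 (h a (Finset.mem_insert_self _ _))
    -- On the line `x + r • y` each subspace contains at most one point: two points would put both
    -- `y` and `x` into it, but `y` is outside `H a` and `x` is outside the others. Fewer subspaces
    -- than scalars leave a point free.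
    obtain ⟨r, -, hr⟩ : ∃ r ∈ (Finset.univ : Finset F),
        r ∉ (insert a s).biUnion fun j => Finset.univ.filter fun r : F => x + r • y ∈ H j := by
      refine Finset.exists_mem_notMem_of_card_lt_card (lt_of_le_of_lt Finset.card_biUnion_le ?_)
      refine lt_of_le_of_lt (Finset.sum_le_card_nsmul _ _ 1 fun j hj => ?_) ?_
      · rw [Finset.card_le_one]
        intro r hr r' hr'
        simp only [Finset.mem_filter, Finset.mem_univ, true_and] at hr hr'
        by_contra hne
        have h1 : (r - r') • y ∈ H j := by
          have := (H j).sub_mem hr hr'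
          rwa [add_sub_add_left_eq_sub, ← sub_smul] at this
        have hyj : y ∈ H j := ((H j).smul_mem_iff (sub_ne_zero.2 hne)).1 h1
        rcases Finset.mem_insert.1 hj with rfl | hj
        · exact hy hyj
        · refine hx j hj ?_
          have := (H j).sub_mem hr ((H j).smul_mem r hyj)
          rwa [add_sub_cancel_right] at this
      · rw [Finset.card_insert_of_notMem ha, Finset.card_univ, ← Nat.card_eq_fintype_card]
        simpa using hs
    refine ⟨x + r • y, U.add_mem hxU (U.smul_mem _ hyU), fun j hj hmem => hr ?_⟩
    exact Finset.mem_biUnion.2 ⟨j, hj, by simpa using hmem⟩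

namespace SumDigraph

open Module Submodule Relation

variable {W : Type*} {F : Type*} [Field F]

/-- `X` contains the targets outside `C` and is closed under taking predecessors outside `C` of
shared vertices that have not been processed. -/
def Closed (D : SumDigraph W) (B : W → Prop) (P C X : Finset W) : Prop :=
  (∀ b, B b → b ∉ C → b ∈ X) ∧
    ∀ u v, D.arc u v → D.Shared v → v ∈ X → v ∉ P → u ∉ C → u ∈ X

/-- The space spanned by the vectors of the processed vertices in `X`. -/
def spanOf (g : W → Fin 3 → F) (P X : Finset W) : Submodule F (Fin 3 → F) :=
  span F (g '' {u | u ∈ X ∧ u ∈ P})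

/-- After the vertices in `P` have obtained their vectors, the targets can still obtain the whole
space. -/
def Open (D : SumDigraph W) (B : W → Prop) (P : Finset W) (g : W → Fin 3 → F) : Prop :=
  ∀ C X : Finset W, (∀ c ∈ C, D.Shared c ∧ c ∉ P) → D.Closed B P C X →
    3 ≤ finrank F (spanOf g P X) + C.card

variable {D : SumDigraph W} {B : W → Prop} {g : W → Fin 3 → F} {P : Finset W}

theorem spanOf_mono {X X' : Finset W} (h : X ⊆ X') : spanOf g P X ≤ spanOf g P X' :=
  span_mono (Set.image_mono fun _ hu => ⟨h hu.1, hu.2⟩)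

variable [DecidableEq W]

theorem spanOf_union (X X' : Finset W) : spanOf g P (X ∪ X') = spanOf g P X ⊔ spanOf g P X' := by
  rw [spanOf, spanOf, spanOf, ← span_union, ← Set.image_union]
  congr 2
  ext u
  simp [or_and_right]

theorem finrank_spanOf_union_add_inter_le (X X' : Finset W) :
    finrank F (spanOf g P (X ∪ X')) + finrank F (spanOf g P (X ∩ X')) ≤
      finrank F (spanOf g P X) + finrank F (spanOf g P X') := by
  rw [← Submodule.finrank_sup_add_finrank_inf_eq (spanOf g P X), spanOf_union]
  exact Nat.add_le_add_left (Submodule.finrank_mono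
    (le_inf (spanOf_mono Finset.inter_subset_left) (spanOf_mono Finset.inter_subset_right))) _

/-- One half of the uncrossing: a cut vertex already contained in the union of the closed sets is no
longer needed in the cut. -/
theorem Closed.union {C C' X X' : Finset W} (h : D.Closed B P C X) (h' : D.Closed B P C' X') :
    D.Closed B P ((C ∪ C') \ (X ∪ X')) (X ∪ X') := by
  constructor
  · intro b hb hbC
    by_contra hbX
    simp only [Finset.mem_union, Finset.mem_sdiff, not_or, not_and, not_not] at hbC hbX
    by_cases hC : b ∈ C
    · exact hbX.2 (hbC (.inl hC) hbX.1)
    · exact hbX.1 (h.1 b hb hC)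
  · intro u v huv hv hvX hvP huC
    by_contra huX
    simp only [Finset.mem_union, Finset.mem_sdiff, not_or, not_and, not_not] at huC huX hvX
    rcases hvX with hvX | hvX
    · by_cases hC : u ∈ C
      · exact huX.2 (huC (.inl hC) huX.1)
      · exact huX.1 (h.2 u v huv hv hvX hvP hC)
    · by_cases hC : u ∈ C'
      · exact huX.2 (huC (.inr hC) huX.1)
      · exact huX.2 (h'.2 u v huv hv hvX hvP hC)

/-- The other half. For the intersection the cut must contain the vertices that one side cuts and
the other side either cuts or contains. -/
theorem Closed.inter {C C' X X' : Finset W} (h : D.Closed B P C X) (h' : D.Closed B P C' X') :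
    D.Closed B P (((C ∩ C') ∪ (C ∩ X') ∪ (C' ∩ X)) \ (X ∩ X')) (X ∩ X') := by
  have key : ∀ u, (u ∉ C → u ∈ X) → (u ∉ C' → u ∈ X') →
      u ∉ ((C ∩ C') ∪ (C ∩ X') ∪ (C' ∩ X)) \ (X ∩ X') → u ∈ X ∩ X' := by
    intro u h1 h2 h3
    simp only [Finset.mem_union, Finset.mem_sdiff, Finset.mem_inter] at h3 ⊢
    tauto
  refine ⟨fun b hb hbC => key b (h.1 b hb) (h'.1 b hb) hbC, fun u v huv hv hvX hvP huC => ?_⟩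
  rw [Finset.mem_inter] at hvX
  exact key u (h.2 u v huv hv hvX.1 hvP) (h'.2 u v huv hv hvX.2 hvP) huC

/-- Submodularity of the cut size. Each vertex is counted on the left at most as often as on the
right, because the union of the two new cuts lies in `C ∪ C'` and their intersection in `C ∩ C'`. -/
theorem card_uncross_le (C C' X X' : Finset W) :
    ((C ∪ C') \ (X ∪ X')).card + (((C ∩ C') ∪ (C ∩ X') ∪ (C' ∩ X)) \ (X ∩ X')).card ≤
      C.card + C'.card := by
  rw [← Finset.card_union_add_card_inter, ← Finset.card_union_add_card_inter C C']
  refine Nat.add_le_add (Finset.card_le_card fun u => ?_) (Finset.card_le_card fun u => ?_)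
  · simp only [Finset.mem_union, Finset.mem_sdiff, Finset.mem_inter]; tauto
  · simp only [Finset.mem_union, Finset.mem_sdiff, Finset.mem_inter]; tauto

variable [Fintype W]

/-- The vectors to be avoided at the next vertex `v` on account of one target set form a
subspace. -/
theorem Open.exists_forbidden (h : D.Open B P g) {v : W} (hv : D.Shared v) (hvP : v ∉ P)
    (hpred : ∀ u, D.arc u v → u ∈ P) :
    (∀ x, D.Open B (insert v P) (Function.update g v x)) ∨ ∃ H : Submodule F (Fin 3 → F),
      ¬ span F (g '' {u | D.arc u v}) ≤ H ∧
      ∀ x, x ∉ H → D.Open B (insert v P) (Function.update g v x) := by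
  classical
  -- The closed sets around `v` that violate the invariant unless the vector of `v` raises their
  -- rank.
  let Bad (X : Finset W) : Prop := v ∈ X ∧ ∃ C : Finset W, (∀ c ∈ C, D.Shared c ∧ c ∉ insert v P) ∧
    D.Closed B (insert v P) C X ∧ finrank F (spanOf g P X) + C.card ≤ 2
  -- Marking `v` as processed lowers the bound by at most one: before, `v` could have been put into
  -- the cut instead. So bad sets attain the value 2 exactly.
  have low : ∀ C X : Finset W, (∀ c ∈ C, D.Shared c ∧ c ∉ insert v P) →
      D.Closed B (insert v P) C X → 2 ≤ finrank F (spanOf g P X) + C.card := by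
    intro C X hC hX
    have := h (insert v C) (X.erase v) (by
      intro c hc
      rcases Finset.mem_insert.1 hc with rfl | hc
      · exact ⟨hv, hvP⟩
      · exact ⟨(hC c hc).1, fun h => (hC c hc).2 (Finset.mem_insert_of_mem h)⟩) (by
      constructor
      · intro b hb hbC
        rw [Finset.mem_insert, not_or] at hbC
        exact Finset.mem_erase.2 ⟨hbC.1, hX.1 b hb hbC.2⟩
      · intro u w huw hw hwX hwP huC
        rw [Finset.mem_insert, not_or] at huC
        rw [Finset.mem_erase] at hwX ⊢
        exact ⟨huC.1, hX.2 u w huw hw hwX.2 (by simp [hwX.1, hwP]) huC.2⟩)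
    have h1 := Submodule.finrank_mono (spanOf_mono (g := g) (P := P) (Finset.erase_subset v X))
    have h2 := Finset.card_insert_le v C
    omega
  have spanNew : ∀ (x : Fin 3 → F) (X : Finset W),
      spanOf g P X ≤ spanOf (Function.update g v x) (insert v P) X := by
    intro x X
    refine span_le.2 ?_
    rintro _ ⟨u, ⟨huX, huP⟩, rfl⟩
    refine subset_span ⟨u, ⟨huX, Finset.mem_insert_of_mem huP⟩, ?_⟩
    rw [Function.update_of_ne]
    rintro rfl; exact hvP huP
  have good : ∀ x, (∀ X, Bad X → x ∉ spanOf g P X) →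
      D.Open B (insert v P) (Function.update g v x) := by
    intro x hx C X hC hX
    have hmono := Submodule.finrank_mono (spanNew x X)
    by_contra hlt
    have hlow := low C X hC hX
    have hCP : ∀ c ∈ C, D.Shared c ∧ c ∉ P := fun c hc =>
      ⟨(hC c hc).1, fun h => (hC c hc).2 (Finset.mem_insert_of_mem h)⟩
    by_cases hvX : v ∈ X
    · have hbad : Bad X := ⟨hvX, C, hC, hX, by omega⟩
      have hlt' : spanOf g P X < spanOf (Function.update g v x) (insert v P) X := by
        refine lt_of_le_of_ne (spanNew x X) fun heq => hx X hbad ?_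
        rw [heq]
        exact subset_span ⟨v, ⟨hvX, Finset.mem_insert_self _ _⟩, Function.update_self ..⟩
      have := Submodule.finrank_lt_finrank_of_lt hlt'
      omega
    · have := h C X hCP ⟨hX.1, fun u w huw hw hwX hwP huC => hX.2 u w huw hw hwX (by
        rw [Finset.mem_insert, not_or]
        exact ⟨by rintro rfl; exact hvX hwX, hwP⟩) huC⟩
      omega
  by_cases hex : ∃ X, Bad X
  swap
  · exact .inl fun x => good x fun X hX => (hex ⟨X, hX⟩).elim
  right
  obtain ⟨X, hX⟩ := hex
  -- Bad sets turn out to be closed under union, so one of maximal size contains all of them and its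
  -- span is the only subspace to avoid.
  obtain ⟨Z, hZ, hmax⟩ := Finset.exists_max_image (Finset.univ.filter Bad) Finset.card
    ⟨X, by simpa using hX⟩
  simp only [Finset.mem_filter, Finset.mem_univ, true_and] at hZ hmax
  refine ⟨spanOf g P Z, ?_, fun x hx => good x fun X hX => ?_⟩
  · intro hle
    obtain ⟨hvZ, C, hC, hcl, hrk⟩ := hZ
    have := h C (Z ∪ Finset.univ.filter fun u => D.arc u v)
      (fun c hc => ⟨(hC c hc).1, fun h => (hC c hc).2 (Finset.mem_insert_of_mem h)⟩) (by
      constructor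
      · intro b hb hbC
        exact Finset.mem_union_left _ (hcl.1 b hb hbC)
      · intro u w huw hw hwX hwP huC
        by_cases hwv : w = v
        · subst hwv
          exact Finset.mem_union_right _ (by simpa using huw)
        · refine Finset.mem_union_left _ (hcl.2 u w huw hw ?_ (by simp [hwv, hwP]) huC)
          rcases Finset.mem_union.1 hwX with h | h
          · exact h
          · exact (hwP (hpred w (by simpa using h))).elim)
    rw [spanOf_union, sup_eq_left.2] at this
    · omega
    · refine (span_mono (Set.image_mono ?_)).trans hle
      rintro u ⟨hu, -⟩
      simpa using hu
  · have hU : Bad (X ∪ Z) := by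
      obtain ⟨hvX, C, hC, hcl, hrk⟩ := hX
      obtain ⟨hvZ, C', hC', hcl', hrk'⟩ := hZ
      have hCC : ∀ c, c ∈ C ∨ c ∈ C' → D.Shared c ∧ c ∉ insert v P := by
        rintro c (hc | hc)
        · exact hC c hc
        · exact hC' c hc
      refine ⟨Finset.mem_union_left _ hvX, _, ?_, hcl.union hcl', ?_⟩
      · intro c hc
        exact hCC c (by simpa using (Finset.mem_sdiff.1 hc).1)
      · have h1 := low _ _ (by
          intro c hc
          refine hCC c ?_
          simp only [Finset.mem_union, Finset.mem_sdiff, Finset.mem_inter] at hc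
          tauto) (hcl.inter hcl')
        have h2 := card_uncross_le C C' X Z
        have h3 := finrank_spanOf_union_add_inter_le (g := g) (P := P) X Z
        omega
    have : X ∪ Z = Z := (Finset.eq_of_subset_of_card_le Finset.subset_union_right
      (hmax _ hU)).symm
    exact fun hmem => hx (spanOf_mono (Finset.union_eq_right.1 this) hmem)

/-- The next vertex can choose a combination of the vectors of its predecessors such that all
target sets can still obtain the whole space. -/
theorem Open.exists_step [Finite F] (hF : 4 ≤ Nat.card F) {B : Fin 3 → W → Prop}
    (h : ∀ j, D.Open (B j) P g) {v : W} (hv : D.Shared v) (hvP : v ∉ P)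
    (hpred : ∀ u, D.arc u v → u ∈ P) :
    ∃ x ∈ span F (g '' {u | D.arc u v}),
      ∀ j, D.Open (B j) (insert v P) (Function.update g v x) := by
  classical
  have h1 := fun j => (h j).exists_forbidden hv hvP hpred
  have h2 : ∀ j, ∃ H : Submodule F (Fin 3 → F),
      (¬ ∀ x, D.Open (B j) (insert v P) (Function.update g v x)) →
      ¬ span F (g '' {u | D.arc u v}) ≤ H ∧
      ∀ x, x ∉ H → D.Open (B j) (insert v P) (Function.update g v x) := by
    intro j
    rcases h1 j with h | ⟨H, hH⟩
    · exact ⟨⊥, fun h' => (h' h).elim⟩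
    · exact ⟨H, fun _ => hH⟩
  choose H hH using h2
  -- At most three subspaces matter, one per terminal that forbids anything, and the field has at
  -- least four elements.
  obtain ⟨x, hxU, hx⟩ := Submodule.exists_mem_forall_notMem (span F (g '' {u | D.arc u v})) H
    (Finset.univ.filter fun j =>
      ¬ ∀ x, D.Open (B j) (insert v P) (Function.update g v x))
    (lt_of_le_of_lt (Finset.card_le_univ _) (by simp; omega))
    (fun j hj => (hH j (Finset.mem_filter.1 hj).2).1)
  refine ⟨x, hxU, fun j => ?_⟩
  by_cases hj : ∀ x, D.Open (B j) (insert v P) (Function.update g v x)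
  · exact hj x
  · exact (hH j hj).2 x (hx j (Finset.mem_filter.2 ⟨Finset.mem_univ _, hj⟩))

/-- If there is no hub pair, then at the beginning, when only the sources have their vectors, the
gates of every terminal can obtain the whole space. -/
theorem open_init (hD : D.IsGood) (h : ¬ ∃ y z, D.IsHubPair y z)
    (hg : ∀ i l, g (D.src i) l = if i = l then 1 else 0) (j : Fin 3) :
    D.Open (D.Gate j) (Finset.univ.image D.src) g := by
  classical
  intro C X hC hX
  -- The last shared vertex of a path to terminal `j` that avoids the cut is a gate, hence in `X`.
  -- Closedness then pulls all earlier vertices of the path into `X`, as no vertex after the first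
  -- is a source.
  have back : ∀ {Q : Set W} {u : W}, (∀ c ∈ C, c ∈ Q) →
      ReflTransGen (fun u v => D.arc u v ∧ u ∉ Q) u (D.term j) → D.Shared u → u ∈ X := by
    intro Q u hQ hu
    induction hu using ReflTransGen.head_induction_on with
    | refl => exact fun h => (hD.not_shared_term j h).elim
    | head h hr ih =>
      rename_i a b
      intro ha
      have haC : a ∉ C := fun hc => h.2 (hQ a hc)
      have hbt : D.Reach b (D.term j) := ReflTransGen.mono (fun _ _ h => h.1) _ _ hr
      by_cases hb : D.Shared b
      · refine hX.2 a b h.1 hb (ih hb) ?_ haC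
        intro hbs
        obtain ⟨i, rfl⟩ : ∃ i, D.src i = b := by simpa using hbs
        exact hD.not_arc_src _ _ h.1
      · exact hX.1 a ⟨ha, b, h.1, hbt, hb⟩ haC
  have hsh : ∀ i, D.Shared (D.src i) := fun i => ⟨0, 1, by decide, hD.reach _ _, hD.reach _ _⟩
  have hinner : ∀ c ∈ C, (∀ i, c ≠ D.src i) ∧ ∀ j, c ≠ D.term j := by
    intro c hc
    refine ⟨?_, ?_⟩
    · rintro i rfl; exact (hC _ hc).2 (by simp)
    · rintro j rfl; exact hD.not_shared_term j (hC _ hc).1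
  -- The sources carry the standard basis, so each source in `X` adds one to the rank.
  have hsrc : ∀ (s : Finset (Fin 3)), (∀ i ∈ s, D.src i ∈ X) →
      s.card ≤ finrank F (spanOf g (Finset.univ.image D.src) X) := by
    intro s hs
    have hgi : ∀ i, g (D.src i) = Pi.basisFun F (Fin 3) i := by
      intro i; ext l
      simp [hg, Pi.single_apply, eq_comm]
    have hli : LinearIndependent F fun i : s => g (D.src i) := by
      simp_rw [hgi]
      exact (Pi.basisFun F (Fin 3)).linearIndependent.comp _ Subtype.val_injective
    rw [← Fintype.card_coe, ← finrank_span_eq_card hli]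
    refine Submodule.finrank_mono (span_mono ?_)
    rintro _ ⟨i, rfl⟩
    exact ⟨D.src i, ⟨hs i i.2, by simp⟩, rfl⟩
  rcases Nat.lt_or_ge C.card 1 with h0 | h1
  · have hC0 : C = ∅ := Finset.card_eq_zero.1 (by omega)
    have := hsrc Finset.univ fun i _ => back (Q := ∅) (by simp [hC0])
      (ReflTransGen.mono (fun _ _ h => ⟨h, by simp⟩) _ _ (hD.reach i j)) (hsh i)
    simp at this; omega
  rcases Nat.lt_or_ge C.card 2 with h2 | h2
  · obtain ⟨c, rfl⟩ := Finset.card_eq_one.1 (show C.card = 1 by omega)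
    obtain ⟨hc1, hc2⟩ := hinner c (by simp)
    have := hsrc Finset.univ fun i _ => back (Q := {c}) (by simp)
      (ReflTransGen.mono (fun _ _ h => ⟨h.1, by simpa using h.2⟩) _ _ (hD.connected i j c hc1 hc2))
      (hsh i)
    simp at this; omega
  rcases Nat.lt_or_ge C.card 3 with h3 | h3
  swap
  · omega
  obtain ⟨a, b, hab, rfl⟩ := Finset.card_eq_two.1 (show C.card = 2 by omega)
  -- A source that does not reach `a` has a path to the terminal avoiding `b`, and this path avoids
  -- `a` automatically. So a cut of size 2 still leaves rank 1.
  obtain ⟨i, hi⟩ := not_src_of_not_hub hD h (hC a (by simp)).1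
  obtain ⟨hb1, hb2⟩ := hinner b (by simp)
  have := hsrc {i} fun i' hi' => by
    obtain rfl : i' = i := by simpa using hi'
    refine back (Q := {a, b}) (by simp) ?_ (hsh i')
    have aux : ∀ {u}, ReflTransGen (fun u v => D.arc u v ∧ u ≠ b) u (D.term j) →
        ¬ D.Reach u a → ReflTransGen (fun u v => D.arc u v ∧ u ∉ ({a, b} : Set W)) u (D.term j) := by
      intro u hu
      induction hu using ReflTransGen.head_induction_on with
      | refl => exact fun _ => .refl
      | head h hr ih =>
        intro hna
        refine .head ⟨h.1, ?_⟩ (ih fun hr => hna (hr.head h.1))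
        rintro (rfl | rfl)
        · exact hna .refl
        · exact h.2 rfl
    exact aux (hD.connected i' j b hb1 hb2) hi
  rw [Finset.card_singleton] at this
  rw [Finset.card_pair hab]; omega

/-- When all shared vertices have been processed, the targets span the whole space. -/
theorem Open.span_eq_top {B : W → Prop} (h : D.Open B P g) (hP : ∀ v, D.Shared v → v ∈ P) :
    span F (g '' {u | B u}) = ⊤ := by
  classical
  have := h ∅ (Finset.univ.filter B) (by simp)
    ⟨fun b hb _ => by simpa using hb, fun u v _ hv _ hvP => (hvP (hP v hv)).elim⟩
  refine Submodule.eq_top_of_finrank_eq (le_antisymm (Submodule.finrank_le _) ?_)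
  simp only [Finset.card_empty, add_zero] at this
  rw [finrank_fintype_fun_eq_card, Fintype.card_fin]
  refine this.trans (Submodule.finrank_mono (span_mono (Set.image_mono ?_)))
  rintro u ⟨hu, -⟩
  simpa using hu

end SumDigraph

/-! ### Completing the multicast and solving the sum problem -/

namespace SumDigraph

open Module Submodule Relation

variable {W : Type*} [Fintype W] [DecidableEq W] {F : Type*} [Field F] {D : SumDigraph W}
  {g : W → Fin 3 → F} {P : Finset W}

/-- A partial multicast: the vertices in `P` have obtained vectors. -/
structure Partial (D : SumDigraph W) (P : Finset W) (g : W → Fin 3 → F) : Prop where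
  src_mem : ∀ i, D.src i ∈ P
  src : ∀ i l, g (D.src i) l = if i = l then 1 else 0
  shared : ∀ v ∈ P, D.Shared v
  pred : ∀ v ∈ P, ∀ u, D.arc u v → u ∈ P
  mem_span : ∀ v ∈ P, (∀ i, v ≠ D.src i) → g v ∈ span F (g '' {u | D.arc u v})
  isOpen : ∀ j, D.Open (D.Gate j) P g

theorem partial_init (hD : D.IsGood) (h : ¬ ∃ y z, D.IsHubPair y z)
    (hg : ∀ i l, g (D.src i) l = if i = l then 1 else 0) :
    D.Partial (Finset.univ.image D.src) g where
  src_mem i := by simp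
  src := hg
  shared v hv := by
    obtain ⟨i, rfl⟩ : ∃ i, D.src i = v := by simpa using hv
    exact ⟨0, 1, by decide, hD.reach _ _, hD.reach _ _⟩
  pred v hv u hu := by
    obtain ⟨i, rfl⟩ : ∃ i, D.src i = v := by simpa using hv
    exact (hD.not_arc_src _ _ hu).elim
  mem_span v hv hs := by
    obtain ⟨i, rfl⟩ : ∃ i, D.src i = v := by simpa using hv
    exact (hs i rfl).elim
  isOpen := open_init hD h hg

theorem Partial.insert (h : D.Partial P g) {v : W} (hv : D.Shared v) (hvP : v ∉ P)
    (hpred : ∀ u, D.arc u v → u ∈ P) {x : Fin 3 → F} (hx : x ∈ span F (g '' {u | D.arc u v}))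
    (ho : ∀ j, D.Open (D.Gate j) (insert v P) (Function.update g v x)) :
    D.Partial (insert v P) (Function.update g v x) where
  src_mem i := Finset.mem_insert_of_mem (h.src_mem i)
  src i l := by
    rw [Function.update_of_ne, h.src]
    rintro rfl; exact hvP (h.src_mem i)
  shared w hw := by
    rcases Finset.mem_insert.1 hw with rfl | hw
    · exact hv
    · exact h.shared w hw
  pred w hw u hu := by
    rcases Finset.mem_insert.1 hw with rfl | hw
    · exact Finset.mem_insert_of_mem (hpred u hu)
    · exact Finset.mem_insert_of_mem (h.pred w hw u hu)
  mem_span w hw hs := by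
    have himg : ∀ w, (∀ u, D.arc u w → u ∈ P) →
        Function.update g v x '' {u | D.arc u w} = g '' {u | D.arc u w} := by
      intro w hwP
      refine Set.image_congr fun u hu => Function.update_of_ne ?_ _ _
      rintro rfl; exact hvP (hwP u hu)
    rcases Finset.mem_insert.1 hw with rfl | hwP
    · rwa [himg _ hpred, Function.update_self]
    · rw [himg _ (h.pred w hwP), Function.update_of_ne]
      · exact h.mem_span w hwP hs
      · rintro rfl; exact hvP hwP
  isOpen := ho

/-- An unprocessed shared vertex of least height has only processed predecessors, since predecessors
of shared vertices are shared. It can therefore be processed next, and the number of remaining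
vertices drops. -/
theorem Partial.exists_complete [Finite F] (hF : 4 ≤ Nat.card F) (hD : D.IsGood)
    (h : D.Partial P g) :
    ∃ P' : Finset W, ∃ g' : W → Fin 3 → F, D.Partial P' g' ∧ ∀ v, D.Shared v → v ∈ P' := by
  induction hn : Pᶜ.card using Nat.strong_induction_on generalizing P g with
  | _ n ih =>
  by_cases hall : ∀ v, D.Shared v → v ∈ P
  · exact ⟨P, g, h, hall⟩
  push Not at hall
  obtain ⟨ht, hht⟩ := hD.height
  obtain ⟨v, ⟨hv, hvP⟩, hmin⟩ :=
    (InvImage.wf ht Nat.lt_wfRel.wf).has_min {v | D.Shared v ∧ v ∉ P} hall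
  have hpred : ∀ u, D.arc u v → u ∈ P := by
    intro u hu
    by_contra huP
    exact hmin u ⟨hv.of_arc hu, huP⟩ (hht _ _ hu)
  obtain ⟨x, hx, ho⟩ := Open.exists_step hF h.isOpen hv hvP hpred
  refine ih _ ?_ (h.insert hv hvP hpred hx ho) rfl
  rw [← hn]
  refine Finset.card_lt_card (Finset.ssubset_iff_subset_ne.2 ⟨?_, ?_⟩)
  · exact Finset.compl_subset_compl.2 (Finset.subset_insert _ _)
  · intro heq
    have := compl_injective heq
    exact hvP (this ▸ Finset.mem_insert_self v P)

omit [DecidableEq W] in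
theorem exists_coeff_of_mem_span {S : Set W} {x : Fin 3 → F} (hx : x ∈ span F (g '' S)) :
    ∃ a : W → F, (∀ u, u ∉ S → a u = 0) ∧ ∀ l, ∑ u, a u * g u l = x l := by
  classical
  obtain ⟨a, ha, rfl⟩ := (Finsupp.mem_span_image_iff_linearCombination F).1 hx
  refine ⟨a, fun u hu => ?_, fun l => ?_⟩
  · by_contra h
    exact hu ((Finsupp.mem_supported F a).1 ha (by simpa using h))
  · rw [Finsupp.linearCombination_apply, Finsupp.sum_fintype _ _ (by simp), Finset.sum_apply]
    rfl

/-- The case distinction behind the theorem: a hub pair gives a code with coefficients 0 and 1;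
otherwise a completed multicast provides local coefficients at shared vertices and decoding weights
at the gates. -/
theorem IsGood.exists_solves [Finite F] (hF : 4 ≤ Nat.card F) (hD : D.IsGood) :
    ∃ c : W → W → F, D.Solves c := by
  classical
  let o : W → ℕ := fun w => Fintype.equivFin W w
  have ho : Function.Injective o := fun a b h => (Fintype.equivFin W).injective (Fin.ext h)
  by_cases hub : ∃ y z, D.IsHubPair y z
  · obtain ⟨y, z, h⟩ := hub
    exact ⟨fun u v => if D.HubArc o y z u v then 1 else 0,
      solves_of_hub hD ho h (fun u v h => if_pos h) (fun u v h => if_neg h)⟩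
  let g₀ : W → Fin 3 → F := fun v l => if v = D.src l then 1 else 0
  obtain ⟨P, g, h, hP⟩ := Partial.exists_complete hF hD (partial_init (g := g₀) hD hub
    fun i l => by simp [g₀, hD.src_injective.eq_iff])
  have hex : ∀ v, ∃ a : W → F,
      (D.Shared v → (∀ i, v ≠ D.src i) → (∀ u, ¬ D.arc u v → a u = 0) ∧
        ∀ l, ∑ u, a u * g u l = g v l) ∧
      (∀ j, v = D.term j → (∀ u, ¬ D.Gate j u → a u = 0) ∧ ∀ l, ∑ u, a u * g u l = 1) := by
    intro v
    by_cases hv : D.Shared v ∧ ∀ i, v ≠ D.src i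
    · obtain ⟨a, ha⟩ := exists_coeff_of_mem_span (h.mem_span v (hP v hv.1) hv.2)
      refine ⟨a, fun _ _ => ha, ?_⟩
      rintro j rfl
      exact (hD.not_shared_term j hv.1).elim
    · by_cases ht : ∃ j, v = D.term j
      · obtain ⟨j, rfl⟩ := ht
        have hmem : (1 : Fin 3 → F) ∈ span F (g '' {u | D.Gate j u}) := by
          rw [(h.isOpen j).span_eq_top hP]; trivial
        obtain ⟨a, ha⟩ := exists_coeff_of_mem_span hmem
        refine ⟨a, fun h1 h2 => (hv ⟨h1, h2⟩).elim, fun j' hj' => ?_⟩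
        obtain rfl := hD.term_injective hj'
        exact ha
      · exact ⟨0, fun h1 h2 => (hv ⟨h1, h2⟩).elim, fun j hj => (ht ⟨j, hj⟩).elim⟩
  choose val hval using hex
  -- The cases in order: arcs into sources, the multicast itself, forwarding inside a region,
  -- entering a region from a gate with the decoding weight, and everything else.
  let c : W → W → F := fun u v =>
    if ∃ i, v = D.src i then 0 else
    if D.Shared v then val v u else
    if ∃ j, D.Own j v ∧ First o (fun x => D.arc u x ∧ D.Own j x) v ∧ D.Own j u then 1 else
    if h : ∃ j, D.Own j v ∧ First o (fun x => D.arc u x ∧ D.Own j x) v then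
      val (D.term h.choose) u else 0
  have hsrc : ∀ {v j}, D.Own j v → ¬ ∃ i, v = D.src i := by
    rintro v j hv ⟨i, rfl⟩
    exact hv.2 ⟨0, 1, by decide, hD.reach _ _, hD.reach _ _⟩
  have huniq : ∀ {v j j'}, D.Own j v → D.Own j' v → j = j' := by
    intro v j j' h h'
    by_contra hne
    exact h.2 ⟨j, j', hne, h.1, h'.1⟩
  refine ⟨c, solves_of_multicast hD ho (val := val) (g := g) ⟨?_, ?_, ?_, ?_, ?_, ?_⟩ h.src ?_ ?_ ?_ ?_⟩
  · intro u v hv hs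
    have : ¬ ∃ i, v = D.src i := by push Not; exact hs
    simp only [c]
    rw [if_neg this, if_pos hv]
  · intro u i
    exact if_pos ⟨i, rfl⟩
  · intro u v j hv hu hf
    simp only [c]
    rw [if_neg (hsrc hv), if_neg hv.2, if_pos ⟨j, hv, hf, hu⟩]
  · intro u v j hv hu hf
    have h1 : ¬ ∃ j, D.Own j v ∧ First o (fun x => D.arc u x ∧ D.Own j x) v ∧ D.Own j u := by
      rintro ⟨j', hv', -, hu'⟩
      exact hu (huniq hv hv' ▸ hu')
    have h2 : ∃ j, D.Own j v ∧ First o (fun x => D.arc u x ∧ D.Own j x) v := ⟨j, hv, hf⟩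
    simp only [c]
    rw [if_neg (hsrc hv), if_neg hv.2, if_neg h1, dif_pos h2, huniq h2.choose_spec.1 hv]
  · intro u v j hv hf
    have h2 : ¬ ∃ j, D.Own j v ∧ First o (fun x => D.arc u x ∧ D.Own j x) v := by
      rintro ⟨j', hv', hf'⟩
      exact hf (huniq hv' hv ▸ hf')
    simp only [c]
    rw [if_neg (hsrc hv), if_neg hv.2, if_neg (fun ⟨j, h, h', _⟩ => h2 ⟨j, h, h'⟩), dif_neg h2]
  · intro u v hv
    simp only [c]
    rw [if_neg, if_neg, if_neg, dif_neg]
    · rintro ⟨j, h, -⟩; exact hv j h.1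
    · rintro ⟨j, h, -⟩; exact hv j h.1
    · rintro ⟨j, -, -, h, -⟩; exact hv j h
    · rintro ⟨i, rfl⟩; exact hv 0 (hD.reach i 0)
  · exact fun u v hv hs hu => ((hval v).1 hv hs).1 u hu
  · exact fun v l hv hs => ((hval v).1 hv hs).2 l
  · exact fun j u hu => ((hval _).2 j rfl).1 u hu
  · exact fun j l => ((hval _).2 j rfl).2 l

end SumDigraph

/-! ### The line digraph of a network -/

namespace SumNetwork

open Relation

variable {V E : Type*}

/-- Edges, sources and terminals. -/
abbrev LineVertex (E : Type*) := E ⊕ Fin 3 ⊕ Fin 3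

variable (N : SumNetwork V E)

def lineHead : LineVertex E → Option V
  | .inl e => some (N.head e)
  | .inr (.inl i) => some (N.source i)
  | .inr (.inr _) => none

def lineTail : LineVertex E → Option V
  | .inl e => some (N.tail e)
  | .inr (.inl _) => none
  | .inr (.inr j) => some (N.terminal j)

/-- An arc demands a genuine common node, so `none` matches nothing. This makes sources free of
predecessors and terminals free of successors. -/
def line : SumDigraph (LineVertex E) where
  arc u v := ∃ x, N.lineHead u = some x ∧ N.lineTail v = some x
  src i := .inr (.inl i)
  term j := .inr (.inr j)

variable {N}

theorem exists_head_eq_of_isWalk {u v : V} {p : List E} (h : N.IsWalk u v p) (hp : p ≠ []) :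
    ∃ e, N.head e = v := by
  induction p generalizing u with
  | nil => exact (hp rfl).elim
  | cons e p ih =>
    by_cases hp' : p = []
    · subst hp'
      exact ⟨e, h.2⟩
    · exact ih h.2 hp'

/-- The predicate `Q` records what the walk avoids; it is needed for every vertex except the final
terminal, which matches the shape of `IsGood.connected`. -/
theorem reflTransGen_of_isWalk {Q : LineVertex E → Prop} {j : Fin 3} {p : List E} :
    ∀ {x : V} {w : LineVertex E}, N.IsWalk x (N.terminal j) p → (∀ e ∈ p, Q (.inl e)) →
      N.lineHead w = some x → Q w →
      ReflTransGen (fun u v => N.line.arc u v ∧ Q u) w (N.line.term j) := by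
  induction p with
  | nil =>
    intro x w h _ hw hQ
    exact .single ⟨⟨x, hw, by rw [show x = N.terminal j from h]; rfl⟩, hQ⟩
  | cons e p ih =>
    intro x w h hQp hw hQ
    refine .head ⟨⟨x, hw, ?_⟩, hQ⟩ (ih (w := .inl e) h.2 (fun e' he' => hQp e' (by simp [he'])) rfl
      (hQp e (by simp)))
    rw [← h.1]; rfl

/-- Transfers acyclicity: a cycle through an edge in the line digraph would be a closed path in the
network. Sources and terminals cannot occur in between. -/
theorem exists_isPath_of_transGen {e e' : E} (h : TransGen N.line.arc (.inl e) (.inl e')) : ∃ p, N.IsPath (N.tail e) (N.tail e') p := by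
  obtain ⟨w, hw⟩ : ∃ w : LineVertex E, w = .inl e := ⟨_, rfl⟩
  rw [← hw] at h
  induction h using TransGen.head_induction_on generalizing e with
  | single h =>
    subst hw
    obtain ⟨x, hx, hx'⟩ := h
    refine ⟨[e], by simp, rfl, ?_⟩
    exact Option.some.inj (hx.trans hx'.symm)
  | head h hr ih =>
    rename_i a b
    subst hw
    obtain ⟨x, hx, hx'⟩ := h
    rcases b with e₁ | i | j
    · obtain ⟨p, hp⟩ := ih rfl
      refine ⟨e :: p, by simp, rfl, ?_⟩
      rw [show N.head e = N.tail e₁ from Option.some.inj (hx.trans hx'.symm)]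
      exact hp.2
    · cases hx'
    · obtain ⟨c, ⟨y, hy, -⟩, -⟩ := TransGen.head'_iff.1 hr
      cases hy

theorem source_ne_terminal (hN : N.IsAdmissible) (h2 : N.TwoEdgeDisjointPaths) (i j : Fin 3) :
    N.source i ≠ N.terminal j := by
  obtain ⟨p, -, hp, -, -⟩ := h2 i j
  obtain ⟨e, he⟩ := exists_head_eq_of_isWalk hp.2 hp.1
  exact fun h => hN.head_ne_source e i (he.trans h.symm)

/-- The number of strict ancestors is a height function because there are no cycles. For
connectivity, an edge lies on at most one of two edge-disjoint paths, so the other path avoids it.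
-/
theorem line_isGood [Finite E] (hN : N.IsAdmissible) (h2 : N.TwoEdgeDisjointPaths) :
    N.line.IsGood where
  height := by
    classical
    have := Fintype.ofFinite E
    have hirr : ∀ v, ¬ TransGen N.line.arc v v := by
      intro v hv
      rcases v with e | i | j
      · obtain ⟨p, hp⟩ := exists_isPath_of_transGen hv
        exact hN.acyclic _ _ hp
      · obtain ⟨c, -, y, -, hy⟩ := TransGen.tail'_iff.1 hv
        cases hy
      · obtain ⟨c, ⟨y, hy, -⟩, -⟩ := TransGen.head'_iff.1 hv
        cases hy
    refine ⟨fun v => (Finset.univ.filter fun u => TransGen N.line.arc u v).card, fun u v huv => ?_⟩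
    refine Finset.card_lt_card (Finset.ssubset_iff_of_subset ?_ |>.2 ⟨u, ?_, ?_⟩)
    · intro w hw
      simp only [Finset.mem_filter, Finset.mem_univ, true_and] at hw ⊢
      exact hw.tail huv
    · simpa using TransGen.single huv
    · simpa using hirr u
  src_injective i j h := by simpa [line] using h
  term_injective i j h := by simpa [line] using h
  src_ne_term i j := by simp [line]
  not_arc_src := by
    rintro u i ⟨x, -, hx⟩
    cases hx
  not_term_arc := by
    rintro j v ⟨x, hx, -⟩
    cases hx
  reach i j := by
    obtain ⟨p, -, hp, -, -⟩ := h2 i j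
    exact ReflTransGen.mono (fun _ _ h => h.1) _ _
      (reflTransGen_of_isWalk (Q := fun _ => True) hp.2 (by simp) rfl trivial)
  connected i j c hc1 hc2 := by
    rcases c with e | i' | j'
    · obtain ⟨p, q, hp, hq, hd⟩ := h2 i j
      by_cases he : e ∈ p
      · exact reflTransGen_of_isWalk (Q := fun u => u ≠ .inl e) hq.2
          (by rintro e' he' h; exact hd he (Sum.inl.inj h ▸ he')) rfl (by simp [line])
      · exact reflTransGen_of_isWalk (Q := fun u => u ≠ .inl e) hp.2
          (by rintro e' he' h; exact he (Sum.inl.inj h ▸ he')) rfl (by simp [line])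
    · exact (hc1 i' rfl).elim
    · exact (hc2 j' rfl).elim

variable [Fintype E] {F : Type*} [CommRing F]

theorem exists_isSignal [DecidableEq V] (hN : N.IsAdmissible) (h2 : N.TwoEdgeDisjointPaths)
    (c : LinearCode E F) (X : Fin 3 → F) : ∃ Y, N.IsSignal c X Y := by
  obtain ⟨h, hh⟩ := (line_isGood hN h2).height
  have wf : WellFounded fun e' e : E => h (.inl e') < h (.inl e) :=
    InvImage.wf (fun e : E => h (.inl e)) Nat.lt_wfRel.wf
  have hlt : ∀ e' e, N.head e' = N.tail e → h (.inl e') < h (.inl e) :=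
    fun e' e he => hh _ _ ⟨_, rfl, congrArg some he.symm⟩
  refine ⟨wf.fix fun e Y =>
    (∑ i, if N.source i = N.tail e then c.inject i e * X i else 0) +
    (∑ e', if he : N.head e' = N.tail e then c.transfer e' e * Y e' (hlt e' e he) else 0),
    fun e => ?_⟩
  rw [wf.fix_eq]
  simp only [dite_eq_ite]

/-- The terminals of the line digraph play the role of edges that carry the decoded values. Thus
edge signals extend to a solution `Z` of the line digraph, and the coefficients only have to agree
where an arc exists. -/
theorem computesSum_of_solves [DecidableEq V] (hN : N.IsAdmissible)
    (h2 : N.TwoEdgeDisjointPaths) {a : LineVertex E → LineVertex E → F} (ha : N.line.Solves a)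
    {c : LinearCode E F}
    (hi : ∀ i e, N.source i = N.tail e → c.inject i e = a (.inr (.inl i)) (.inl e))
    (ht : ∀ e' e, N.head e' = N.tail e → c.transfer e' e = a (.inl e') (.inl e))
    (hd : ∀ j e, N.head e = N.terminal j → c.decode j e = a (.inl e) (.inr (.inr j))) :
    N.ComputesSum c := by
  intro X
  refine ⟨exists_isSignal hN h2 c X, fun Y hY j => ?_⟩
  have hi' : ∀ i e x, (if N.source i = N.tail e then c.inject i e * x else 0) =
      a (.inr (.inl i)) (.inl e) * x := by
    intro i e x
    split
    · rename_i h; rw [hi i e h]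
    · rename_i h
      rw [ha.1, zero_mul]
      rintro ⟨y, hy, hy'⟩
      exact h (Option.some.inj (hy.trans hy'.symm))
  have ht' : ∀ e' e x, (if N.head e' = N.tail e then c.transfer e' e * x else 0) =
      a (.inl e') (.inl e) * x := by
    intro i e x
    split
    · rename_i h; rw [ht i e h]
    · rename_i h
      rw [ha.1, zero_mul]
      rintro ⟨y, hy, hy'⟩
      exact h (Option.some.inj (hy.trans hy'.symm))
  have hd' : ∀ j e x, (if N.head e = N.terminal j then c.decode j e * x else 0) =
      a (.inl e) (.inr (.inr j)) * x := by
    intro i e x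
    split
    · rename_i h; rw [hd i e h]
    · rename_i h
      rw [ha.1, zero_mul]
      rintro ⟨y, hy, hy'⟩
      exact h (Option.some.inj (hy.trans hy'.symm))
  have hterm : ∀ j v, a (.inr (.inr j)) v = 0 := by
    intro j v
    refine ha.1 _ _ ?_
    rintro ⟨x, hx, -⟩
    cases hx
  have hst : ∀ i j, a (.inr (.inl i)) (.inr (.inr j)) = 0 := by
    intro i j
    refine ha.1 _ _ ?_
    rintro ⟨x, hx, hx'⟩
    exact source_ne_terminal hN h2 i j (Option.some.inj (hx.trans hx'.symm))
  let Z : LineVertex E → F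
    | .inl e => Y e
    | .inr (.inl i) => X i
    | .inr (.inr j) => ∑ e, a (.inl e) (.inr (.inr j)) * Y e
  have := ha.2 Z (by
    intro v hv
    rw [Fintype.sum_sum_type, Fintype.sum_sum_type]
    rcases v with e | i | j
    · simp only [Z, hterm, zero_mul, Finset.sum_const_zero, add_zero]
      rw [hY e]
      simp only [hi', ht']
      exact add_comm _ _
    · exact (hv i rfl).elim
    · simp only [Z, hterm, hst, zero_mul, Finset.sum_const_zero, add_zero]) j
  simp only [hd']
  exact this

theorem exists_computesSum [DecidableEq V] {F : Type*} [Field F] [Finite F] (hF : 4 ≤ Nat.card F)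
    (hN : N.IsAdmissible) (h2 : N.TwoEdgeDisjointPaths) :
    ∃ c : LinearCode E F, N.ComputesSum c := by
  classical
  obtain ⟨a, ha⟩ := (line_isGood hN h2).exists_solves hF
  exact ⟨⟨fun i e => a (.inr (.inl i)) (.inl e), fun e' e => a (.inl e') (.inl e),
    fun j e => a (.inl e) (.inr (.inr j))⟩, computesSum_of_solves hN h2 ha
    (fun _ _ _ => rfl) (fun _ _ _ => rfl) (fun _ _ _ => rfl)⟩

end SumNetwork

/-! ### The algorithm -/

namespace LoopLang

namespace Fm

def eq (s t : Tm) : Fm := neg (nz (.add (.sub s t) (.sub t s)))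

def lt (s t : Tm) : Fm := nz (.sub t s)

def or (φ ψ : Fm) : Fm := neg (and (neg φ) (neg ψ))

def imp (φ ψ : Fm) : Fm := neg (and φ (neg ψ))

def all (x : ℕ) (b : Range) (φ : Fm) : Fm := neg (ex x b (neg φ))

variable {k : ℕ} {ρ : Env} {σ : RAM.Memory}

@[simp] theorem holds_eq {s t : Tm} : (eq s t).Holds k ρ σ ↔ s.eval ρ σ = t.eval ρ σ := by
  simp [eq]; omega

@[simp] theorem holds_lt {s t : Tm} : (lt s t).Holds k ρ σ ↔ s.eval ρ σ < t.eval ρ σ := by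
  simp [lt]; omega

@[simp] theorem holds_or {φ ψ : Fm} :
    (or φ ψ).Holds k ρ σ ↔ φ.Holds k ρ σ ∨ ψ.Holds k ρ σ := by
  simp only [or, Holds]; tauto

@[simp] theorem holds_imp {φ ψ : Fm} :
    (imp φ ψ).Holds k ρ σ ↔ (φ.Holds k ρ σ → ψ.Holds k ρ σ) := by
  simp only [imp, Holds]; tauto

@[simp] theorem holds_all {x : ℕ} {b : Range} {φ : Fm} :
    (all x b φ).Holds k ρ σ ↔ ∀ i < b.val k, φ.Holds k (Function.update ρ x i) σ := by
  simp [all]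

end Fm

/-- Sequential execution of a list of commands. -/
def Cmd.seqs : List Cmd → Cmd
  | [] => .skip
  | [c] => c
  | c :: d :: l => .seq c (seqs (d :: l))

end LoopLang

namespace SumAlgorithm

open LoopLang

/-! The memory of the algorithm: array 9 holds the tails and heads of the vertices of the line
digraph, array 10 its reachability relation, arrays 11 and 12 the addition and multiplication of the
field with four elements, array 13 the vectors of the vertices, array 14 marks the processed
vertices, array 15 holds closures, array 16 single values, and array 17 representations of vectors as
combinations of three other ones. -/

def numEdges : Tm := .cell 0 (.const 0) (.const 1)

def numVertices : Tm := .add numEdges (.const 6)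

def srcT (i : Tm) : Tm := .add numEdges i

def termT (j : Tm) : Tm := .add numEdges (.add (.const 3) j)

/-- The range of the vertices of the line digraph. -/
def vertices : Range := .edges 6

def arcF (u v : Tm) : Fm := .eq (.cell 9 (.const 1) u) (.cell 9 (.const 0) v)

/-- The target selects the row, so that one backward closure computation fills one row. -/
def reachF (u v : Tm) : Fm := .nz (.cell 10 v u)

def sharedF (v : Tm) : Fm :=
  let r j := reachF v (termT (.const j))
  .or (.and (r 0) (r 1)) (.or (.and (r 0) (r 2)) (.and (r 1) (r 2)))

def ownF (j v : Tm) : Fm := .and (reachF v (termT j)) (.neg (sharedF v))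

def gateF (j u : Tm) : Fm :=
  .and (sharedF u) (.ex 20 vertices (.and (arcF u (.var 20)) (ownF j (.var 20))))

def firstF (p : Tm → Fm) (v : Tm) : Fm :=
  .and (p v) (.neg (.ex 21 vertices (.and (.lt (.var 21) v) (p (.var 21)))))

def processedF (v : Tm) : Fm := .nz (.cell 14 (.const 0) v)

def addT (s t : Tm) : Tm := .cell 11 s t

def mulT (s t : Tm) : Tm := .cell 12 s t

/-- Coordinate `l` of the combination of three vectors. -/
def combT (p q r a b c l : Tm) : Tm :=
  addT (addT (mulT a (.cell 13 p l)) (mulT b (.cell 13 q l))) (mulT c (.cell 13 r l))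

/-- A code is the bit pattern of a polynomial over the two-element field of degree at most 1, so
addition is bitwise. -/
def addCode (x y : ℕ) : ℕ := x ^^^ y

/-- With `r` the class of the indeterminate, the codes 1, 2, 3 stand for `1`, `r`, `r + 1 = r ^ 2`.
Hence a nonzero code minus one is a discrete logarithm modulo 3. -/
def mulCode (x y : ℕ) : ℕ := if x = 0 ∨ y = 0 then 0 else (x + y - 2) % 3 + 1

def tableC (a : ℕ) (f : ℕ → ℕ → ℕ) : List (ℕ × ℕ) → Cmd
  | [] => .skip
  | (x, y) :: l => .seq (.set a (.const x) (.const y) (.const (f x y))) (tableC a f l)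

def codePairs : List (ℕ × ℕ) := (List.range 4).product (List.range 4)

/-- Sources get the fictitious tail `n` and terminals the fictitious head `n + 1`. These are
distinct and not nodes, so they create no arcs. -/
def edgesC : Cmd := .seq
  (.for 0 (.edges 0) (.seq
    (.set 9 (.const 0) (.var 0) (.cell 1 (.const 0) (.var 0)))
    (.set 9 (.const 1) (.var 0) (.cell 1 (.const 1) (.var 0)))))
  (.for 0 (.num 3) (.seqs [
    .set 9 (.const 0) (srcT (.var 0)) (.cell 0 (.const 0) (.const 0)),
    .set 9 (.const 1) (srcT (.var 0)) (.cell 2 (.const 0) (.var 0)),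
    .set 9 (.const 0) (termT (.var 0)) (.cell 2 (.const 1) (.var 0)),
    .set 9 (.const 1) (termT (.var 0)) (.add (.cell 0 (.const 0) (.const 0)) (.const 1))]))

/-- Computes in a row of array `a` the set of vertices from which steps lead to a vertex with
property `init`; in `init` and `step`, variable 1 is the vertex and variable 3 the vertex after one
step. -/
def closureC (a : ℕ) (row : Tm) (init step : Fm) : Cmd := .seq
  (.for 1 vertices (.ite init (.set a row (.var 1) (.const 1)) (.set a row (.var 1) (.const 0))))
  -- One round per vertex is enough, because a path in an acyclic digraph has fewer steps than there
  -- are vertices.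
  (.for 2 vertices (.for 1 vertices
    (.ite (.ex 3 vertices (.and step (.nz (.cell a row (.var 3)))))
      (.set a row (.var 1) (.const 1)) .skip)))

def reachC : Cmd :=
  .for 0 vertices (closureC 10 (.var 0) (.eq (.var 1) (.var 0)) (arcF (.var 1) (.var 3)))

def allSrcF (y : Tm) : Fm :=
  .and (reachF (srcT (.const 0)) y) (.and (reachF (srcT (.const 1)) y) (reachF (srcT (.const 2)) y))

def hubPairF (y z : Tm) : Fm :=
  let t j := .or (reachF y (termT (.const j))) (reachF z (termT (.const j)))
  .and (allSrcF y) (.and (allSrcF z) (.and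
    (.or (.eq y z) (.and (.neg (reachF y z)) (.neg (reachF z y)))) (.and (t 0) (.and (t 1) (t 2)))))

def hubArcF (u v : Tm) : Fm :=
  let y : Tm := .cell 16 (.const 0) (.const 1)
  let z : Tm := .cell 16 (.const 0) (.const 2)
  let both : Fm := .ex 20 vertices
    (.and (arcF u (.var 20)) (.and (reachF (.var 20) y) (reachF (.var 20) z)))
  .or (.and (.or (reachF y v) (reachF z v)) (.and (.neg (.eq v y)) (.and (.neg (.eq v z))
    (firstF (fun x => .and (arcF x v) (.or (reachF y x) (reachF z x))) u))))
  (.or (.and both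
    (firstF (fun x => .and (arcF u x) (.and (reachF x y) (reachF x z))) v))
  (.and (.neg both) (.or (firstF (fun x => .and (arcF u x) (reachF x y)) v)
    (firstF (fun x => .and (arcF u x) (reachF x z)) v))))

/-- The search does not stop at the first hub pair: a later one overwrites the stored one, and any
of them will do. -/
def hubC : Cmd := .seq
  (.for 0 vertices (.for 1 vertices (.ite (hubPairF (.var 0) (.var 1))
    (.seq (.set 16 (.const 0) (.const 1) (.var 0)) (.set 16 (.const 0) (.const 2) (.var 1))) .skip)))
  (.for 0 vertices (.for 1 vertices (.ite (hubArcF (.var 0) (.var 1))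
    (.set 5 (.var 0) (.var 1) (.const 1)) (.set 5 (.var 0) (.var 1) (.const 0)))))

/-- The sources receive the unit vectors. The terminals receive the all-ones vector only as a target
for the final decoding; they are never marked as processed. -/
def initC : Cmd := .for 0 (.num 3) (.seqs [
  .set 13 (srcT (.var 0)) (.var 0) (.const 1),
  .set 14 (.const 0) (srcT (.var 0)) (.const 1),
  .set 13 (termT (.var 0)) (.const 0) (.const 1),
  .set 13 (termT (.var 0)) (.const 1) (.const 1),
  .set 13 (termT (.var 0)) (.const 2) (.const 1)])

/-- The value `a`, usable in a cut: no vertex, or a shared vertex that is not processed. -/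
def cutF (a : Tm) : Fm := .imp (.lt a numVertices) (.and (sharedF a) (.neg (processedF a)))

/-- A cut with `c` vertices requires rank at least `3 - c`. Each entry of the cut that is a real
vertex excuses one of the three vectors by forcing its coefficient to be zero, so one formula covers
all cut sizes. -/
def independentF : Fm :=
  let m (x : ℕ) : Fm := .and (.nz (.cell 15 (.const 0) (.var x))) (processedF (.var x))
  let z (l : ℕ) : Fm := .eq (combT (.var 20) (.var 21) (.var 22) (.var 23) (.var 24) (.var 25)
    (.const l)) (.const 0)
  .ex 20 vertices (.and (m 20) (.ex 21 vertices (.and (m 21) (.ex 22 vertices (.and (m 22)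
    (.all 23 (.num 4) (.all 24 (.num 4) (.all 25 (.num 4)
      (.imp (.imp (.lt (.var 16) numVertices) (.eq (.var 24) (.const 0)))
      (.imp (.imp (.lt (.var 17) numVertices) (.eq (.var 25) (.const 0)))
      (.imp (.and (z 0) (.and (z 1) (z 2)))
        (.and (.eq (.var 23) (.const 0)) (.and (.eq (.var 24) (.const 0))
          (.eq (.var 25) (.const 0)))))))))))))))

/-- The test for one terminal and one cut. -/
def cutC : Cmd :=
  let avoid : Fm := .and (.neg (.eq (.var 1) (.var 16))) (.neg (.eq (.var 1) (.var 17)))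
  .ite (.and (cutF (.var 16)) (cutF (.var 17)))
    (.seq (closureC 15 (.const 0) (.and (gateF (.var 15) (.var 1)) avoid)
      (.and avoid (.and (arcF (.var 1) (.var 3))
        (.and (sharedF (.var 3)) (.neg (processedF (.var 3)))))))
      (.ite independentF .skip (.set 16 (.const 0) (.const 3) (.const 0)))) .skip

def testC : Cmd := .seq (.set 16 (.const 0) (.const 3) (.const 1))
  -- The ranges have one index more than there are vertices: the last index means that no vertex is
  -- put into the cut.
  (.for 15 (.num 3) (.for 16 (.edges 7) (.for 17 (.edges 7) cutC)))

/-- The vector in the variables 12, 13, 14 is a combination of three predecessors of the vertex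
in variable 11. -/
def predCombF : Fm :=
  let c (x p : ℕ) : Fm := .or (.eq (.var x) (.const 0)) (arcF (.var p) (.var 11))
  let z (l x : ℕ) : Fm := .eq (combT (.var 20) (.var 21) (.var 22) (.var 23) (.var 24) (.var 25)
    (.const l)) (.var x)
  .ex 20 vertices (.ex 21 vertices (.ex 22 vertices (.ex 23 (.num 4) (.ex 24 (.num 4)
    (.ex 25 (.num 4) (.and (c 23 20) (.and (c 24 21) (.and (c 25 22)
      (.and (z 0 12) (.and (z 1 13) (z 2 14)))))))))))

/-- The candidate vector is installed and tested. After a failure only the mark is removed, since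
vectors of unmarked vertices are never used. -/
def tryC : Cmd := .seqs [
  .set 13 (.var 11) (.const 0) (.var 12),
  .set 13 (.var 11) (.const 1) (.var 13),
  .set 13 (.var 11) (.const 2) (.var 14),
  .set 14 (.const 0) (.var 11) (.const 1),
  testC,
  .ite (.nz (.cell 16 (.const 0) (.const 3)))
    (.set 16 (.const 0) (.const 0) (.const 1))
    (.set 14 (.const 0) (.var 11) (.const 0))]

def readyF : Fm := .and (sharedF (.var 11)) (.and (.neg (processedF (.var 11)))
  (.neg (.ex 20 vertices (.and (arcF (.var 20) (.var 11)) (.neg (processedF (.var 20)))))))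

/-- Exhaustive search over the 64 vectors. The cell `16 0 0` records success and switches off all
further attempts. -/
def stepC : Cmd := .seq (.set 16 (.const 0) (.const 0) (.const 0))
  (.for 12 (.num 4) (.for 13 (.num 4) (.for 14 (.num 4)
    (.ite (.and (.eq (.cell 16 (.const 0) (.const 0)) (.const 0)) predCombF) tryC .skip))))

/-- The outer loop makes enough rounds for every height to have its turn, so no topological order
has to be computed. -/
def processC : Cmd := .for 10 vertices (.for 11 vertices (.ite readyF stepC .skip))

/-- `u` may contribute to `v`: it is a predecessor of a shared vertex or a gate of a terminal. -/
def contributesF (u v : Tm) : Fm :=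
  let t (j : ℕ) : Fm := .and (.eq v (termT (.const j))) (gateF (.const j) u)
  .or (.and (sharedF v) (arcF u v)) (.or (t 0) (.or (t 1) (t 2)))

def solveF : Fm :=
  let c (x p : ℕ) : Fm := .or (.eq (.var x) (.const 0)) (contributesF (.var p) (.var 11))
  let z (l : ℕ) : Fm := .eq (combT (.var 0) (.var 1) (.var 2) (.var 3) (.var 4) (.var 5)
    (.const l)) (.cell 13 (.var 11) (.const l))
  .and (c 3 0) (.and (c 4 1) (.and (c 5 2) (.and (z 0) (.and (z 1) (z 2)))))

def solveC : Cmd := .for 11 vertices (.for 0 vertices (.for 1 vertices (.for 2 vertices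
  (.for 3 (.num 4) (.for 4 (.num 4) (.for 5 (.num 4) (.ite solveF (.seqs [
    .set 17 (.var 11) (.const 0) (.var 0),
    .set 17 (.var 11) (.const 1) (.var 1),
    .set 17 (.var 11) (.const 2) (.var 2),
    .set 17 (.var 11) (.const 3) (.var 3),
    .set 17 (.var 11) (.const 4) (.var 4),
    .set 17 (.var 11) (.const 5) (.var 5)]) .skip)))))))

/-- `c` if `u = p`, otherwise zero. -/
def ifEqT (c u p : Tm) : Tm :=
  let d : Tm := .add (.sub u p) (.sub p u)
  -- If `u` and `p` differ, four times their distance is at least 4 and truncated subtraction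
  -- removes every code `c < 4`.
  .sub c (.add (.add d d) (.add d d))

/-- The three listed vertices may coincide, so their coefficients are added in the field. -/
def valueT (v u : Tm) : Tm :=
  let t (l l' : ℕ) : Tm := ifEqT (.cell 17 v (.const l')) u (.cell 17 v (.const l))
  addT (addT (t 0 3) (t 1 4)) (t 2 5)

/-- Writes the coefficient of the arc from variable 0 to variable 1. -/
def coeffC : Cmd := .seq
  (.set 5 (.var 0) (.var 1) (.const 0)) (.seq
  (.ite (sharedF (.var 1)) (.set 5 (.var 0) (.var 1) (valueT (.var 1) (.var 0))) .skip)
  (.for 2 (.num 3) (.ite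
    (.and (ownF (.var 2) (.var 1))
      (firstF (fun x => .and (arcF (.var 0) x) (ownF (.var 2) x)) (.var 1)))
    (.ite (ownF (.var 2) (.var 0)) (.set 5 (.var 0) (.var 1) (.const 1))
      (.set 5 (.var 0) (.var 1) (valueT (termT (.var 2)) (.var 0)))) .skip)))

def fillC : Cmd := .for 0 vertices (.for 1 vertices coeffC)

def multicastC : Cmd := .seqs [initC, processC, solveC, fillC]

def outputC : Cmd := .seq
  (.for 0 (.num 3) (.for 1 (.edges 0) (.seq
    (.set 4 (.var 0) (.var 1) (.cell 5 (srcT (.var 0)) (.var 1)))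
    (.set 6 (.var 0) (.var 1) (.cell 5 (.var 1) (termT (.var 0)))))))
  (.set 3 (.const 0) (.const 0) (.const 7))

def algorithm : Cmd := .seqs [edgesC, reachC, tableC 11 addCode codePairs,
  tableC 12 mulCode codePairs,
  .ite (.ex 0 vertices (.ex 1 vertices (hubPairF (.var 0) (.var 1)))) hubC multicastC, outputC]

theorem algorithm_wf : algorithm.wf [] = true := by
  decide

end SumAlgorithm

/-! ### Numbering of the line digraph and correctness of the closure computation -/

namespace SumAlgorithm

open LoopLang RAM SumNetwork Relation

variable {n k : ℕ} {N : SumNetwork (Fin n) (Fin k)}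

/-- The number of a vertex of the line digraph. -/
def enc : LineVertex (Fin k) → ℕ
  | .inl e => e
  | .inr (.inl i) => k + i
  | .inr (.inr j) => k + (3 + j)

theorem enc_lt (w : LineVertex (Fin k)) : enc w < k + 6 := by
  rcases w with e | i | j <;> simp only [enc] <;> omega

theorem enc_injective : Function.Injective (enc (k := k)) := by
  rintro (e | i | j) (e' | i' | j') h <;> simp only [enc] at h <;>
    first
    | omega
    | (congr 1; omega)
    | (congr 2; omega)

theorem exists_enc {i : ℕ} (hi : i < k + 6) : ∃ w : LineVertex (Fin k), enc w = i := by
  by_cases h1 : i < k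
  · exact ⟨.inl ⟨i, h1⟩, rfl⟩
  by_cases h2 : i < k + 3
  · exact ⟨.inr (.inl ⟨i - k, by omega⟩), by simp only [enc]; omega⟩
  · exact ⟨.inr (.inr ⟨i - k - 3, by omega⟩), by simp only [enc]; omega⟩

theorem exists_lt_iff {p : ℕ → Prop} :
    (∃ i < k + 6, p i) ↔ ∃ w : LineVertex (Fin k), p (enc w) := by
  constructor
  · rintro ⟨i, hi, hp⟩
    obtain ⟨w, rfl⟩ := exists_enc hi
    exact ⟨w, hp⟩
  · rintro ⟨w, hw⟩
    exact ⟨enc w, enc_lt w, hw⟩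

@[simp] theorem vertices_val : vertices.val k = k + 6 := rfl

@[simp] theorem num_val (c : ℕ) : (Range.num c).val k = c := rfl

@[simp] theorem edges_val (c : ℕ) : (Range.edges c).val k = k + c := rfl

@[simp] theorem enc_inl (e : Fin k) : enc (.inl e) = (e : ℕ) := rfl

theorem enc_src (i : Fin 3) : enc (N.line.src i) = k + i := rfl

theorem enc_term (j : Fin 3) : enc (N.line.term j) = k + (3 + j) := rfl

theorem write_apply (σ : Memory) (a i j x a' i' j' : ℕ) :
    σ.write a i j x a' i' j' = if a' = a ∧ i' = i ∧ j' = j then x else σ a' i' j' := rfl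

/-! #### Vertices, arcs and reachability -/

/-- The constant cells of the input and the table of the arcs. -/
structure HasArcs (N : SumNetwork (Fin n) (Fin k)) (σ : Memory) : Prop where
  size : σ 0 0 1 = k
  arc : ∀ u v : LineVertex (Fin k), σ 9 1 (enc u) = σ 9 0 (enc v) ↔ N.line.arc u v

theorem hasArcs_edgesC (ρ : Env) : HasArcs N (edgesC.den k ρ N.input) := by
  set σ := edgesC.den k ρ N.input with hσ
  have hsize : σ 0 0 1 = k := by
    rw [hσ, Cmd.den_of_notMem_writes k _ _ _ (by decide)]; rfl
  let σ₁ := (Cmd.for 0 (.edges 0) (.seq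
    (.set 9 (.const 0) (.var 0) (.cell 1 (.const 0) (.var 0)))
    (.set 9 (.const 1) (.var 0) (.cell 1 (.const 1) (.var 0))))).den k ρ N.input
  have h1 : ∀ e : Fin k, σ₁ 9 0 e = N.tail e ∧ σ₁ 9 1 e = N.head e := by
    have := Cmd.den_for_induction (k := k) (x := 0) (b := .edges 0) (c := .seq
      (.set 9 (.const 0) (.var 0) (.cell 1 (.const 0) (.var 0)))
      (.set 9 (.const 1) (.var 0) (.cell 1 (.const 1) (.var 0)))) (ρ := ρ) (σ := N.input)
      (fun m τ => τ 1 = N.input 1 ∧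
        ∀ e : Fin k, (e : ℕ) < m → τ 9 0 e = N.tail e ∧ τ 9 1 e = N.head e)
      ⟨rfl, by simp⟩ (by
        rintro m τ hm ⟨hτ, h⟩
        simp only [edges_val, add_zero] at hm
        simp only [Cmd.den, Tm.eval, Function.update_self]
        refine ⟨by rw [write_of_ne _ _ _ (by decide), write_of_ne _ _ _ (by decide), hτ], ?_⟩
        intro e he
        simp only [write_apply, hτ]
        rcases eq_or_ne (e : ℕ) m with rfl | hne
        · simp [SumNetwork.input]
        · simpa [hne] using h e (by omega))
    intro e
    exact this.2 e (by simp)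
  have h1' : σ₁ 0 = N.input 0 ∧ σ₁ 2 = N.input 2 :=
    ⟨Cmd.den_of_notMem_writes k _ _ _ (by decide), Cmd.den_of_notMem_writes k _ _ _ (by decide)⟩
  have h2 := Cmd.den_for_induction (k := k) (x := 0) (b := .num 3) (c := .seqs [
    .set 9 (.const 0) (srcT (.var 0)) (.cell 0 (.const 0) (.const 0)),
    .set 9 (.const 1) (srcT (.var 0)) (.cell 2 (.const 0) (.var 0)),
    .set 9 (.const 0) (termT (.var 0)) (.cell 2 (.const 1) (.var 0)),
    .set 9 (.const 1) (termT (.var 0)) (.add (.cell 0 (.const 0) (.const 0)) (.const 1))])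
    (ρ := ρ) (σ := σ₁)
    (fun m τ => (τ 0 = N.input 0 ∧ τ 2 = N.input 2) ∧
      (∀ e : Fin k, τ 9 0 e = N.tail e ∧ τ 9 1 e = N.head e) ∧
      ∀ i : Fin 3, (i : ℕ) < m → τ 9 0 (k + i) = n ∧ τ 9 1 (k + i) = N.source i ∧
        τ 9 0 (k + (3 + i)) = N.terminal i ∧ τ 9 1 (k + (3 + i)) = n + 1)
    ⟨h1', h1, by simp⟩ (by
      rintro m τ hm ⟨⟨h0, h2⟩, he, hi⟩
      simp only [num_val] at hm
      have hk : τ 0 0 1 = k := by rw [h0]; rfl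
      have hn : τ 0 0 0 = n := by rw [h0]; rfl
      simp only [Cmd.seqs, Cmd.den, Tm.eval, Function.update_self, srcT, termT, numEdges]
      simp only [write_apply, show (0 : ℕ) ≠ 9 by decide, show (2 : ℕ) ≠ 9 by decide, false_and,
        if_false, hk, hn, h2]
      refine ⟨⟨by simp only [write_of_ne _ _ _ (show (0 : ℕ) ≠ 9 by decide), h0],
        by simp only [write_of_ne _ _ _ (show (2 : ℕ) ≠ 9 by decide), h2]⟩, ?_, ?_⟩
      · intro e
        have := e.2
        simp only [show (e : ℕ) ≠ k + m by omega, show (e : ℕ) ≠ k + (3 + m) by omega, and_false,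
          if_false]
        exact he e
      · intro i hi'
        have := i.2
        rcases eq_or_ne (i : ℕ) m with rfl | hne
        · simp [SumNetwork.input]
        · simp only [show k + (i : ℕ) ≠ k + m by omega, show k + (i : ℕ) ≠ k + (3 + m) by omega,
            show k + (3 + (i : ℕ)) ≠ k + m by omega, show k + (3 + (i : ℕ)) ≠ k + (3 + m) by omega,
            and_false, if_false]
          exact hi i (by omega))
  obtain ⟨-, he, hi⟩ := h2
  refine ⟨hsize, fun u v => ?_⟩
  change σ 9 1 (enc u) = σ 9 0 (enc v) ↔ ∃ x, N.lineHead u = some x ∧ N.lineTail v = some x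
  have hhead : ∀ u, σ 9 1 (enc u) = match N.lineHead u with | some x => (x : ℕ) | none => n + 1 := by
    rintro (e | i | j)
    · exact (he e).2
    · exact (hi i i.2).2.1
    · exact (hi j j.2).2.2.2
  have htail : ∀ u, σ 9 0 (enc u) = match N.lineTail u with | some x => (x : ℕ) | none => n := by
    rintro (e | i | j)
    · exact (he e).1
    · exact (hi i i.2).1
    · exact (hi j j.2).2.2.1
  rw [hhead, htail]
  rcases N.lineHead u with _ | x <;> rcases N.lineTail v with _ | y
  · simp
  · have := y.2
    simp; omega
  · have := x.2
    simp; omega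
  · constructor
    · intro h
      exact ⟨x, rfl, congrArg some (Fin.ext h).symm⟩
    · rintro ⟨w, hx, hy⟩
      exact congrArg Fin.val (Option.some.inj (hx.trans hy.symm))

theorem HasArcs.congr {σ τ : Memory} (h : HasArcs N σ) (h0 : τ 0 = σ 0) (h9 : τ 9 = σ 9) :
    HasArcs N τ := by
  constructor
  · rw [h0, h.size]
  · rw [h9]; exact h.arc

/-- The effect of a closure computation. -/
theorem den_closureC {W : Type*} [Finite W] {num : W → ℕ} {a r : ℕ} {row : Tm} {init step : Fm}
    {ρ : Env} {σ : Memory} (hnum : Function.Injective num) (hlt : ∀ w, num w < k + 6)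
    (hsurj : ∀ i < k + 6, ∃ w, num w = i) (p : W → Prop) (s : W → W → Prop)
    (hrow : ∀ τ : Memory, (∀ b, b ≠ a → τ b = σ b) → ∀ x₁ x₂ x₃,
      row.eval (Function.update ρ 1 x₁) τ = r ∧
      row.eval (Function.update (Function.update ρ 2 x₂) 1 x₁) τ = r ∧
      row.eval (Function.update (Function.update (Function.update ρ 2 x₂) 1 x₁) 3 x₃) τ = r)
    (hinit : ∀ τ : Memory, (∀ b, b ≠ a → τ b = σ b) → ∀ u,
      init.Holds k (Function.update ρ 1 (num u)) τ ↔ p u)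
    (hstep : ∀ τ : Memory, (∀ b, b ≠ a → τ b = σ b) → ∀ u v i,
      step.Holds k (Function.update (Function.update (Function.update ρ 2 i) 1 (num u)) 3 (num v)) τ
        ↔ s u v)
    (hs : ∃ h : W → ℕ, (∀ u v, s u v → h v < h u) ∧ ∀ u, h u < k + 6) :
    (∀ b, b ≠ a → (closureC a row init step).den k ρ σ b = σ b) ∧
    (∀ r', r' ≠ r → (closureC a row init step).den k ρ σ a r' = σ a r') ∧
    ∀ u, (closureC a row init step).den k ρ σ a r (num u) ≠ 0 ↔
      ∃ w, ReflTransGen s u w ∧ p w := by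
  obtain ⟨h, hh, hhlt⟩ := hs
  have hk : ∀ i, i < vertices.val k → ∃ w, num w = i := hsurj
  let G (τ : Memory) : Prop := (∀ b, b ≠ a → τ b = σ b) ∧ ∀ r', r' ≠ r → τ a r' = σ a r'
  have hG : ∀ τ x y, G τ → G (τ.write a r x y) := by
    rintro τ x y ⟨h1, h2⟩
    refine ⟨fun b hb => (write_of_ne _ _ _ hb).trans (h1 b hb), fun r' hr' => ?_⟩
    funext c
    simp [write_apply, hr', h2 r' hr']
  set σ₁ := (Cmd.for 1 vertices (.ite init (.set a row (.var 1) (.const 1))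
    (.set a row (.var 1) (.const 0)))).den k ρ σ with hσ₁
  have h1 : G σ₁ ∧ ∀ w, num w < k + 6 → (σ₁ a r (num w) ≠ 0 ↔ p w) := by
    refine Cmd.den_for_induction (k := k) (x := 1) (b := vertices) (ρ := ρ) (σ := σ)
      (fun m τ => G τ ∧ ∀ w, num w < m → (τ a r (num w) ≠ 0 ↔ p w))
      ⟨⟨fun _ _ => rfl, fun _ _ => rfl⟩, by simp⟩ ?_
    rintro m τ hm ⟨hGτ, hτ⟩
    obtain ⟨u, rfl⟩ := hk m hm
    have hr := (hrow τ hGτ.1 (num u) 0 0).1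
    simp only [Cmd.den, Tm.eval, Function.update_self, hr]
    have key : ∀ w, num w < num u + 1 → w = u ∨ (num w ≠ num u ∧ num w < num u) := by
      intro w hw
      rcases eq_or_ne (num w) (num u) with h | h
      · exact .inl (hnum h)
      · exact .inr ⟨h, by omega⟩
    split
    · rename_i hp
      rw [hinit τ hGτ.1 u] at hp
      refine ⟨hG _ _ _ hGτ, fun w hw => ?_⟩
      rcases key w hw with rfl | ⟨hne, hlt⟩
      · simpa [write_apply] using hp
      · simpa [write_apply, hne] using hτ w hlt
    · rename_i hp
      rw [hinit τ hGτ.1 u] at hp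
      refine ⟨hG _ _ _ hGτ, fun w hw => ?_⟩
      rcases key w hw with rfl | ⟨hne, hlt⟩
      · simpa [write_apply] using hp
      · simpa [write_apply, hne] using hτ w hlt
  obtain ⟨hG₁, hp₁⟩ := h1
  let T (u : W) : Prop := ∃ w, ReflTransGen s u w ∧ p w
  have h2 : ∀ (c : Cmd) (_ : c = .for 2 vertices (.for 1 vertices
      (.ite (.ex 3 vertices (.and step (.nz (.cell a row (.var 3)))))
      (.set a row (.var 1) (.const 1)) .skip))),
      G (c.den k ρ σ₁) ∧ (∀ w, c.den k ρ σ₁ a r (num w) ≠ 0 → T w) ∧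
      ∀ w, T w → h w < k + 6 → c.den k ρ σ₁ a r (num w) ≠ 0 := by
    rintro c rfl
    -- After `m` rounds all members of the closure of height below `m` are marked, and never
    -- anything outside it. Updating in place within a round only helps, since marks are never
    -- removed.
    refine Cmd.den_for_induction (k := k) (x := 2) (b := vertices) (ρ := ρ) (σ := σ₁)
      (fun m τ => G τ ∧ (∀ w, τ a r (num w) ≠ 0 → T w) ∧
        ∀ w, T w → (h w < m ∨ p w) → τ a r (num w) ≠ 0)
      ⟨hG₁, fun w hw => ⟨w, .refl, (hp₁ w (hlt w)).1 hw⟩, fun w _ hw => ?_⟩ ?_ |>.imp id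
      (And.imp id fun h w hw hl => h w hw (.inl hl))
    · rcases hw with hw | hw
      · omega
      · exact (hp₁ w (hlt w)).2 hw
    rintro m τ hm ⟨hGτ, hτ, hτ'⟩
    have := Cmd.den_for_induction (k := k) (x := 1) (b := vertices)
      (c := .ite (.ex 3 vertices (.and step (.nz (.cell a row (.var 3)))))
        (.set a row (.var 1) (.const 1)) .skip)
      (ρ := Function.update ρ 2 m) (σ := τ)
      (fun i τ => G τ ∧ (∀ w, τ a r (num w) ≠ 0 → T w) ∧
        (∀ w, T w → (h w < m ∨ p w) → τ a r (num w) ≠ 0) ∧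
        ∀ w, num w < i → T w → h w < m + 1 → τ a r (num w) ≠ 0)
      ⟨hGτ, hτ, hτ', by simp⟩ (by
        rintro i τ hi ⟨hGτ, hτ, hτ', hτi⟩
        obtain ⟨u, rfl⟩ := hk i hi
        have hex : (Fm.ex 3 vertices (.and step (.nz (.cell a row (.var 3))))).Holds k
            (Function.update (Function.update ρ 2 m) 1 (num u)) τ ↔
            ∃ v, s u v ∧ τ a r (num v) ≠ 0 := by
          simp only [Fm.Holds, Tm.eval, vertices_val, Function.update_self]
          constructor
          · rintro ⟨j, hj, h1, h2⟩
            obtain ⟨v, rfl⟩ := hsurj j hj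
            rw [hstep τ hGτ.1] at h1
            rw [(hrow τ hGτ.1 _ _ _).2.2] at h2
            exact ⟨v, h1, h2⟩
          · rintro ⟨v, h1, h2⟩
            refine ⟨num v, hlt v, (hstep τ hGτ.1 u v m).2 h1, ?_⟩
            rwa [(hrow τ hGτ.1 _ _ _).2.2]
        have hr := (hrow τ hGτ.1 (num u) m 0).2.1
        rw [Cmd.den]
        split
        · rename_i hx
          obtain ⟨v, huv, hv⟩ := hex.1 hx
          simp only [Cmd.den, Tm.eval, Function.update_self, hr]
          have hmono : ∀ w, τ a r (num w) ≠ 0 → τ.write a r (num u) 1 a r (num w) ≠ 0 := by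
            intro w hw
            simp only [write_apply]
            split <;> simp [hw]
          refine ⟨hG _ _ _ hGτ, fun w hw => ?_, fun w h1 h2 => hmono w (hτ' w h1 h2),
            fun w hw h1 h2 => ?_⟩
          · rcases eq_or_ne w u with rfl | hne
            · obtain ⟨x, hx, hpx⟩ := hτ v hv
              exact ⟨x, hx.head huv, hpx⟩
            · refine hτ w ?_
              simpa [write_apply, hnum.ne hne] using hw
          · rcases eq_or_ne w u with rfl | hne
            · simp [write_apply]
            · exact hmono w (hτi w (lt_of_le_of_ne (by omega) (hnum.ne hne)) h1 h2)
        · rename_i hx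
          refine ⟨hGτ, hτ, hτ', fun w hw h1 h2 => ?_⟩
          rcases eq_or_ne w u with rfl | hne
          · obtain ⟨x, hwx, hpx⟩ := h1
            rcases hwx.cases_head with rfl | ⟨v, hwv, hvx⟩
            · exact hτ' w ⟨w, .refl, hpx⟩ (.inr hpx)
            · exact (hx (hex.2 ⟨v, hwv, hτ' v ⟨x, hvx, hpx⟩ (.inl (by have := hh _ _ hwv; omega))⟩)).elim
          · exact hτi w (lt_of_le_of_ne (by omega) (hnum.ne hne)) h1 h2)
    refine ⟨this.1, this.2.1, fun w h1 h2 => ?_⟩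
    rcases h2 with h2 | h2
    · exact this.2.2.2 w (hlt w) h1 h2
    · exact this.2.2.1 w h1 (.inr h2)
  obtain ⟨hG₂, h3, h4⟩ := h2 _ rfl
  exact ⟨hG₂.1, hG₂.2, fun u => ⟨h3 u, fun h => h4 u h (hhlt u)⟩⟩

end SumAlgorithm

/-- The number of strict descendants: it drops along arcs, and no vertex is its own descendant, so
it stays below the number of vertices. The bound limits the rounds of the closure computations. -/
theorem SumDigraph.IsGood.exists_coheight {W : Type*} [Fintype W] {D : SumDigraph W}
    (hD : D.IsGood) :
    ∃ h : W → ℕ, (∀ u v, D.arc u v → h v < h u) ∧ ∀ u, h u < Fintype.card W := by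
  classical
  have hirr : ∀ u, ¬ Relation.TransGen D.arc u u := by
    intro u hu
    obtain ⟨v, huv, hvu⟩ := Relation.TransGen.head'_iff.1 hu
    exact hD.not_arc_of_reach hvu huv
  refine ⟨fun u => (Finset.univ.filter fun v => Relation.TransGen D.arc u v).card,
    fun u v huv => ?_, fun u => ?_⟩
  · refine Finset.card_lt_card (Finset.ssubset_iff_of_subset ?_ |>.2 ⟨v, ?_, ?_⟩)
    · intro w hw
      simp only [Finset.mem_filter, Finset.mem_univ, true_and] at hw ⊢
      exact hw.head huv
    · simpa using Relation.TransGen.single huv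
    · simpa using hirr v
  · refine Finset.card_lt_univ_of_notMem (x := u) ?_
    simpa using hirr u

theorem SumDigraph.IsGood.exists_height {W : Type*} [Fintype W] {D : SumDigraph W}
    (hD : D.IsGood) :
    ∃ h : W → ℕ, (∀ u v, D.arc u v → h u < h v) ∧ ∀ u, h u < Fintype.card W := by
  obtain ⟨h, hh, hlt⟩ := hD.exists_coheight
  refine ⟨fun u => Fintype.card W - 1 - h u, fun u v huv => ?_, fun u => ?_⟩
  · have := hh u v huv
    have := hlt u
    dsimp only; omega
  · have := hlt u
    dsimp only; omega

namespace SumAlgorithm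

open LoopLang RAM SumNetwork Relation

variable {n k : ℕ} {N : SumNetwork (Fin n) (Fin k)}

theorem card_lineVertex : Fintype.card (LineVertex (Fin k)) = k + 6 := by
  simp

/-- All tables that are computed at the beginning. -/
structure HasTables (N : SumNetwork (Fin n) (Fin k)) (σ : Memory) : Prop extends HasArcs N σ where
  reach : ∀ u w : LineVertex (Fin k), σ 10 (enc w) (enc u) ≠ 0 ↔ N.line.Reach u w
  add : ∀ x < 4, ∀ y < 4, σ 11 x y = addCode x y
  mul : ∀ x < 4, ∀ y < 4, σ 12 x y = mulCode x y

theorem HasTables.congr {σ τ : Memory} (h : HasTables N σ)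
    (hτ : ∀ a, a = 0 ∨ a = 9 ∨ a = 10 ∨ a = 11 ∨ a = 12 → τ a = σ a) : HasTables N τ where
  toHasArcs := h.toHasArcs.congr (hτ 0 (by simp)) (hτ 9 (by simp))
  reach := by rw [hτ 10 (by simp)]; exact h.reach
  add := by rw [hτ 11 (by simp)]; exact h.add
  mul := by rw [hτ 12 (by simp)]; exact h.mul

theorem reach_reachC (hD : N.line.IsGood) {ρ : Env} {σ : Memory} (h : HasArcs N σ)
    (u w : LineVertex (Fin k)) : reachC.den k ρ σ 10 (enc w) (enc u) ≠ 0 ↔ N.line.Reach u w := by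
  have := Cmd.den_for_induction (k := k) (x := 0) (b := vertices)
    (c := closureC 10 (.var 0) (.eq (.var 1) (.var 0)) (arcF (.var 1) (.var 3)))
    (ρ := ρ) (σ := σ)
    (fun m τ => HasArcs N τ ∧ ∀ u w : LineVertex (Fin k), enc w < m →
      (τ 10 (enc w) (enc u) ≠ 0 ↔ N.line.Reach u w)) ⟨h, by simp⟩ (by
      rintro m τ hm ⟨hτ, ih⟩
      obtain ⟨x, rfl⟩ := exists_enc hm
      obtain ⟨hh, hlt⟩ := hD.exists_coheight
      rw [card_lineVertex] at hlt
      obtain ⟨h1, h2, h3⟩ := den_closureC (k := k) (W := LineVertex (Fin k)) (num := enc) (a := 10)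
        (r := enc x) (row := .var 0) (init := .eq (.var 1) (.var 0)) (step := arcF (.var 1) (.var 3))
        (ρ := Function.update ρ 0 (enc x)) (σ := τ) enc_injective enc_lt
        (fun _ hi => exists_enc hi)
        (fun u => u = x) N.line.arc (by simp)
        (by intro τ' _ u; simp [enc_injective.eq_iff])
        (by
          intro τ' hτ' u v i
          simp [arcF, hτ' 9 (by decide), hτ.arc])
        ⟨hh, hlt⟩
      refine ⟨hτ.congr (h1 0 (by decide)) (h1 9 (by decide)), fun u w hw => ?_⟩
      rcases eq_or_ne w x with rfl | hne
      · rw [h3]; simp [SumDigraph.Reach]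
      · have := enc_injective.ne hne
        rw [h2 _ this]
        exact ih u w (by omega))
  exact this.2 u w (enc_lt w)

theorem den_tableC {a : ℕ} {f : ℕ → ℕ → ℕ} {l : List (ℕ × ℕ)} {ρ : Env} {σ : Memory} :
    (∀ b, b ≠ a → (tableC a f l).den k ρ σ b = σ b) ∧
    ∀ x y, (tableC a f l).den k ρ σ a x y = if (x, y) ∈ l then f x y else σ a x y := by
  induction l generalizing σ with
  | nil => simp [tableC, Cmd.den]
  | cons p l ih =>
    obtain ⟨x, y⟩ := p
    simp only [tableC, Cmd.den, Tm.eval]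
    refine ⟨fun b hb => ((ih (σ := _)).1 b hb).trans (write_of_ne _ _ _ hb), fun x' y' => ?_⟩
    rw [ih.2]
    by_cases h : (x', y') ∈ l
    · simp [h]
    · by_cases h' : x' = x ∧ y' = y
      · obtain ⟨rfl, rfl⟩ := h'
        simp [h, write_apply]
      · simp [h, write_apply, h']

theorem mem_codePairs {x y : ℕ} (hx : x < 4) (hy : y < 4) : (x, y) ∈ codePairs := by
  simp [codePairs, hx, hy]

/-! #### The meaning of the formulas -/

section Formulas

variable {ρ : Env} {σ : Memory} {s t : Tm} {u v : LineVertex (Fin k)}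

theorem holds_arcF (hT : HasTables N σ) (hs : s.eval ρ σ = enc u) (ht : t.eval ρ σ = enc v) :
    (arcF s t).Holds k ρ σ ↔ N.line.arc u v := by
  simp only [arcF, Fm.holds_eq, Tm.eval, hs, ht, hT.arc]

theorem holds_reachF (hT : HasTables N σ) (hs : s.eval ρ σ = enc u) (ht : t.eval ρ σ = enc v) :
    (reachF s t).Holds k ρ σ ↔ N.line.Reach u v := by
  simp only [reachF, Fm.Holds, Tm.eval, hs, ht, hT.reach]

theorem eval_srcT (hT : HasArcs N σ) (i : Fin 3) (hs : s.eval ρ σ = i) :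
    (srcT s).eval ρ σ = enc (N.line.src i) := by
  simp only [srcT, numEdges, Tm.eval, hT.size, hs, enc_src]

theorem eval_termT (hT : HasArcs N σ) (j : Fin 3) (hs : s.eval ρ σ = j) :
    (termT s).eval ρ σ = enc (N.line.term j) := by
  simp only [termT, numEdges, Tm.eval, hT.size, hs, enc_term]

theorem holds_sharedF (hT : HasTables N σ) (hs : s.eval ρ σ = enc u) :
    (sharedF s).Holds k ρ σ ↔ N.line.Shared u := by
  have h : ∀ j : Fin 3, (reachF s (termT (.const j))).Holds k ρ σ ↔
      N.line.Reach u (N.line.term j) := fun j =>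
    holds_reachF hT hs (eval_termT hT.toHasArcs j rfl)
  have h0 := h 0
  have h1 := h 1
  have h2 := h 2
  simp only [Fin.val_zero, Fin.val_one, Fin.val_two] at h0 h1 h2
  simp only [sharedF, Fm.holds_or, Fm.Holds, h0, h1, h2]
  constructor
  · rintro (h | h | h)
    · exact ⟨0, 1, by decide, h.1, h.2⟩
    · exact ⟨0, 2, by decide, h.1, h.2⟩
    · exact ⟨1, 2, by decide, h.1, h.2⟩
  · rintro ⟨j, j', hj, h, h'⟩
    fin_cases j <;> fin_cases j' <;> simp_all

theorem holds_ownF (hT : HasTables N σ) {j : Fin 3} (hs : s.eval ρ σ = j)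
    (ht : t.eval ρ σ = enc u) : (ownF s t).Holds k ρ σ ↔ N.line.Own j u := by
  simp only [ownF, Fm.Holds, holds_reachF hT ht (eval_termT hT.toHasArcs j hs),
    holds_sharedF hT ht, SumDigraph.Own]

theorem holds_gateF (hT : HasTables N σ) {j : Fin 3}
    (hs : ∀ i, s.eval (Function.update ρ 20 i) σ = j)
    (ht : ∀ i, t.eval (Function.update ρ 20 i) σ = enc u) (ht' : t.eval ρ σ = enc u) :
    (gateF s t).Holds k ρ σ ↔ N.line.Gate j u := by
  have h : ∀ x : LineVertex (Fin k),
      (Fm.Holds k (Function.update ρ 20 (enc x)) σ (arcF t (.var 20)) ∧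
        Fm.Holds k (Function.update ρ 20 (enc x)) σ (ownF s (.var 20))) ↔
      N.line.arc u x ∧ N.line.Own j x := fun x =>
    and_congr (holds_arcF hT (ht _) (by simp)) (holds_ownF hT (hs _) (by simp))
  simp only [gateF, Fm.Holds, vertices_val, exists_lt_iff, h, holds_sharedF hT ht',
    SumDigraph.Gate]

theorem holds_firstF {p : Tm → Fm} {q : LineVertex (Fin k) → Prop}
    (hp : (p t).Holds k ρ σ ↔ q v)
    (hp' : ∀ x, (p (.var 21)).Holds k (Function.update ρ 21 (enc x)) σ ↔ q x)
    (ht : ∀ i, t.eval (Function.update ρ 21 i) σ = enc v) :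
    (firstF p t).Holds k ρ σ ↔ SumDigraph.First enc q v := by
  simp only [firstF, Fm.Holds, vertices_val, exists_lt_iff, hp, hp', Fm.holds_lt, ht, Tm.eval,
    Function.update_self, SumDigraph.First]
  refine and_congr_right fun _ => ?_
  push Not
  exact forall_congr' fun x => ⟨fun h hx => by_contra fun hlt => h (by omega) hx,
    fun h hlt hx => absurd (h hx) (by omega)⟩

theorem holds_allSrcF (hT : HasTables N σ) (hs : s.eval ρ σ = enc u) :
    (allSrcF s).Holds k ρ σ ↔ ∀ i, N.line.Reach (N.line.src i) u := by
  have h : ∀ j : Fin 3, (reachF (srcT (.const j)) s).Holds k ρ σ ↔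
      N.line.Reach (N.line.src j) u := fun j =>
    holds_reachF hT (eval_srcT hT.toHasArcs j rfl) hs
  have h0 := h 0
  have h1 := h 1
  have h2 := h 2
  simp only [Fin.val_zero, Fin.val_one, Fin.val_two] at h0 h1 h2
  simp only [allSrcF, Fm.Holds, h0, h1, h2, Fin.forall_fin_succ, Fin.succ_zero_eq_one,
    Fin.succ_one_eq_two, IsEmpty.forall_iff, and_true]

theorem holds_hubPairF (hT : HasTables N σ) (hs : s.eval ρ σ = enc u) (ht : t.eval ρ σ = enc v) :
    (hubPairF s t).Holds k ρ σ ↔ N.line.IsHubPair u v := by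
  have h : ∀ (j : Fin 3) {s u}, s.eval ρ σ = enc u → ((reachF s (termT (.const j))).Holds k ρ σ ↔
      N.line.Reach u (N.line.term j)) := fun j _ _ hs =>
    holds_reachF hT hs (eval_termT hT.toHasArcs j rfl)
  have h0 := h 0 hs
  have h1 := h 1 hs
  have h2 := h 2 hs
  have h0' := h 0 ht
  have h1' := h 1 ht
  have h2' := h 2 ht
  simp only [Fin.val_zero, Fin.val_one, Fin.val_two] at h0 h1 h2 h0' h1' h2'
  simp only [hubPairF, Fm.Holds, Fm.holds_or, Fm.holds_eq, h0, h1, h2, h0', h1', h2',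
    holds_allSrcF hT hs, holds_allSrcF hT ht, holds_reachF hT hs ht, holds_reachF hT ht hs, hs, ht,
    enc_injective.eq_iff]
  constructor
  · rintro ⟨h1, h2, h3, h4⟩
    refine ⟨h1, h2, h3, ?_⟩
    simpa [Fin.forall_fin_succ] using h4
  · rintro ⟨h1, h2, h3, h4⟩
    exact ⟨h1, h2, h3, h4 0, h4 1, h4 2⟩

theorem holds_hubArcF (hT : HasTables N σ) {y z : LineVertex (Fin k)}
    (hy : σ 16 0 1 = enc y) (hz : σ 16 0 2 = enc z) (hu : ρ 0 = enc u) (hv : ρ 1 = enc v) :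
    (hubArcF (.var 0) (.var 1)).Holds k ρ σ ↔ N.line.HubArc enc y z u v := by
  have hyT : ∀ ρ : Env, (Tm.cell 16 (.const 0) (.const 1)).eval ρ σ = enc y := fun ρ => hy
  have hzT : ∀ ρ : Env, (Tm.cell 16 (.const 0) (.const 2)).eval ρ σ = enc z := fun ρ => hz
  have hu' : ∀ x i, x ≠ 0 → (Tm.var 0).eval (Function.update ρ x i) σ = enc u := by
    intro x i hx
    simp [Function.update_of_ne hx.symm, hu]
  have hv' : ∀ x i, x ≠ 1 → (Tm.var 1).eval (Function.update ρ x i) σ = enc v := by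
    intro x i hx
    simp [Function.update_of_ne hx.symm, hv]
  have hx' : ∀ x i, (Tm.var x).eval (Function.update ρ x i) σ = i := by simp
  have huT : (Tm.var 0).eval ρ σ = enc u := hu
  have hvT : (Tm.var 1).eval ρ σ = enc v := hv
  have hboth : (Fm.ex 20 vertices (.and (arcF (.var 0) (.var 20))
      (.and (reachF (.var 20) (.cell 16 (.const 0) (.const 1)))
        (reachF (.var 20) (.cell 16 (.const 0) (.const 2)))))).Holds k ρ σ ↔
      ∃ x, N.line.arc u x ∧ N.line.Reach x y ∧ N.line.Reach x z := by
    rw [Fm.Holds, vertices_val, exists_lt_iff]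
    refine exists_congr fun x => ?_
    rw [Fm.Holds, Fm.Holds, holds_arcF hT (hu' 20 _ (by decide)) (hx' _ _),
      holds_reachF hT (hx' _ _) (hyT _), holds_reachF hT (hx' _ _) (hzT _)]
  have f1 : (firstF (fun x => .and (arcF x (.var 1))
      (.or (reachF (.cell 16 (.const 0) (.const 1)) x)
        (reachF (.cell 16 (.const 0) (.const 2)) x))) (.var 0)).Holds k ρ σ ↔
      SumDigraph.First enc (fun x => N.line.arc x v ∧ (N.line.Reach y x ∨ N.line.Reach z x)) u := by
    refine holds_firstF ?_ (fun x => ?_) (hu' 21 · (by decide))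
    · rw [Fm.Holds, Fm.holds_or, holds_arcF hT huT hvT, holds_reachF hT (hyT _) huT,
        holds_reachF hT (hzT _) huT]
    · rw [Fm.Holds, Fm.holds_or, holds_arcF hT (hx' _ _) (hv' 21 _ (by decide)),
        holds_reachF hT (hyT _) (hx' _ _), holds_reachF hT (hzT _) (hx' _ _)]
  have f2 : (firstF (fun x => .and (arcF (.var 0) x)
      (.and (reachF x (.cell 16 (.const 0) (.const 1)))
        (reachF x (.cell 16 (.const 0) (.const 2))))) (.var 1)).Holds k ρ σ ↔
      SumDigraph.First enc (fun x => N.line.arc u x ∧ N.line.Reach x y ∧ N.line.Reach x z) v := by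
    refine holds_firstF ?_ (fun x => ?_) (hv' 21 · (by decide))
    · rw [Fm.Holds, Fm.Holds, holds_arcF hT huT hvT, holds_reachF hT hvT (hyT _),
        holds_reachF hT hvT (hzT _)]
    · rw [Fm.Holds, Fm.Holds, holds_arcF hT (hu' 21 _ (by decide)) (hx' _ _),
        holds_reachF hT (hx' _ _) (hyT _), holds_reachF hT (hx' _ _) (hzT _)]
  have f3 : ∀ {t : Tm} {y : LineVertex (Fin k)}, (∀ ρ, t.eval ρ σ = enc y) →
      ((firstF (fun x => .and (arcF (.var 0) x) (reachF x t)) (.var 1)).Holds k ρ σ ↔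
      SumDigraph.First enc (fun x => N.line.arc u x ∧ N.line.Reach x y) v) := by
    intro t y ht
    refine holds_firstF ?_ (fun x => ?_) (hv' 21 · (by decide))
    · rw [Fm.Holds, holds_arcF hT huT hvT, holds_reachF hT hvT (ht _)]
    · rw [Fm.Holds, holds_arcF hT (hu' 21 _ (by decide)) (hx' _ _),
        holds_reachF hT (hx' _ _) (ht _)]
  simp only [hubArcF, Fm.holds_or]
  rw [Fm.Holds, Fm.Holds, Fm.Holds, Fm.Holds, Fm.Holds, Fm.Holds, Fm.Holds, Fm.Holds, hboth, f1, f2,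
    Fm.holds_or, Fm.holds_or, f3 hyT, f3 hzT, holds_reachF hT (hyT _) hvT,
    holds_reachF hT (hzT _) hvT, Fm.holds_eq, Fm.holds_eq, hyT, hzT, hvT, enc_injective.eq_iff,
    enc_injective.eq_iff]
  rfl

end Formulas

/-- The effect of filling array 5. -/
theorem den_fill {c : Cmd} {ρ : Env} {σ : Memory}
    (R : LineVertex (Fin k) → LineVertex (Fin k) → ℕ → Prop)
    (hc : ∀ τ : Memory, (∀ b, b ≠ 5 → τ b = σ b) → ∀ u v : LineVertex (Fin k),
      let τ' := c.den k (Function.update (Function.update ρ 0 (enc u)) 1 (enc v)) τ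
      (∀ b, b ≠ 5 → τ' b = τ b) ∧ R u v (τ' 5 (enc u) (enc v)) ∧
        ∀ i j, i ≠ enc u ∨ j ≠ enc v → τ' 5 i j = τ 5 i j) :
    let τ := (Cmd.for 0 vertices (.for 1 vertices c)).den k ρ σ
    (∀ b, b ≠ 5 → τ b = σ b) ∧ ∀ u v, R u v (τ 5 (enc u) (enc v)) := by
  have := Cmd.den_for_induction (k := k) (x := 0) (b := vertices) (c := .for 1 vertices c) (ρ := ρ)
    (σ := σ) (fun m τ => (∀ b, b ≠ 5 → τ b = σ b) ∧
      ∀ u v : LineVertex (Fin k), enc u < m → R u v (τ 5 (enc u) (enc v)))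
    ⟨fun _ _ => rfl, by simp⟩ (by
      rintro m τ hm ⟨hτ, ih⟩
      obtain ⟨x, rfl⟩ := exists_enc hm
      have := Cmd.den_for_induction (k := k) (x := 1) (b := vertices) (c := c)
        (ρ := Function.update ρ 0 (enc x)) (σ := τ) (fun m' τ => (∀ b, b ≠ 5 → τ b = σ b) ∧
          (∀ u v : LineVertex (Fin k), enc u < enc x → R u v (τ 5 (enc u) (enc v))) ∧
          ∀ v : LineVertex (Fin k), enc v < m' → R x v (τ 5 (enc x) (enc v)))
        ⟨hτ, ih, by simp⟩ (by
          rintro m' τ hm' ⟨hτ, h1, h2⟩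
          obtain ⟨y, rfl⟩ := exists_enc hm'
          obtain ⟨g1, g2, g3⟩ := hc τ hτ x y
          refine ⟨fun b hb => (g1 b hb).trans (hτ b hb), fun u v hu => ?_, fun v hv => ?_⟩
          · rw [g3 _ _ (.inl (by omega))]; exact h1 u v hu
          · rcases eq_or_ne v y with rfl | hne
            · exact g2
            · have := enc_injective.ne hne
              rw [g3 _ _ (.inr this)]; exact h2 v (by omega))
      refine ⟨this.1, fun u v hu => ?_⟩
      rcases eq_or_ne u x with rfl | hne
      · exact this.2.2 v (enc_lt v)
      · have hne' := enc_injective.ne hne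
        exact this.2.1 u v (by omega))
  exact ⟨this.1, fun u v => this.2 u v (enc_lt u)⟩

/-- The first pair of loops keeps the property that some hub pair is stored: a pass either leaves
the cells alone or stores another hub pair. The pass for the given pair stores it. -/
theorem den_hubC {ρ : Env} {σ : Memory} (hT : HasTables N σ) (h : ∃ y z, N.line.IsHubPair y z) :
    ∃ y z, N.line.IsHubPair y z ∧ ∀ u v,
      (N.line.HubArc enc y z u v → hubC.den k ρ σ 5 (enc u) (enc v) = 1) ∧
      (¬ N.line.HubArc enc y z u v → hubC.den k ρ σ 5 (enc u) (enc v) = 0) := by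
  classical
  set c₁ : Cmd := .for 0 vertices (.for 1 vertices (.ite (hubPairF (.var 0) (.var 1))
    (.seq (.set 16 (.const 0) (.const 1) (.var 0)) (.set 16 (.const 0) (.const 2) (.var 1))) .skip))
    with hc₁
  obtain ⟨y₀, z₀, hyz₀⟩ := h
  have hpair : ∀ {i j : ℕ} {τ : Memory}, HasTables N τ → i < k + 6 → j < k + 6 →
      ∃ y z, enc y = i ∧ enc z = j ∧ ((hubPairF (.var 0) (.var 1)).Holds k
        (Function.update (Function.update ρ 0 i) 1 j) τ ↔ N.line.IsHubPair y z) := by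
    intro i j τ hτ hi hj
    obtain ⟨y, rfl⟩ := exists_enc hi
    obtain ⟨z, rfl⟩ := exists_enc hj
    exact ⟨y, z, rfl, rfl, holds_hubPairF hτ (by simp) (by simp)⟩
  have hkeep : ∀ {τ : Memory} {i j : ℕ}, HasTables N τ →
      HasTables N (Cmd.den k (.ite (hubPairF (.var 0) (.var 1))
    (.seq (.set 16 (.const 0) (.const 1) (.var 0)) (.set 16 (.const 0) (.const 2) (.var 1))) .skip)
    (Function.update (Function.update ρ 0 i) 1 j) τ) := by
    intro τ i j hτ
    refine hτ.congr fun a ha => Cmd.den_of_notMem_writes k _ _ _ ?_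
    rcases ha with rfl | rfl | rfl | rfl | rfl <;> decide
  have hD' : ∀ i j (τ : Memory), i < k + 6 → j < k + 6 → HasTables N τ →
      ((∃ y z, N.line.IsHubPair y z ∧ τ 16 0 1 = enc y ∧ τ 16 0 2 = enc z) ∨
        (i = enc y₀ ∧ j = enc z₀)) →
      ∃ y z, N.line.IsHubPair y z ∧
        Cmd.den k (.ite (hubPairF (.var 0) (.var 1)) (.seq (.set 16 (.const 0) (.const 1) (.var 0))
          (.set 16 (.const 0) (.const 2) (.var 1))) .skip)
          (Function.update (Function.update ρ 0 i) 1 j) τ 16 0 1 = enc y ∧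
        Cmd.den k (.ite (hubPairF (.var 0) (.var 1)) (.seq (.set 16 (.const 0) (.const 1) (.var 0))
          (.set 16 (.const 0) (.const 2) (.var 1))) .skip)
          (Function.update (Function.update ρ 0 i) 1 j) τ 16 0 2 = enc z := by
    intro i j τ hi hj hτ h
    obtain ⟨y, z, rfl, rfl, hiff⟩ := hpair hτ hi hj
    rw [Cmd.den]
    split
    · rename_i hh
      exact ⟨y, z, hiff.1 hh, by simp [Cmd.den, write_apply], by simp [Cmd.den, write_apply]⟩
    · rename_i hh
      rcases h with h | ⟨h1, h2⟩
      · exact h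
      · rw [hiff, enc_injective h1, enc_injective h2] at hh
        exact (hh hyz₀).elim
  have hTfor : ∀ {τ : Memory} {i : ℕ}, HasTables N τ → HasTables N (Cmd.den k
      (.for 1 vertices (.ite (hubPairF (.var 0) (.var 1)) (.seq
        (.set 16 (.const 0) (.const 1) (.var 0)) (.set 16 (.const 0) (.const 2) (.var 1))) .skip))
      (Function.update ρ 0 i) τ) :=
    fun hτ => Cmd.den_for_keeps _ hτ fun _ _ _ h => hkeep h
  obtain ⟨y, z, hyz, hy, hz⟩ : ∃ y z, N.line.IsHubPair y z ∧ c₁.den k ρ σ 16 0 1 = enc y ∧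
      c₁.den k ρ σ 16 0 2 = enc z := by
    refine Cmd.den_for_search (k := k) (x := 0) (b := vertices) (ρ := ρ) (σ := σ) (HasTables N)
      (fun τ => ∃ y z, N.line.IsHubPair y z ∧ τ 16 0 1 = enc y ∧ τ 16 0 2 = enc z) hT
      (fun i τ _ hτ => hTfor hτ) (fun i τ hi hτ h => ?_) (enc_lt y₀) (fun τ hτ => ?_)
    · exact (Cmd.den_for_keeps (b := vertices) (fun τ => HasTables N τ ∧
        ∃ y z, N.line.IsHubPair y z ∧ τ 16 0 1 = enc y ∧ τ 16 0 2 = enc z) ⟨hτ, h⟩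
        fun j τ hj h => ⟨hkeep h.1, hD' i j τ hi hj h.1 (.inl h.2)⟩).2
    · exact Cmd.den_for_search (k := k) (x := 1) (b := vertices) (HasTables N)
        (fun τ => ∃ y z, N.line.IsHubPair y z ∧ τ 16 0 1 = enc y ∧ τ 16 0 2 = enc z) hτ
        (fun j τ _ hτ => hkeep hτ) (fun j τ hj hτ h => hD' _ j τ (enc_lt _) hj hτ (.inl h))
        (enc_lt z₀) fun τ hτ => hD' _ _ τ (enc_lt _) (enc_lt _) hτ (.inr ⟨rfl, rfl⟩)
  have hT₁ : HasTables N (c₁.den k ρ σ) := Cmd.den_for_keeps _ hT fun _ _ _ h => hTfor h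
  have := den_fill (k := k) (ρ := ρ) (σ := c₁.den k ρ σ)
    (c := .ite (hubArcF (.var 0) (.var 1))
      (.set 5 (.var 0) (.var 1) (.const 1)) (.set 5 (.var 0) (.var 1) (.const 0)))
    (fun u v x => (N.line.HubArc enc y z u v → x = 1) ∧ (¬ N.line.HubArc enc y z u v → x = 0)) (by
      intro τ hτ u v
      have hTτ : HasTables N τ := hT₁.congr fun a ha => hτ a (by omega)
      have hiff := holds_hubArcF (u := u) (v := v) (y := y) (z := z)
        (ρ := Function.update (Function.update ρ 0 (enc u)) 1 (enc v)) hTτ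
        (by rw [hτ 16 (by decide), hy]) (by rw [hτ 16 (by decide), hz]) (by simp) (by simp)
      intro τ'
      refine ⟨fun b hb => Cmd.den_of_notMem_writes k _ _ _ (by simpa [Cmd.writes] using hb), ?_⟩
      simp only [τ', Cmd.den, ← hiff]
      split
      · rename_i hh
        refine ⟨by simp [write_apply, hh], fun i j hij => ?_⟩
        simp [write_apply]; omega
      · rename_i hh
        refine ⟨by simp [write_apply, hh], fun i j hij => ?_⟩
        simp [write_apply]; omega)
  exact ⟨y, z, hyz, this.2⟩

end SumAlgorithm

/-! ### Rank, span and openness as properties testable by finite search -/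

namespace SumDigraph

open Module Submodule Relation

variable {W : Type*} {F : Type*} [Field F] {D : SumDigraph W} {g : W → Fin 3 → F}

theorem exists_linearIndependent_iff_le_finrank {Q : Set W} {r : ℕ} :
    (∃ w : Fin r → W, (∀ i, w i ∈ Q) ∧ LinearIndependent F fun i => g (w i)) ↔
      r ≤ finrank F (span F (g '' Q)) := by
  constructor
  · rintro ⟨w, hw, hli⟩
    rw [← Fintype.card_fin r, ← finrank_span_eq_card hli]
    refine Submodule.finrank_mono (span_mono ?_)
    rintro _ ⟨i, rfl⟩
    exact ⟨w i, hw i, rfl⟩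
  · intro h
    obtain ⟨f, hf, -, hli⟩ := exists_fun_fin_finrank_span_eq F (g '' Q)
    choose w hw hwf using hf
    refine ⟨fun i => w (Fin.castLE h i), fun i => hw _, ?_⟩
    simp only [hwf]
    exact hli.comp _ (Fin.castLE_injective h)

/-- Three vectors, of which those excluded by `α` and `β` do not count, are independent. -/
theorem exists_independent_iff {Q : Set W} {α β : Prop} [Decidable α] [Decidable β] :
    (∃ u ∈ Q, ∃ v ∈ Q, ∃ w ∈ Q, ∀ a b c : F, (α → b = 0) → (β → c = 0) →
      (∀ l, a * g u l + b * g v l + c * g w l = 0) → a = 0 ∧ b = 0 ∧ c = 0) ↔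
    3 ≤ finrank F (span F (g '' Q)) + ((if α then 1 else 0) + if β then 1 else 0) := by
  have h3 : ∀ {u v w : W} {a b c : F}, (∀ l, a * g u l + b * g v l + c * g w l = 0) ↔
      a • g u + b • g v + c • g w = 0 := by
    intro u v w a b c
    rw [funext_iff]
    rfl
  simp only [h3]
  by_cases hα : α <;> by_cases hβ : β
  · simp only [hα, hβ, if_true, forall_const]
    have : (3 ≤ finrank F (span F (g '' Q)) + (1 + 1)) ↔ 1 ≤ finrank F (span F (g '' Q)) := by omega
    rw [this, ← exists_linearIndependent_iff_le_finrank]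
    constructor
    · rintro ⟨u, hu, v, hv, w, hw, h⟩
      refine ⟨fun _ => u, fun _ => hu, Fintype.linearIndependent_iff.2 fun a ha i => ?_⟩
      rw [Fin.sum_univ_one] at ha
      rw [Fin.fin_one_eq_zero i]
      exact (h (a 0) 0 0 rfl rfl (by simpa using ha)).1
    · rintro ⟨w, hw, h⟩
      -- Excused places are filled by repeating a vertex; their coefficients are forced to be zero.
      refine ⟨w 0, hw 0, w 0, hw 0, w 0, hw 0, ?_⟩
      rintro a b c rfl rfl hz
      have := Fintype.linearIndependent_iff.1 h (fun _ => a) (by simpa using hz) 0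
      exact ⟨this, rfl, rfl⟩
  · simp only [hα, hβ, if_true, if_false, forall_const, false_imp_iff]
    have : (3 ≤ finrank F (span F (g '' Q)) + (1 + 0)) ↔ 2 ≤ finrank F (span F (g '' Q)) := by omega
    rw [this, ← exists_linearIndependent_iff_le_finrank]
    constructor
    · rintro ⟨u, hu, v, hv, w, hw, h⟩
      refine ⟨![u, w], fun i => by fin_cases i <;> assumption,
        Fintype.linearIndependent_iff.2 fun a ha i => ?_⟩
      rw [Fin.sum_univ_two] at ha
      have := h (a 0) 0 (a 1) rfl (by simpa using ha)
      fin_cases i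
      · exact this.1
      · exact this.2.2
    · rintro ⟨w, hw, h⟩
      refine ⟨w 0, hw 0, w 0, hw 0, w 1, hw 1, ?_⟩
      rintro a b c rfl hz
      have := Fintype.linearIndependent_iff.1 h ![a, c]
        (by rw [Fin.sum_univ_two]; simpa using hz)
      exact ⟨this 0, rfl, this 1⟩
  · simp only [hα, hβ, if_true, if_false, forall_const, false_imp_iff]
    have : (3 ≤ finrank F (span F (g '' Q)) + (0 + 1)) ↔ 2 ≤ finrank F (span F (g '' Q)) := by omega
    rw [this, ← exists_linearIndependent_iff_le_finrank]
    constructor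
    · rintro ⟨u, hu, v, hv, w, hw, h⟩
      refine ⟨![u, v], fun i => by fin_cases i <;> assumption,
        Fintype.linearIndependent_iff.2 fun a ha i => ?_⟩
      rw [Fin.sum_univ_two] at ha
      have := h (a 0) (a 1) 0 rfl (by simpa using ha)
      fin_cases i
      · exact this.1
      · exact this.2.1
    · rintro ⟨w, hw, h⟩
      refine ⟨w 0, hw 0, w 1, hw 1, w 0, hw 0, ?_⟩
      rintro a b c rfl hz
      have := Fintype.linearIndependent_iff.1 h ![a, b]
        (by rw [Fin.sum_univ_two]; simpa using hz)
      exact ⟨this 0, this 1, rfl⟩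
  · simp only [hα, hβ, if_false, false_imp_iff, forall_const, add_zero]
    rw [← exists_linearIndependent_iff_le_finrank]
    constructor
    · rintro ⟨u, hu, v, hv, w, hw, h⟩
      refine ⟨![u, v, w], fun i => by fin_cases i <;> assumption,
        Fintype.linearIndependent_iff.2 fun a ha i => ?_⟩
      rw [Fin.sum_univ_three] at ha
      have := h (a 0) (a 1) (a 2) (by simpa using ha)
      fin_cases i
      · exact this.1
      · exact this.2.1
      · exact this.2.2
    · rintro ⟨w, hw, h⟩
      refine ⟨w 0, hw 0, w 1, hw 1, w 2, hw 2, ?_⟩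
      rintro a b c hz
      have := Fintype.linearIndependent_iff.1 h ![a, b, c]
        (by rw [Fin.sum_univ_three]; simpa using hz)
      exact ⟨this 0, this 1, this 2⟩

/-- Vectors in a span are combinations of three vectors. -/
theorem mem_span_iff_exists_three [Nonempty W] {S : Set W} {x : Fin 3 → F} :
    x ∈ span F (g '' S) ↔ ∃ u v w, ∃ a b c : F, (a = 0 ∨ u ∈ S) ∧ (b = 0 ∨ v ∈ S) ∧
      (c = 0 ∨ w ∈ S) ∧ ∀ l, a * g u l + b * g v l + c * g w l = x l := by
  constructor
  · intro hx
    obtain ⟨f, hf, hspan, -⟩ := exists_fun_fin_finrank_span_eq F (g '' S)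
    rw [← hspan, mem_span_range_iff_exists_fun] at hx
    obtain ⟨a, ha⟩ := hx
    choose w hw hwf using hf
    have hd : finrank F (span F (g '' S)) ≤ 3 := by
      simpa using Submodule.finrank_le (span F (g '' S))
    -- If the basis of the span has fewer than three members, it is padded by an arbitrary vertex
    -- with coefficient 0.
    let w' (i : ℕ) : W := if h : i < finrank F (span F (g '' S)) then w ⟨i, h⟩ else
      Classical.arbitrary W
    let a' (i : ℕ) : F := if h : i < finrank F (span F (g '' S)) then a ⟨i, h⟩ else 0
    have hmem : ∀ i, a' i = 0 ∨ w' i ∈ S := by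
      intro i
      by_cases h : i < finrank F (span F (g '' S))
      · right; simp only [w', dif_pos h]; exact hw _
      · left; simp only [a', dif_neg h]
    refine ⟨w' 0, w' 1, w' 2, a' 0, a' 1, a' 2, hmem _, hmem _, hmem _, fun l => ?_⟩
    have h1 : ∑ i ∈ Finset.range 3, a' i * g (w' i) l = x l := by
      rw [← Finset.sum_subset (Finset.range_mono hd)]
      · rw [Finset.sum_range, ← ha, Finset.sum_apply]
        refine Finset.sum_congr rfl fun i _ => ?_
        simp only [a', w', i.2, dif_pos, ← hwf, Pi.smul_apply, smul_eq_mul]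
      · intro i _ hi
        have hi' : ¬ i < finrank F (span F (g '' S)) := by simpa using hi
        simp only [a', dif_neg hi', zero_mul]
    rw [← h1]
    simp [Finset.sum_range_succ]
  · rintro ⟨u, v, w, a, b, c, hu, hv, hw, h⟩
    have hx : x = a • g u + b • g v + c • g w := by
      ext l; exact (h l).symm
    have key : ∀ {u : W} {a : F}, (a = 0 ∨ u ∈ S) → a • g u ∈ span F (g '' S) := by
      rintro u a (rfl | h)
      · simp
      · exact smul_mem _ _ (subset_span ⟨u, h, rfl⟩)
    rw [hx]
    exact add_mem (add_mem (key hu) (key hv)) (key hw)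

variable [Fintype W] [DecidableEq W] {P : Finset W} {B : W → Prop}

/-- The vertices from which unprocessed shared vertices outside `C` lead to a target. -/
def Tail (D : SumDigraph W) (B : W → Prop) (P : Finset W) (C : W → Prop) (u : W) : Prop :=
  ∃ w, ReflTransGen (fun u v => ¬ C u ∧ D.arc u v ∧ D.Shared v ∧ v ∉ P) u w ∧ B w ∧ ¬ C w

/-- For a given cut, `Tail` is the least closed set, so it gives the smallest rank; and cuts with at
least three vertices need no check. This reduces the invariant to polynomially many reachability
problems. -/
theorem open_iff_tail : D.Open B P g ↔ ∀ C : Finset W, C.card ≤ 2 →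
    (∀ c ∈ C, D.Shared c ∧ c ∉ P) →
    3 ≤ finrank F (span F (g '' {u | D.Tail B P (· ∈ C) u ∧ u ∈ P})) + C.card := by
  classical
  constructor
  · intro h C _ hC
    have := h C (Finset.univ.filter (D.Tail B P (· ∈ C))) hC (by
      constructor
      · intro b hb hbC
        simpa using ⟨b, .refl, hb, hbC⟩
      · intro u v huv hv hvX hvP huC
        simp only [Finset.mem_filter, Finset.mem_univ, true_and] at hvX ⊢
        obtain ⟨w, hvw, hw⟩ := hvX
        exact ⟨w, hvw.head ⟨huC, huv, hv, hvP⟩, hw⟩)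
    refine this.trans (Nat.add_le_add_right (Submodule.finrank_mono (span_mono
      (Set.image_mono ?_))) _)
    rintro u ⟨hu, huP⟩
    exact ⟨(Finset.mem_filter.1 hu).2, huP⟩
  · intro h C X hC hX
    rcases Nat.lt_or_ge 2 C.card with h3 | h2
    · omega
    refine (h C h2 hC).trans (Nat.add_le_add_right (Submodule.finrank_mono (span_mono
      (Set.image_mono ?_))) _)
    rintro u ⟨⟨w, huw, hw, hwC⟩, huP⟩
    refine ⟨?_, huP⟩
    clear huP
    induction huw using ReflTransGen.head_induction_on with
    | refl => exact hX.1 _ hw hwC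
    | head h _ ih => exact hX.2 _ _ h.2.1 h.2.2.1 ih h.2.2.2 h.1

end SumDigraph

/-! ### Coding of the four-element field and of partial multicasts in memory -/

namespace SumAlgorithm

open LoopLang RAM SumNetwork Relation Module Submodule

variable {n k : ℕ} {N : SumNetwork (Fin n) (Fin k)} {F : Type*} [Field F]

/-- The numbers below 4 stand for the elements of the field with four elements. -/
structure IsCoding (dec : ℕ → F) : Prop where
  inj : ∀ x < 4, ∀ y < 4, dec x = dec y → x = y
  surj : ∀ a, ∃ x < 4, dec x = a
  zero : dec 0 = 0
  one : dec 1 = 1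
  add : ∀ x < 4, ∀ y < 4, dec (addCode x y) = dec x + dec y
  mul : ∀ x < 4, ∀ y < 4, dec (mulCode x y) = dec x * dec y

theorem addCode_lt : ∀ x < 4, ∀ y < 4, addCode x y < 4 := by decide

theorem mulCode_lt : ∀ x < 4, ∀ y < 4, mulCode x y < 4 := by decide

namespace IsCoding

variable {dec : ℕ → F} (hc : IsCoding dec)
include hc

theorem forall_iff {p : F → Prop} : (∀ a, p a) ↔ ∀ x < 4, p (dec x) := by
  refine ⟨fun h x _ => h _, fun h a => ?_⟩
  obtain ⟨x, hx, rfl⟩ := hc.surj a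
  exact h x hx

theorem exists_iff {p : F → Prop} : (∃ a, p a) ↔ ∃ x < 4, p (dec x) := by
  refine ⟨?_, fun ⟨x, _, h⟩ => ⟨_, h⟩⟩
  rintro ⟨a, ha⟩
  obtain ⟨x, hx, rfl⟩ := hc.surj a
  exact ⟨x, hx, ha⟩

theorem eq_iff {x y : ℕ} (hx : x < 4) (hy : y < 4) : dec x = dec y ↔ x = y :=
  ⟨hc.inj x hx y hy, congrArg dec⟩

theorem eq_zero_iff {x : ℕ} (hx : x < 4) : dec x = 0 ↔ x = 0 := by
  rw [← hc.zero, hc.eq_iff hx (by decide)]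

theorem card_eq : Nat.card F = 4 := by
  rw [← Nat.card_fin 4]
  refine (Nat.card_congr (Equiv.ofBijective (fun x : Fin 4 => dec x) ⟨?_, ?_⟩)).symm
  · exact fun x y h => Fin.ext (hc.inj x x.2 y y.2 h)
  · intro a
    obtain ⟨x, hx, rfl⟩ := hc.surj a
    exact ⟨⟨x, hx⟩, rfl⟩

theorem finite : Finite F := Nat.finite_of_card_ne_zero (by rw [hc.card_eq]; decide)

theorem eval_combT {ρ : Env} {σ : Memory} (hT : HasTables N σ)
    (hlt : ∀ w : LineVertex (Fin k), ∀ l < 3, σ 13 (enc w) l < 4)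
    {p q r a b c l : Tm} {u v w : LineVertex (Fin k)} {x y z m : ℕ}
    (hp : p.eval ρ σ = enc u) (hq : q.eval ρ σ = enc v) (hr : r.eval ρ σ = enc w)
    (ha : a.eval ρ σ = x) (hb : b.eval ρ σ = y) (hc' : c.eval ρ σ = z) (hl : l.eval ρ σ = m)
    (hx : x < 4) (hy : y < 4) (hz : z < 4) (hm : m < 3) :
    (combT p q r a b c l).eval ρ σ < 4 ∧ dec ((combT p q r a b c l).eval ρ σ) =
      dec x * dec (σ 13 (enc u) m) + dec y * dec (σ 13 (enc v) m) +
        dec z * dec (σ 13 (enc w) m) := by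
  have hu := hlt u m hm
  have hv := hlt v m hm
  have hw := hlt w m hm
  have h1 := mulCode_lt _ hx _ hu
  have h2 := mulCode_lt _ hy _ hv
  have h3 := mulCode_lt _ hz _ hw
  have h4 := addCode_lt _ h1 _ h2
  simp only [combT, addT, mulT, Tm.eval, hp, hq, hr, ha, hb, hc', hl]
  rw [hT.mul _ hx _ hu, hT.mul _ hy _ hv, hT.mul _ hz _ hw, hT.add _ h1 _ h2, hT.add _ h4 _ h3,
    hc.add _ h4 _ h3, hc.add _ h1 _ h2, hc.mul _ hx _ hu, hc.mul _ hy _ hv, hc.mul _ hz _ hw]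
  exact ⟨addCode_lt _ h4 _ h3, rfl⟩

end IsCoding

/-- The memory represents a partial multicast. -/
structure Repr (N : SumNetwork (Fin n) (Fin k)) (dec : ℕ → F) (σ : Memory)
    (P : Finset (LineVertex (Fin k))) (g : LineVertex (Fin k) → Fin 3 → F) : Prop where
  tables : HasTables N σ
  processed : ∀ w, σ 14 0 (enc w) ≠ 0 ↔ w ∈ P
  lt : ∀ w : LineVertex (Fin k), ∀ l < 3, σ 13 (enc w) l < 4
  vec : ∀ w ∈ P, ∀ l : Fin 3, dec (σ 13 (enc w) l) = g w l
  term : ∀ j : Fin 3, ∀ l < 3, σ 13 (enc (N.line.term j)) l = 1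

variable {dec : ℕ → F} {σ : Memory} {P : Finset (LineVertex (Fin k))}
  {g : LineVertex (Fin k) → Fin 3 → F} {ρ : Env}

theorem Repr.congr (h : Repr N dec σ P g) {τ : Memory}
    (hτ : ∀ a, a = 0 ∨ a = 9 ∨ a = 10 ∨ a = 11 ∨ a = 12 ∨ a = 13 ∨ a = 14 → τ a = σ a) :
    Repr N dec τ P g where
  tables := h.tables.congr fun a ha => hτ a (by omega)
  processed := by rw [hτ 14 (by simp)]; exact h.processed
  lt := by rw [hτ 13 (by simp)]; exact h.lt
  vec := by rw [hτ 13 (by simp)]; exact h.vec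
  term := by rw [hτ 13 (by simp)]; exact h.term

theorem forall_fin_three {p : Fin 3 → Prop} : (∀ l, p l) ↔ p 0 ∧ p 1 ∧ p 2 := by
  simp [Fin.forall_fin_succ]

/-- The memory may hold meaningless vectors at unprocessed vertices. They do no harm as long as
their coefficient is 0, which explains the disjunctions. -/
theorem Repr.comb_eq_iff (h : Repr N dec σ P g) (hc : IsCoding dec)
    {p q r a b c : Tm} {u v w : LineVertex (Fin k)} {x y z : ℕ}
    (hp : p.eval ρ σ = enc u) (hq : q.eval ρ σ = enc v) (hr : r.eval ρ σ = enc w)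
    (ha : a.eval ρ σ = x) (hb : b.eval ρ σ = y) (hc' : c.eval ρ σ = z)
    (hx : x < 4) (hy : y < 4) (hz : z < 4) (hu : x = 0 ∨ u ∈ P) (hv : y = 0 ∨ v ∈ P)
    (hw : z = 0 ∨ w ∈ P) {l : Fin 3} {m : ℕ} (hm : m < 4) :
    (combT p q r a b c (.const l)).eval ρ σ = m ↔
      dec x * g u l + dec y * g v l + dec z * g w l = dec m := by
  obtain ⟨h1, h2⟩ := hc.eval_combT h.tables h.lt hp hq hr ha hb hc' (l := .const l) (m := l) rfl
    hx hy hz l.2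
  have key : ∀ {x u}, (x = 0 ∨ u ∈ P) → dec x * dec (σ 13 (enc u) l) = dec x * g u l := by
    rintro x u (rfl | hu)
    · rw [hc.zero]; ring
    · rw [h.vec u hu]
  rw [← hc.eq_iff h1 hm, h2, key hu, key hv, key hw]

theorem holds_independentF (h : Repr N dec σ P g) (hc : IsCoding dec)
    {M : LineVertex (Fin k) → Prop} (hM : ∀ u, σ 15 0 (enc u) ≠ 0 ↔ M u) :
    independentF.Holds k ρ σ ↔ 3 ≤ finrank F (span F (g '' {u | M u ∧ u ∈ P})) +
      ((if ρ 16 < k + 6 then 1 else 0) + if ρ 17 < k + 6 then 1 else 0) := by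
  rw [← SumDigraph.exists_independent_iff]
  have hk := h.tables.size
  rw [independentF, Fm.Holds, vertices_val, exists_lt_iff]
  refine exists_congr fun u => ?_
  rw [Fm.Holds, Fm.Holds]
  refine (and_congr_left' (b := u ∈ {u | M u ∧ u ∈ P}) ?_).trans (and_congr_right fun hu => ?_)
  · simp [processedF, hM u, h.processed u, -ne_eq]
  rw [Fm.Holds, vertices_val, exists_lt_iff]
  refine exists_congr fun v => ?_
  rw [Fm.Holds, Fm.Holds]
  refine (and_congr_left' (b := v ∈ {u | M u ∧ u ∈ P}) ?_).trans (and_congr_right fun hv => ?_)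
  · simp [processedF, hM v, h.processed v, -ne_eq]
  rw [Fm.Holds, vertices_val, exists_lt_iff]
  refine exists_congr fun w => ?_
  rw [Fm.Holds, Fm.Holds]
  refine (and_congr_left' (b := w ∈ {u | M u ∧ u ∈ P}) ?_).trans (and_congr_right fun hw => ?_)
  · simp [processedF, hM w, h.processed w, -ne_eq]
  rw [Fm.holds_all, num_val, hc.forall_iff]
  refine forall₂_congr fun x hx => ?_
  rw [Fm.holds_all, num_val, hc.forall_iff]
  refine forall₂_congr fun y hy => ?_
  rw [Fm.holds_all, num_val, hc.forall_iff]
  refine forall₂_congr fun z hz => ?_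
  rw [hc.eq_zero_iff hx, hc.eq_zero_iff hy, hc.eq_zero_iff hz, forall_fin_three, ← hc.zero]
  have key : ∀ l : Fin 3, _ := fun l => h.comb_eq_iff hc (l := l) (m := 0) (p := .var 20)
    (q := .var 21) (r := .var 22) (a := .var 23) (b := .var 24) (c := .var 25)
    (ρ := Function.update (Function.update (Function.update (Function.update (Function.update
      (Function.update ρ 20 (enc u)) 21 (enc v)) 22 (enc w)) 23 x) 24 y) 25 z)
    (by simp) (by simp) (by simp) (by simp) (by simp) (by simp)
    hx hy hz (.inr hu.2) (.inr hv.2) (.inr hw.2) (by decide)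
  have k0 := key 0
  have k1 := key 1
  have k2 := key 2
  simp only [Fin.val_zero, Fin.val_one, Fin.val_two] at k0 k1 k2
  simp only [← k0, ← k1, ← k2, Fm.holds_imp, Fm.Holds, Fm.holds_eq, Fm.holds_lt, numVertices,
    numEdges, Tm.eval, hk, Function.update_apply]
  simp

end SumAlgorithm

namespace LoopLang

open RAM

/-- A loop that checks a property of all its indices. -/
theorem Cmd.den_for_forall {k x : ℕ} {b : Range} {c : Cmd} {ρ : Env} {σ : Memory}
    (I D : Memory → Prop) (Q : ℕ → Prop) (h0 : I σ)
    (hs : ∀ i τ, i < b.val k → I τ → I (c.den k (Function.update ρ x i) τ) ∧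
      (D (c.den k (Function.update ρ x i) τ) ↔ D τ ∧ Q i)) :
    I ((Cmd.for x b c).den k ρ σ) ∧
      (D ((Cmd.for x b c).den k ρ σ) ↔ D σ ∧ ∀ i < b.val k, Q i) := by
  refine Cmd.den_for_induction (fun m τ => I τ ∧ (D τ ↔ D σ ∧ ∀ i < m, Q i)) ⟨h0, by simp⟩ ?_
  rintro m τ hm ⟨hI, hD⟩
  obtain ⟨h1, h2⟩ := hs m τ hm hI
  refine ⟨h1, h2.trans ?_⟩
  rw [hD, and_assoc]
  refine and_congr_right fun _ => ⟨fun ⟨h, h'⟩ i hi => ?_, fun h => ⟨fun i hi => h i (by omega),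
    h m (by omega)⟩⟩
  rcases eq_or_ne i m with rfl | hne
  · exact h'
  · exact h i (by omega)

end LoopLang

/-! ### Testing the invariant -/

namespace SumAlgorithm

open LoopLang RAM SumNetwork Relation Module Submodule

variable {n k : ℕ} {N : SumNetwork (Fin n) (Fin k)} {F : Type*} [Field F]
  {dec : ℕ → F} {σ : Memory} {P : Finset (LineVertex (Fin k))}
  {g : LineVertex (Fin k) → Fin 3 → F} {ρ : Env}

theorem Repr.holds_processedF (h : Repr N dec σ P g) {s : Tm} {u : LineVertex (Fin k)}
    (hs : s.eval ρ σ = enc u) : (processedF s).Holds k ρ σ ↔ u ∈ P := by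
  simp only [processedF, Fm.Holds, Tm.eval, hs, h.processed]

theorem Repr.holds_cutF (h : Repr N dec σ P g) {s : Tm} {a : ℕ} (hs : s.eval ρ σ = a) :
    (cutF s).Holds k ρ σ ↔
      ∀ c : LineVertex (Fin k), enc c = a → N.line.Shared c ∧ c ∉ P := by
  simp only [cutF, Fm.holds_imp, Fm.holds_lt, numVertices, numEdges, Tm.eval, h.tables.size, hs,
    Fm.Holds]
  constructor
  · rintro h1 c rfl
    obtain ⟨h2, h3⟩ := h1 (enc_lt c)
    exact ⟨(holds_sharedF h.tables hs).1 h2, mt (h.holds_processedF hs).2 h3⟩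
  · intro h1 ha
    obtain ⟨c, rfl⟩ := exists_enc ha
    obtain ⟨h2, h3⟩ := h1 c rfl
    exact ⟨(holds_sharedF h.tables hs).2 h2, mt (h.holds_processedF hs).1 h3⟩

/-- The cut that consists of the vertices with numbers `a` and `b` does not prevent terminal `j`
from obtaining the whole space. -/
def Passes (N : SumNetwork (Fin n) (Fin k)) (P : Finset (LineVertex (Fin k)))
    (g : LineVertex (Fin k) → Fin 3 → F) (j : Fin 3) (a b : ℕ) : Prop :=
  (∀ c : LineVertex (Fin k), enc c = a ∨ enc c = b → N.line.Shared c ∧ c ∉ P) →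
    3 ≤ finrank F (span F
      (g '' {u | N.line.Tail (N.line.Gate j) P (fun w => enc w = a ∨ enc w = b) u ∧ u ∈ P})) +
      ((if a < k + 6 then 1 else 0) + if b < k + 6 then 1 else 0)

/-- The index `k + 6`, which numbers no vertex, fills the unused places of a cut with fewer than two
vertices. -/
theorem exists_cut {C : Finset (LineVertex (Fin k))} (hC : C.card ≤ 2) :
    ∃ a < k + 7, ∃ b < k + 7, (∀ w : LineVertex (Fin k), (enc w = a ∨ enc w = b) ↔ w ∈ C) ∧
      ((if a < k + 6 then 1 else 0) + if b < k + 6 then 1 else 0) = C.card := by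
  have hne : ∀ w : LineVertex (Fin k), enc w ≠ k + 6 := fun w => (enc_lt w).ne
  have hlt : ∀ w : LineVertex (Fin k), enc w < k + 7 := fun w => (enc_lt w).trans (by omega)
  interval_cases h : C.card
  · obtain rfl := Finset.card_eq_zero.1 h
    exact ⟨k + 6, by omega, k + 6, by omega, by simp [hne], by simp⟩
  · obtain ⟨c, rfl⟩ := Finset.card_eq_one.1 h
    exact ⟨enc c, hlt c, k + 6, by omega, by simp [hne, enc_injective.eq_iff], by simp [enc_lt]⟩
  · obtain ⟨c, d, -, rfl⟩ := Finset.card_eq_two.1 h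
    exact ⟨enc c, hlt c, enc d, hlt d, by simp [enc_injective.eq_iff], by simp [enc_lt]⟩

theorem forall_passes_iff {j : Fin 3} :
    (∀ a < k + 7, ∀ b < k + 7, Passes N P g j a b) ↔ N.line.Open (N.line.Gate j) P g := by
  classical
  rw [SumDigraph.open_iff_tail]
  constructor
  · intro h C hC hCP
    obtain ⟨a, ha, b, hb, hab, hcard⟩ := exists_cut hC
    have := h a ha b hb fun c hc => hCP c ((hab c).1 hc)
    rwa [hcard, show (fun w : LineVertex (Fin k) => enc w = a ∨ enc w = b) = (· ∈ C) from
      funext fun w => propext (hab w)] at this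
  · intro h a _ b _ hab
    let C : Finset (LineVertex (Fin k)) := Finset.univ.filter fun w => enc w = a ∨ enc w = b
    have hC : ∀ w, w ∈ C ↔ (enc w = a ∨ enc w = b) := by simp [C]
    -- If both indices name the same vertex, the test counts it twice and asks for less than the
    -- invariant. The cut is tested properly when that vertex is paired with `k + 6`.
    have hcard : C.card ≤ (if a < k + 6 then 1 else 0) + if b < k + 6 then 1 else 0 := by
      have h1 : ∀ a : ℕ, (Finset.univ.filter fun w : LineVertex (Fin k) => enc w = a).card ≤
          if a < k + 6 then 1 else 0 := by
        intro a
        split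
        · exact Finset.card_le_one.2 fun u hu v hv => enc_injective (by simp_all)
        · rename_i ha
          rw [Nat.le_zero, Finset.card_eq_zero, Finset.filter_eq_empty_iff]
          rintro w - rfl
          exact ha (enc_lt w)
      refine le_trans ?_ (Nat.add_le_add (h1 a) (h1 b))
      rw [show C = Finset.univ.filter (fun w : LineVertex (Fin k) => enc w = a) ∪
        Finset.univ.filter (fun w : LineVertex (Fin k) => enc w = b) from Finset.filter_or _ _ _]
      exact Finset.card_union_le _ _
    have hle : ((if a < k + 6 then 1 else 0) + if b < k + 6 then 1 else 0) ≤ 2 := by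
      split <;> split <;> simp
    have := h C (hcard.trans hle) fun c hc => hab c ((hC c).1 hc)
    rw [show (· ∈ C) = (fun w : LineVertex (Fin k) => enc w = a ∨ enc w = b) from
      funext fun w => propext (hC w)] at this
    omega

/-- The flag `16 0 3` is only ever cleared here, so over all cuts it computes a conjunction. -/
theorem den_cutC (hD : N.line.IsGood) (h : Repr N dec σ P g) (hc : IsCoding dec) {j : Fin 3}
    {a b : ℕ} (hj : ρ 15 = j) (ha : ρ 16 = a) (hb : ρ 17 = b) :
    (∀ x y, (x ≠ 0 ∨ y ≠ 3) → cutC.den k ρ σ 16 x y = σ 16 x y) ∧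
    (cutC.den k ρ σ 16 0 3 ≠ 0 ↔ σ 16 0 3 ≠ 0 ∧ Passes N P g j a b) := by
  have hcut : (Fm.and (cutF (.var 16)) (cutF (.var 17))).Holds k ρ σ ↔
      ∀ c : LineVertex (Fin k), enc c = a ∨ enc c = b → N.line.Shared c ∧ c ∉ P := by
    rw [Fm.Holds, h.holds_cutF (a := a) (by simpa using ha), h.holds_cutF (a := b) (by simpa using hb)]
    constructor
    · rintro ⟨h1, h2⟩ c (hc | hc)
      exacts [h1 c hc, h2 c hc]
    · exact fun h => ⟨fun c hc => h c (.inl hc), fun c hc => h c (.inr hc)⟩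
  rw [cutC, Cmd.den]
  split
  swap
  · rename_i hn
    rw [hcut] at hn
    exact ⟨fun _ _ _ => rfl, (and_iff_left fun h => (hn h).elim).symm⟩
  rename_i hcab
  rw [hcut] at hcab
  have hcong : ∀ τ : Memory, (∀ b, b ≠ 15 → τ b = σ b) → Repr N dec τ P g := fun τ hτ =>
    h.congr fun a ha => hτ a (by omega)
  obtain ⟨hh, hhlt, hlt⟩ := hD.exists_coheight
  rw [card_lineVertex] at hlt
  obtain ⟨h1, -, h3⟩ := den_closureC (k := k) (W := LineVertex (Fin k)) (num := enc) (a := 15)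
    (r := 0) (row := .const 0) (ρ := ρ) (σ := σ)
    (init := .and (gateF (.var 15) (.var 1))
      (.and (.neg (.eq (.var 1) (.var 16))) (.neg (.eq (.var 1) (.var 17)))))
    (step := .and (.and (.neg (.eq (.var 1) (.var 16))) (.neg (.eq (.var 1) (.var 17))))
      (.and (arcF (.var 1) (.var 3)) (.and (sharedF (.var 3)) (.neg (processedF (.var 3))))))
    enc_injective enc_lt (fun _ hi => exists_enc hi)
    (fun w => N.line.Gate j w ∧ ¬ (enc w = a ∨ enc w = b))
    (fun u v => ¬ (enc u = a ∨ enc u = b) ∧ N.line.arc u v ∧ N.line.Shared v ∧ v ∉ P)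
    (by intros; exact ⟨rfl, rfl, rfl⟩)
    (by
      intro τ hτ u
      rw [Fm.Holds, Fm.Holds, holds_gateF (hcong τ hτ).tables (j := j) (u := u) (by simp [hj])
        (by simp) (by simp)]
      simp [ha, hb, not_or])
    (by
      intro τ hτ u v i
      rw [Fm.Holds, Fm.Holds, Fm.Holds, Fm.Holds, Fm.Holds, Fm.Holds,
        holds_arcF (hcong τ hτ).tables (u := u) (v := v) (by simp) (by simp),
        holds_sharedF (hcong τ hτ).tables (u := v) (by simp), Fm.Holds,
        (hcong τ hτ).holds_processedF (u := v) (by simp)]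
      simp [ha, hb, not_or])
    ⟨hh, fun u v huv => hhlt u v huv.2.1, hlt⟩
  rw [Cmd.den]
  set σ₁ := (closureC _ _ _ _).den k ρ σ
  have h16 : σ₁ 16 = σ 16 := h1 16 (by decide)
  have hind := holds_independentF (ρ := ρ) (hcong σ₁ h1) hc
    (M := N.line.Tail (N.line.Gate j) P fun w => enc w = a ∨ enc w = b) h3
  rw [ha, hb] at hind
  rw [Cmd.den]
  split
  · rename_i hi
    rw [Cmd.den, h16]
    exact ⟨fun _ _ _ => rfl, by simp only [Passes, hind.1 hi, implies_true, and_true]⟩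
  · rename_i hi
    refine ⟨fun x y hxy => ?_, ?_⟩
    · simp only [Cmd.den, Tm.eval, write_apply, h16]
      rw [if_neg (by omega)]
    · simp only [Cmd.den, Tm.eval, write_apply, and_self, if_true, ne_eq, not_true_eq_false,
        false_iff, not_and]
      exact fun _ hp => hi (hind.2 (hp hcab))

theorem den_testC (hD : N.line.IsGood) (h : Repr N dec σ P g) (hc : IsCoding dec) :
    (∀ x y, (x ≠ 0 ∨ y ≠ 3) → testC.den k ρ σ 16 x y = σ 16 x y) ∧
    (testC.den k ρ σ 16 0 3 ≠ 0 ↔ ∀ j, N.line.Open (N.line.Gate j) P g) := by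
  change (∀ x y, (x ≠ 0 ∨ y ≠ 3) → (Cmd.for 15 (.num 3) (.for 16 (.edges 7) (.for 17 (.edges 7)
    cutC))).den k ρ (σ.write 16 0 3 1) 16 x y = σ 16 x y) ∧ ((Cmd.for 15 (.num 3)
    (.for 16 (.edges 7) (.for 17 (.edges 7) cutC))).den k ρ (σ.write 16 0 3 1) 16 0 3 ≠ 0 ↔ _)
  let I (τ : Memory) : Prop := Repr N dec τ P g ∧ ∀ x y, (x ≠ 0 ∨ y ≠ 3) → τ 16 x y = σ 16 x y
  have h0 : I (σ.write 16 0 3 1) := by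
    refine ⟨h.congr fun a ha => write_of_ne _ _ _ (by omega), fun x y hxy => ?_⟩
    rw [write_apply, if_neg (by omega)]
  obtain ⟨h1, h2⟩ := Cmd.den_for_forall (k := k) (x := 15) (b := .num 3)
    (c := .for 16 (.edges 7) (.for 17 (.edges 7) cutC)) (ρ := ρ) I (fun τ => τ 16 0 3 ≠ 0)
    (fun j => ∀ a < k + 7, ∀ b < k + 7, ∀ hj : j < 3, Passes N P g ⟨j, hj⟩ a b) h0 (by
      intro j τ hj hτ
      exact Cmd.den_for_forall I (fun τ => τ 16 0 3 ≠ 0) _ hτ fun a τ ha hτ =>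
        Cmd.den_for_forall I (fun τ => τ 16 0 3 ≠ 0) _ hτ fun b τ hb hτ => by
          obtain ⟨h1, h2⟩ := den_cutC (j := ⟨j, hj⟩) (a := a) (b := b)
            (ρ := Function.update (Function.update (Function.update ρ 15 j) 16 a) 17 b)
            hD hτ.1 hc (by simp) (by simp) (by simp)
          refine ⟨⟨hτ.1.congr fun a ha => Cmd.den_of_notMem_writes k _ _ _ ?_,
            fun x y hxy => (h1 x y hxy).trans (hτ.2 x y hxy)⟩, h2.trans (and_congr_right fun _ => ?_)⟩
          · rcases ha with rfl | rfl | rfl | rfl | rfl | rfl | rfl <;> decide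
          · exact ⟨fun h _ => h, fun h => h hj⟩)
  refine ⟨h1.2, h2.trans ?_⟩
  simp only [write_apply, and_self, if_true, ne_eq, one_ne_zero, not_false_eq_true, true_and,
    num_val, ← forall_passes_iff]
  exact ⟨fun h j a ha b hb => h j j.2 a ha b hb j.2, fun h j hj a ha b hb _ => h ⟨j, hj⟩ a ha b hb⟩

end SumAlgorithm

namespace SumAlgorithm

open LoopLang RAM SumNetwork Relation Module Submodule

variable {n k : ℕ} {N : SumNetwork (Fin n) (Fin k)} {F : Type*} [Field F]
  {dec : ℕ → F} {σ : Memory} {P : Finset (LineVertex (Fin k))}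
  {g : LineVertex (Fin k) → Fin 3 → F} {ρ : Env}

/-! #### Processing the shared vertices -/

theorem holds_predCombF (h : Repr N dec σ P g) (hc : IsCoding dec) {v : LineVertex (Fin k)}
    (hpred : ∀ u, N.line.arc u v → u ∈ P) {x : Fin 3 → ℕ} (hx : ∀ l, x l < 4)
    (hv : ρ 11 = enc v) (h0 : ρ 12 = x 0) (h1 : ρ 13 = x 1) (h2 : ρ 14 = x 2) :
    predCombF.Holds k ρ σ ↔ (fun l => dec (x l)) ∈ span F (g '' {u | N.line.arc u v}) := by
  have : Nonempty (LineVertex (Fin k)) := ⟨N.line.src 0⟩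
  rw [SumDigraph.mem_span_iff_exists_three]
  rw [predCombF, Fm.Holds, vertices_val, exists_lt_iff]
  refine exists_congr fun p => ?_
  rw [Fm.Holds, vertices_val, exists_lt_iff]
  refine exists_congr fun q => ?_
  rw [Fm.Holds, vertices_val, exists_lt_iff]
  refine exists_congr fun r => ?_
  rw [Fm.Holds, num_val, hc.exists_iff]
  refine exists_congr fun a => and_congr_right fun ha => ?_
  rw [Fm.Holds, num_val, hc.exists_iff]
  refine exists_congr fun b => and_congr_right fun hb => ?_
  rw [Fm.Holds, num_val, hc.exists_iff]
  refine exists_congr fun c => and_congr_right fun hc' => ?_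
  rw [hc.eq_zero_iff ha, hc.eq_zero_iff hb, hc.eq_zero_iff hc', forall_fin_three]
  set ρ' := Function.update (Function.update (Function.update (Function.update (Function.update
      (Function.update ρ 20 (enc p)) 21 (enc q)) 22 (enc r)) 23 a) 24 b) 25 c with hρ'
  rw [Fm.Holds, Fm.Holds, Fm.Holds, Fm.holds_or, Fm.holds_or, Fm.holds_or,
    holds_arcF h.tables (u := p) (v := v) (by simp [hρ']) (by simp [hρ', hv]),
    holds_arcF h.tables (u := q) (v := v) (by simp [hρ']) (by simp [hρ', hv]),
    holds_arcF h.tables (u := r) (v := v) (by simp [hρ']) (by simp [hρ', hv])]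
  rw [show (Fm.eq (.var 23) (.const 0)).Holds k ρ' σ ↔ a = 0 by simp [hρ'],
    show (Fm.eq (.var 24) (.const 0)).Holds k ρ' σ ↔ b = 0 by simp [hρ'],
    show (Fm.eq (.var 25) (.const 0)).Holds k ρ' σ ↔ c = 0 by simp [hρ']]
  refine and_congr_right fun hp => and_congr_right fun hq => and_congr_right fun hr => ?_
  have key : ∀ l : Fin 3, _ := fun l => h.comb_eq_iff hc (l := l) (m := x l) (p := .var 20)
    (q := .var 21) (r := .var 22) (a := .var 23) (b := .var 24) (c := .var 25) (ρ := ρ')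
    (by simp [hρ']) (by simp [hρ']) (by simp [hρ']) (by simp [hρ']) (by simp [hρ']) (by simp [hρ'])
    ha hb hc' (hp.imp_right (hpred _)) (hq.imp_right (hpred _)) (hr.imp_right (hpred _)) (hx l)
  rw [Fm.Holds, Fm.Holds, Fm.holds_eq, Fm.holds_eq, Fm.holds_eq, ← key, ← key, ← key]
  simp [hρ', h0, h1, h2]

theorem Repr.extend (h : Repr N dec σ P g) {v : LineVertex (Fin k)} (hv : ∀ j, v ≠ N.line.term j)
    {x : Fin 3 → ℕ} (hx : ∀ l, x l < 4) :
    Repr N dec ((((σ.write 13 (enc v) 0 (x 0)).write 13 (enc v) 1 (x 1)).write 13 (enc v) 2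
      (x 2)).write 14 0 (enc v) 1) (insert v P) (Function.update g v fun l => dec (x l)) := by
  set τ := (((σ.write 13 (enc v) 0 (x 0)).write 13 (enc v) 1 (x 1)).write 13 (enc v) 2
      (x 2)).write 14 0 (enc v) 1 with hτ
  have hne : ∀ a, a ≠ 13 → a ≠ 14 → τ a = σ a := by
    intro a h1 h2
    rw [hτ, write_of_ne _ _ _ h2, write_of_ne _ _ _ h1, write_of_ne _ _ _ h1, write_of_ne _ _ _ h1]
  have h13 : ∀ w, w ≠ v → ∀ l, τ 13 (enc w) l = σ 13 (enc w) l := by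
    intro w hw l
    simp [hτ, write_apply, enc_injective.ne hw]
  have h13' : ∀ l : Fin 3, τ 13 (enc v) l = x l := by
    rw [forall_fin_three]
    simp [hτ, write_apply]
  refine ⟨h.tables.congr fun a ha => hne a (by omega) (by omega), fun w => ?_, fun w l hl => ?_,
    fun w hw l => ?_, fun j l hl => ?_⟩
  · rw [Finset.mem_insert, ← h.processed]
    by_cases hw : w = v <;> simp [hτ, write_apply, enc_injective.eq_iff, hw]
  · rcases eq_or_ne w v with rfl | hw
    · exact (h13' ⟨l, hl⟩).trans_lt (hx _)
    · exact (h13 w hw l).trans_lt (h.lt w l hl)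
  · rcases eq_or_ne w v with rfl | hwv
    · rw [h13', Function.update_self]
    · rw [h13 w hwv, Function.update_of_ne hwv,
        h.vec w ((Finset.mem_insert.1 hw).resolve_left hwv)]
  · rw [h13 _ (hv j).symm, h.term j l hl]

theorem Repr.of_insert {v : LineVertex (Fin k)} {x : Fin 3 → F}
    (h : Repr N dec σ (insert v P) (Function.update g v x)) (hv : v ∉ P) :
    Repr N dec (σ.write 14 0 (enc v) 0) P g := by
  have hne : ∀ a, a ≠ 14 → σ.write 14 0 (enc v) 0 a = σ a := fun a ha => write_of_ne _ _ _ ha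
  refine ⟨h.tables.congr fun a ha => hne a (by omega), fun w => ?_, ?_, fun w hw l => ?_, ?_⟩
  · rcases eq_or_ne w v with rfl | hw
    · simp [write_apply, hv]
    · have := h.processed w
      rw [Finset.mem_insert, or_iff_right hw] at this
      simpa [write_apply, enc_injective.ne hw] using this
  · rw [hne 13 (by decide)]; exact h.lt
  · rw [hne 13 (by decide), h.vec w (Finset.mem_insert_of_mem hw), Function.update_of_ne]
    rintro rfl
    exact hv hw
  · rw [hne 13 (by decide)]; exact h.term

/-- The exact test decides between committing to the extended multicast and restoring the old one;
the old one is again represented once the mark of `v` is removed. -/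
theorem den_tryC (hD : N.line.IsGood) (h : Repr N dec σ P g) (hc : IsCoding dec)
    {v : LineVertex (Fin k)} (hv : N.line.Shared v) (hvP : v ∉ P)
    {x : Fin 3 → ℕ} (hx : ∀ l, x l < 4)
    (hv' : ρ 11 = enc v) (h0 : ρ 12 = x 0) (h1 : ρ 13 = x 1) (h2 : ρ 14 = x 2) :
    ((∀ j, N.line.Open (N.line.Gate j) (insert v P) (Function.update g v fun l => dec (x l))) →
      tryC.den k ρ σ 16 0 0 = 1 ∧
      Repr N dec (tryC.den k ρ σ) (insert v P) (Function.update g v fun l => dec (x l))) ∧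
    ((¬ ∀ j, N.line.Open (N.line.Gate j) (insert v P) (Function.update g v fun l => dec (x l))) →
      tryC.den k ρ σ 16 0 0 = σ 16 0 0 ∧ Repr N dec (tryC.den k ρ σ) P g) := by
  have hvt : ∀ j, v ≠ N.line.term j := by
    rintro j rfl
    exact hD.not_shared_term j hv
  have hR := h.extend hvt hx
  set σ₁ := (((σ.write 13 (enc v) 0 (x 0)).write 13 (enc v) 1 (x 1)).write 13 (enc v) 2
      (x 2)).write 14 0 (enc v) 1 with hσ₁
  have h16 : σ₁ 16 = σ 16 := by simp only [hσ₁, write_of_ne _ _ _ (show (16 : ℕ) ≠ 13 by decide),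
    write_of_ne _ _ _ (show (16 : ℕ) ≠ 14 by decide)]
  obtain ⟨ht, hiff⟩ := den_testC (ρ := ρ) hD hR hc
  have hR₂ : Repr N dec (testC.den k ρ σ₁) (insert v P) (Function.update g v fun l => dec (x l)) :=
    hR.congr fun a ha => Cmd.den_of_notMem_writes k _ _ _ (by
      rcases ha with rfl | rfl | rfl | rfl | rfl | rfl | rfl <;> decide)
  have hrun : tryC.den k ρ σ = (Cmd.ite (.nz (.cell 16 (.const 0) (.const 3)))
      (.set 16 (.const 0) (.const 0) (.const 1))
      (.set 14 (.const 0) (.var 11) (.const 0))).den k ρ (testC.den k ρ σ₁) := by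
    simp only [hσ₁, ← hv', ← h0, ← h1, ← h2]
    rfl
  rw [← hiff, hrun, Cmd.den]
  refine ⟨fun ho => ?_, fun ho => ?_⟩
  · rw [if_pos (by exact ho)]
    exact ⟨by simp [Cmd.den, write_apply], hR₂.congr fun a ha => write_of_ne _ _ _ (by omega)⟩
  · rw [if_neg (by exact ho)]
    simp only [Cmd.den, Tm.eval, hv']
    refine ⟨?_, hR₂.of_insert hvP⟩
    rw [write_of_ne _ _ _ (by decide), ht 0 0 (by simp), h16]

theorem den_stepC (hD : N.line.IsGood) (h : Repr N dec σ P g) (hp : N.line.Partial P g)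
    (hc : IsCoding dec) {v : LineVertex (Fin k)} (hv : N.line.Shared v) (hvP : v ∉ P)
    (hpred : ∀ u, N.line.arc u v → u ∈ P) (hv' : ρ 11 = enc v) :
    ∃ g', N.line.Partial (insert v P) g' ∧ Repr N dec (stepC.den k ρ σ) (insert v P) g' := by
  have := hc.finite
  -- `D` says that `v` has been processed and the flag is set, `I` that either this holds or the old
  -- multicast is still represented with the flag clear.
  let D (τ : Memory) : Prop := τ 16 0 0 ≠ 0 ∧
    ∃ g', N.line.Partial (insert v P) g' ∧ Repr N dec τ (insert v P) g'
  let I (τ : Memory) : Prop := D τ ∨ (τ 16 0 0 = 0 ∧ Repr N dec τ P g)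
  let c : Cmd :=
    .ite (.and (.eq (.cell 16 (.const 0) (.const 0)) (.const 0)) predCombF) tryC .skip
  have hrun : ∀ (τ : Memory) (x : Fin 3 → ℕ), (∀ l, x l < 4) → I τ →
      let τ' := c.den k (Function.update (Function.update (Function.update ρ 12 (x 0)) 13 (x 1)) 14
        (x 2)) τ
      I τ' ∧ (D τ → D τ') ∧ (((fun l => dec (x l)) ∈ span F (g '' {u | N.line.arc u v}) ∧
        ∀ j, N.line.Open (N.line.Gate j) (insert v P) (Function.update g v fun l => dec (x l))) →
          D τ') := by
    intro τ x hx hI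
    set ρ' := Function.update (Function.update (Function.update ρ 12 (x 0)) 13 (x 1)) 14 (x 2)
      with hρ'
    simp only [c, Cmd.den]
    rcases hI with hDτ | ⟨hz, hR⟩
    · rw [if_neg (by rintro ⟨h1, -⟩; exact hDτ.1 (Fm.holds_eq.1 h1))]
      exact ⟨.inl hDτ, fun h => h, fun _ => hDτ⟩
    · have hcomb := holds_predCombF (ρ := ρ') hR hc hpred hx (by simp [hρ', hv']) (by simp [hρ'])
        (by simp [hρ']) (by simp [hρ'])
      obtain ⟨ht1, ht2⟩ := den_tryC (ρ := ρ') hD hR hc hv hvP hx (by simp [hρ', hv'])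
        (by simp [hρ']) (by simp [hρ']) (by simp [hρ'])
      split
      · rename_i hh
        have hmem := hcomb.1 hh.2
        by_cases ho : ∀ j, N.line.Open (N.line.Gate j) (insert v P)
            (Function.update g v fun l => dec (x l))
        · obtain ⟨t1, t2⟩ := ht1 ho
          have hd : D (tryC.den k ρ' τ) :=
            ⟨by rw [t1]; decide, _, hp.insert hv hvP hpred hmem ho, t2⟩
          exact ⟨.inl hd, fun _ => hd, fun _ => hd⟩
        · obtain ⟨t1, t2⟩ := ht2 ho
          exact ⟨.inr ⟨t1.trans hz, t2⟩, fun h => (h.1 hz).elim, fun h => (ho h.2).elim⟩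
      · rename_i hh
        refine ⟨.inr ⟨hz, hR⟩, fun h => h, fun hx => (hh ⟨Fm.holds_eq.2 hz, hcomb.2 hx.1⟩).elim⟩
  -- The existence result for the next step guarantees that the search succeeds at the latest when
  -- it meets this vector.
  obtain ⟨y, hy, hyo⟩ := SumDigraph.Open.exists_step hc.card_eq.ge hp.isOpen hv hvP hpred
  choose x hx hxy using fun l => hc.surj (y l)
  obtain rfl : (fun l => dec (x l)) = y := funext hxy
  have hlt : ∀ {a b c : ℕ}, a < 4 → b < 4 → c < 4 → ∀ l, ![a, b, c] l < 4 := by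
    intro a b c ha hb hc
    rw [forall_fin_three]
    exact ⟨ha, hb, hc⟩
  suffices D (stepC.den k ρ σ) from this.2
  refine Cmd.den_for_search (k := k) (x := 12) (b := .num 4) I D ?_ ?_ ?_ (hx 0) ?_
  · exact .inr ⟨rfl, h.congr fun a ha => write_of_ne _ _ _ (by omega)⟩
  · intro a τ ha hτ
    exact Cmd.den_for_keeps I hτ fun b τ hb hτ => Cmd.den_for_keeps I hτ fun c τ hc hτ =>
      (hrun τ ![a, b, c] (hlt ha hb hc) hτ).1
  · intro a τ ha _ hτ
    exact Cmd.den_for_keeps D hτ fun b τ hb hτ => Cmd.den_for_keeps D hτ fun c τ hc hτ =>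
      (hrun τ ![a, b, c] (hlt ha hb hc) (.inl hτ)).2.1 hτ
  intro τ hτ
  refine Cmd.den_for_search (k := k) (x := 13) (b := .num 4) I D hτ ?_ ?_ (hx 1) ?_
  · intro b τ hb hτ
    exact Cmd.den_for_keeps I hτ fun c τ hc hτ => (hrun τ ![x 0, b, c] (hlt (hx 0) hb hc) hτ).1
  · intro b τ hb _ hτ
    exact Cmd.den_for_keeps D hτ fun c τ hc hτ =>
      (hrun τ ![x 0, b, c] (hlt (hx 0) hb hc) (.inl hτ)).2.1 hτ
  intro τ hτ
  refine Cmd.den_for_search (k := k) (x := 14) (b := .num 4) I D hτ ?_ ?_ (hx 2) ?_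
  · exact fun c τ hc hτ => (hrun τ ![x 0, x 1, c] (hlt (hx 0) (hx 1) hc) hτ).1
  · exact fun c τ hc _ hτ => (hrun τ ![x 0, x 1, c] (hlt (hx 0) (hx 1) hc) (.inl hτ)).2.1 hτ
  · exact fun τ hτ => (hrun τ x hx hτ).2.2 ⟨hy, hyo⟩

theorem Repr.holds_readyF (h : Repr N dec σ P g) {v : LineVertex (Fin k)} (hv : ρ 11 = enc v) :
    readyF.Holds k ρ σ ↔ N.line.Shared v ∧ v ∉ P ∧ ∀ u, N.line.arc u v → u ∈ P := by
  have hex : ∀ u : LineVertex (Fin k), (Fm.and (arcF (.var 20) (.var 11))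
      (.neg (processedF (.var 20)))).Holds k (Function.update ρ 20 (enc u)) σ ↔
      N.line.arc u v ∧ u ∉ P := by
    intro u
    rw [Fm.Holds, Fm.Holds, holds_arcF h.tables (u := u) (v := v) (by simp) (by simp [hv]),
      h.holds_processedF (u := u) (by simp)]
  rw [readyF, Fm.Holds, Fm.Holds, Fm.Holds, Fm.Holds, Fm.Holds, vertices_val, exists_lt_iff,
    holds_sharedF h.tables (u := v) (by simpa using hv),
    h.holds_processedF (u := v) (by simpa using hv)]
  simp only [hex]
  push Not
  rfl

/-- Round `r` ensures that all shared vertices of height at most `r` are processed: when such a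
vertex is visited, its predecessors have smaller height and were processed in earlier rounds. -/
theorem den_processC (hD : N.line.IsGood) (h : Repr N dec σ P g) (hp : N.line.Partial P g)
    (hc : IsCoding dec) :
    ∃ P' g', N.line.Partial P' g' ∧ Repr N dec (processC.den k ρ σ) P' g' ∧
      ∀ v, N.line.Shared v → v ∈ P' := by
  obtain ⟨t, ht, htlt⟩ := hD.exists_height
  rw [card_lineVertex] at htlt
  obtain ⟨P', g', h1, h2, h3⟩ := Cmd.den_for_induction (k := k) (x := 10) (b := vertices)
    (c := .for 11 vertices (.ite readyF stepC .skip)) (ρ := ρ) (σ := σ)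
    (fun r τ => ∃ P g, N.line.Partial P g ∧ Repr N dec τ P g ∧
      ∀ v, N.line.Shared v → t v < r → v ∈ P) ⟨P, g, hp, h, by simp⟩ (by
      rintro r τ hr ⟨P, g, hp, h, hr'⟩
      obtain ⟨P', g', h1, h2, -, h3⟩ := Cmd.den_for_induction (k := k) (x := 11) (b := vertices)
        (c := .ite readyF stepC .skip) (ρ := Function.update ρ 10 r) (σ := τ)
        (fun m τ => ∃ P g, N.line.Partial P g ∧ Repr N dec τ P g ∧
          (∀ v, N.line.Shared v → t v < r → v ∈ P) ∧
          ∀ v, N.line.Shared v → enc v < m → t v < r + 1 → v ∈ P)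
        ⟨P, g, hp, h, hr', by simp⟩ (by
          rintro m τ hm ⟨P, g, hp, h, h1, h2⟩
          obtain ⟨v, rfl⟩ := exists_enc hm
          have hiff := h.holds_readyF (v := v)
            (ρ := Function.update (Function.update ρ 10 r) 11 (enc v)) (by simp)
          rw [Cmd.den]
          split
          · rename_i hh
            obtain ⟨hv, hvP, hpred⟩ := hiff.1 hh
            obtain ⟨g', hp', h'⟩ := den_stepC
              (ρ := Function.update (Function.update ρ 10 r) 11 (enc v)) hD h hp hc hv hvP hpred
              (by simp)
            refine ⟨_, g', hp', h', fun w hw hwr => Finset.mem_insert_of_mem (h1 w hw hwr),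
              fun w hw hwv hwr => ?_⟩
            rcases eq_or_ne w v with rfl | hne
            · exact Finset.mem_insert_self _ _
            · have := enc_injective.ne hne
              exact Finset.mem_insert_of_mem (h2 w hw (by omega) hwr)
          · rename_i hh
            refine ⟨P, g, hp, h, h1, fun w hw hwv hwr => ?_⟩
            rcases eq_or_ne w v with rfl | hne
            · by_contra hwP
              exact hh (hiff.2 ⟨hw, hwP, fun u hu => h1 u (hw.of_arc hu)
                (by have := ht u w hu; omega)⟩)
            · have := enc_injective.ne hne
              exact h2 w hw (by omega) hwr)
      exact ⟨P', g', h1, h2, fun v hv hvr => h3 v hv (enc_lt v) hvr⟩)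
  exact ⟨P', g', h1, h2, fun v hv => h3 v hv (htlt v)⟩

theorem den_initC (hT : HasTables N σ) (hc : IsCoding dec) (h13 : ∀ i j, σ 13 i j = 0)
    (h14 : ∀ i j, σ 14 i j = 0) :
    ∃ g, Repr N dec (initC.den k ρ σ) (Finset.univ.image N.line.src) g ∧
      ∀ i l, g (N.line.src i) l = if i = l then 1 else 0 := by
  have := Cmd.den_for_induction (k := k) (x := 0) (b := .num 3) (c := .seqs [
    .set 13 (srcT (.var 0)) (.var 0) (.const 1),
    .set 14 (.const 0) (srcT (.var 0)) (.const 1),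
    .set 13 (termT (.var 0)) (.const 0) (.const 1),
    .set 13 (termT (.var 0)) (.const 1) (.const 1),
    .set 13 (termT (.var 0)) (.const 2) (.const 1)]) (ρ := ρ) (σ := σ)
    (fun m τ => HasTables N τ ∧ (∀ i j, τ 13 i j ≤ 1) ∧
      (∀ i l : Fin 3, τ 13 (enc (N.line.src i)) l = if (i : ℕ) < m ∧ i = l then 1 else 0) ∧
      (∀ j : Fin 3, (j : ℕ) < m → ∀ l < 3, τ 13 (enc (N.line.term j)) l = 1) ∧
      ∀ w, τ 14 0 (enc w) ≠ 0 ↔ ∃ i : Fin 3, (i : ℕ) < m ∧ w = N.line.src i)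
    ⟨hT, by simp [h13], by simp [h13], by simp, by simp [h14]⟩ (by
      rintro m τ hm ⟨hT, hle, hs, ht, hw⟩
      obtain ⟨i, rfl⟩ : ∃ i : Fin 3, (i : ℕ) = m := ⟨⟨m, hm⟩, rfl⟩
      have hk := hT.size
      simp only [Cmd.seqs, Cmd.den, Tm.eval, Function.update_self, srcT, termT, numEdges]
      simp only [write_apply, show (0 : ℕ) ≠ 13 by decide, show (0 : ℕ) ≠ 14 by decide, false_and,
        if_false, hk, ← enc_src (N := N), ← enc_term (N := N), enc_injective.eq_iff]
      refine ⟨hT.congr fun a ha => ?_, fun x y => ?_, fun i' l => ?_, fun j hj l hl => ?_,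
        fun w => ?_⟩
      · simp only [write_of_ne _ _ _ (show a ≠ 13 by omega),
          write_of_ne _ _ _ (show a ≠ 14 by omega)]
      · simp only [true_and, show (13 : ℕ) ≠ 14 by decide, false_and, if_false]
        repeat' split
        all_goals first | exact le_rfl | exact hle x y
      · have hst : ∀ j, N.line.src i' ≠ N.line.term j := fun j => by simp [SumNetwork.line]
        have hss : N.line.src i' = N.line.src i ↔ i' = i := by simp [SumNetwork.line]
        simp only [hst, hss, true_and, false_and, and_false, if_false, hs,
          show (13 : ℕ) ≠ 14 by decide]
        rcases eq_or_ne i' i with rfl | hne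
        · simp [Fin.ext_iff, eq_comm]
        · have : (i' : ℕ) ≠ i := fun h => hne (Fin.ext h)
          simp only [hne, false_and, if_false]
          refine if_congr (and_congr_left' ?_) rfl rfl
          omega
      · have hts : N.line.term j ≠ N.line.src i := by simp [SumNetwork.line]
        have htt : N.line.term j = N.line.term i ↔ j = i := by simp [SumNetwork.line]
        simp only [htt, hts, true_and, false_and, and_false, if_false,
          show (13 : ℕ) ≠ 14 by decide]
        rcases eq_or_ne j i with rfl | hne
        · have : l = 2 ∨ l = 1 ∨ l = 0 := by omega
          rcases this with rfl | rfl | rfl <;> simp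
        · have : (j : ℕ) ≠ i := fun h => hne (Fin.ext h)
          simp only [hne, false_and, if_false]
          exact ht j (by omega) l hl
      · simp only [show (14 : ℕ) ≠ 13 by decide, false_and, if_false, true_and]
        split
        · rename_i h
          simp only [ne_eq, one_ne_zero, not_false_eq_true, true_iff]
          exact ⟨i, by omega, h⟩
        · rename_i h
          rw [hw]
          constructor
          · rintro ⟨i', hi', rfl⟩
            exact ⟨i', by omega, rfl⟩
          · rintro ⟨i', hi', rfl⟩
            refine ⟨i', ?_, rfl⟩
            have : (i' : ℕ) ≠ i := fun h' => h (by rw [Fin.ext h'])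
            omega)
  obtain ⟨hT', hle, hs, ht, hw⟩ := this
  -- The abstract vectors are simply read off the memory; only their values at the sources matter.
  refine ⟨fun w l => dec (initC.den k ρ σ 13 (enc w) l), ⟨hT', fun w => ?_,
    fun w l _ => (hle _ _).trans_lt (by decide), fun w _ l => rfl, fun j l hl => ht j j.2 l hl⟩,
    fun i l => ?_⟩
  · refine (hw w).trans ?_
    simp [eq_comm]
  · refine (congrArg dec (hs i l)).trans ?_
    by_cases h : i = l
    · simp [h, hc.one]
    · simp [h, hc.zero]

end SumAlgorithm

namespace LoopLang

open RAM

/-- A loop that searches: it keeps success and succeeds if some pass does. -/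
theorem Cmd.den_for_find {k x : ℕ} {b : Range} {c : Cmd} {ρ : Env} {σ : Memory}
    (I D : Memory → Prop) (Q : ℕ → Prop) (h0 : I σ)
    (hs : ∀ i τ, i < b.val k → I τ → I (c.den k (Function.update ρ x i) τ) ∧
      (D τ ∨ Q i → D (c.den k (Function.update ρ x i) τ))) :
    I ((Cmd.for x b c).den k ρ σ) ∧
      (D σ ∨ (∃ i < b.val k, Q i) → D ((Cmd.for x b c).den k ρ σ)) := by
  refine Cmd.den_for_induction (fun m τ => I τ ∧ (D σ ∨ (∃ i < m, Q i) → D τ)) ⟨h0, by simp⟩ ?_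
  rintro m τ hm ⟨hI, hD⟩
  obtain ⟨h1, h2⟩ := hs m τ hm hI
  refine ⟨h1, ?_⟩
  rintro (h | ⟨i, hi, hQ⟩)
  · exact h2 (.inl (hD (.inl h)))
  · rcases eq_or_ne i m with rfl | hne
    · exact h2 (.inr hQ)
    · exact h2 (.inl (hD (.inr ⟨i, by omega, hQ⟩)))

end LoopLang

namespace SumAlgorithm

open LoopLang RAM SumNetwork Relation Module Submodule

variable {n k : ℕ} {N : SumNetwork (Fin n) (Fin k)} {F : Type*} [Field F]
  {dec : ℕ → F} {σ : Memory} {P : Finset (LineVertex (Fin k))}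
  {g : LineVertex (Fin k) → Fin 3 → F} {ρ : Env}

/-! #### Writing vectors as combinations of three other ones -/

/-- The sequence `x` describes a combination of three vectors of vertices in `S` that equals `y`:
first the numbers of the vertices, then the codes of the coefficients. -/
def IsCombination (dec : ℕ → F) (g : LineVertex (Fin k) → Fin 3 → F)
    (S : LineVertex (Fin k) → Prop) (y : Fin 3 → F) (x : ℕ → ℕ) : Prop :=
  ∃ p q r, x 0 = enc p ∧ x 1 = enc q ∧ x 2 = enc r ∧ x 3 < 4 ∧ x 4 < 4 ∧ x 5 < 4 ∧
    (x 3 = 0 ∨ S p) ∧ (x 4 = 0 ∨ S q) ∧ (x 5 = 0 ∨ S r) ∧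
    ∀ l, dec (x 3) * g p l + dec (x 4) * g q l + dec (x 5) * g r l = y l

theorem IsCombination.congr {S : LineVertex (Fin k) → Prop} {y : Fin 3 → F} {x x' : ℕ → ℕ}
    (h : IsCombination dec g S y x) (hx : ∀ l < 6, x' l = x l) : IsCombination dec g S y x' := by
  rw [IsCombination, hx 0 (by decide), hx 1 (by decide), hx 2 (by decide), hx 3 (by decide),
    hx 4 (by decide), hx 5 (by decide)]
  exact h

/-- `u` is a predecessor of the shared vertex `v` or a gate of the terminal `v`. -/
def Contributes (N : SumNetwork (Fin n) (Fin k)) (u v : LineVertex (Fin k)) : Prop :=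
  (N.line.Shared v ∧ N.line.arc u v) ∨ ∃ j, v = N.line.term j ∧ N.line.Gate j u

theorem holds_contributesF (hT : HasTables N σ) {s t : Tm} {u v : LineVertex (Fin k)}
    (hs : s.eval ρ σ = enc u) (hs' : ∀ i, s.eval (Function.update ρ 20 i) σ = enc u)
    (ht : t.eval ρ σ = enc v) : (contributesF s t).Holds k ρ σ ↔ Contributes N u v := by
  have h : ∀ j : Fin 3, (Fm.and (.eq t (termT (.const j))) (gateF (.const j) s)).Holds k ρ σ ↔
      v = N.line.term j ∧ N.line.Gate j u := by
    intro j
    rw [Fm.Holds, Fm.holds_eq, ht, eval_termT hT.toHasArcs j rfl, enc_injective.eq_iff,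
      holds_gateF hT (j := j) (fun _ => rfl) hs' hs]
  have h0 := h 0
  have h1 := h 1
  have h2 := h 2
  simp only [Fin.val_zero, Fin.val_one, Fin.val_two] at h0 h1 h2
  simp only [contributesF, Fm.holds_or, h0, h1, h2]
  rw [Fm.Holds, holds_sharedF hT ht, holds_arcF hT hs ht]
  simp [Contributes, Fin.exists_fin_succ]

theorem holds_solveF (h : Repr N dec σ P g) (hc : IsCoding dec) (hP : ∀ v, N.line.Shared v → v ∈ P)
    {v p q r : LineVertex (Fin k)} (hv : ρ 11 = enc v) (hp : ρ 0 = enc p) (hq : ρ 1 = enc q)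
    (hr : ρ 2 = enc r) (ha : ρ 3 < 4) (hb : ρ 4 < 4) (hc' : ρ 5 < 4) :
    solveF.Holds k ρ σ ↔ IsCombination dec g (Contributes N · v)
      (fun l => dec (σ 13 (enc v) l)) ρ := by
  have hmem : ∀ u, Contributes N u v → u ∈ P := by
    rintro u (⟨h1, h2⟩ | ⟨j, -, h2⟩)
    · exact hP u (h1.of_arc h2)
    · exact hP u h2.1
  have hcon : ∀ {m : ℕ} {u : LineVertex (Fin k)}, ρ m = enc u → m ≠ 20 →
      ((contributesF (.var m) (.var 11)).Holds k ρ σ ↔ Contributes N u v) := by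
    intro m u hm hne
    exact holds_contributesF h.tables hm
      (fun i => by simp [Function.update_of_ne hne, hm]) hv
  have hz : ∀ m, (Fm.eq (.var m) (.const 0)).Holds k ρ σ ↔ ρ m = 0 := by simp
  have key : (ρ 3 = 0 ∨ Contributes N p v) → (ρ 4 = 0 ∨ Contributes N q v) →
      (ρ 5 = 0 ∨ Contributes N r v) → ∀ l : Fin 3, _ := fun h3 h4 h5 l =>
    h.comb_eq_iff hc (l := l) (m := σ 13 (enc v) l) (p := .var 0)
    (q := .var 1) (r := .var 2) (a := .var 3) (b := .var 4) (c := .var 5) (ρ := ρ)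
    hp hq hr rfl rfl rfl ha hb hc' (h3.imp_right (hmem _)) (h4.imp_right (hmem _))
    (h5.imp_right (hmem _)) (h.lt v l l.2)
  rw [solveF, Fm.Holds, Fm.Holds, Fm.Holds, Fm.Holds, Fm.Holds, Fm.holds_or, Fm.holds_or,
    Fm.holds_or, hz, hz, hz, hcon hp (by decide), hcon hq (by decide), hcon hr (by decide),
    Fm.holds_eq, Fm.holds_eq, Fm.holds_eq]
  simp only [Tm.eval, hv]
  constructor
  · rintro ⟨h3, h4, h5, h6⟩
    refine ⟨p, q, r, hp, hq, hr, ha, hb, hc', h3, h4, h5, ?_⟩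
    have key := key h3 h4 h5
    rw [forall_fin_three]
    exact ⟨(key 0).1 h6.1, (key 1).1 h6.2.1, (key 2).1 h6.2.2⟩
  · rintro ⟨p', q', r', hp', hq', hr', -, -, -, h3, h4, h5, h6⟩
    obtain rfl := enc_injective (hp.symm.trans hp')
    obtain rfl := enc_injective (hq.symm.trans hq')
    obtain rfl := enc_injective (hr.symm.trans hr')
    have key := key h3 h4 h5
    exact ⟨h3, h4, h5, (key 0).2 (h6 0), (key 1).2 (h6 1), (key 2).2 (h6 2)⟩

/-- Every vector in the span has a description by three contributing vertices, which the search
meets. Later hits may overwrite an earlier description, but only by another valid one. -/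
theorem den_solveC (h : Repr N dec σ P g) (hc : IsCoding dec)
    (hP : ∀ v, N.line.Shared v → v ∈ P) (v : LineVertex (Fin k))
    (hv : (fun l : Fin 3 => dec (σ 13 (enc v) l)) ∈ span F (g '' {u | Contributes N u v})) :
    IsCombination dec g (Contributes N · v) (fun l => dec (σ 13 (enc v) l))
      (solveC.den k ρ σ 17 (enc v)) := by
  have hR : ∀ τ : Memory, (∀ b, b ≠ 17 → τ b = σ b) → Repr N dec τ P g := fun τ hτ =>
    h.congr fun a ha => hτ a (by omega)
  let c : Cmd := .ite solveF (.seqs [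
    .set 17 (.var 11) (.const 0) (.var 0),
    .set 17 (.var 11) (.const 1) (.var 1),
    .set 17 (.var 11) (.const 2) (.var 2),
    .set 17 (.var 11) (.const 3) (.var 3),
    .set 17 (.var 11) (.const 4) (.var 4),
    .set 17 (.var 11) (.const 5) (.var 5)]) .skip
  have hrun : ∀ (ρ : Env) (τ : Memory) {w : LineVertex (Fin k)}, ρ 11 = enc w → ρ 0 < k + 6 →
      ρ 1 < k + 6 → ρ 2 < k + 6 → ρ 3 < 4 → ρ 4 < 4 → ρ 5 < 4 → (∀ b, b ≠ 17 → τ b = σ b) →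
      (∀ i, i ≠ enc w → c.den k ρ τ 17 i = τ 17 i) ∧
      (IsCombination dec g (Contributes N · w) (fun l => dec (σ 13 (enc w) l)) (τ 17 (enc w)) ∨
        IsCombination dec g (Contributes N · w) (fun l => dec (σ 13 (enc w) l)) ρ →
      IsCombination dec g (Contributes N · w) (fun l => dec (σ 13 (enc w) l))
        (c.den k ρ τ 17 (enc w))) := by
    intro ρ τ w hw h0 h1 h2 h3 h4 h5 hτ
    obtain ⟨p, hp⟩ := exists_enc h0
    obtain ⟨q, hq⟩ := exists_enc h1
    obtain ⟨r, hr⟩ := exists_enc h2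
    have hiff := holds_solveF (hR τ hτ) hc hP hw hp.symm hq.symm hr.symm h3 h4 h5
    rw [hτ 13 (by decide)] at hiff
    simp only [c]
    rw [Cmd.den]
    split
    · rename_i hh
      constructor
      · intro i hi
        funext l
        simp [Cmd.seqs, Cmd.den, write_apply, hw, hi]
      · refine fun _ => (hiff.1 hh).congr fun l hl => ?_
        simp only [Cmd.seqs, Cmd.den, Tm.eval, write_apply, hw, true_and]
        interval_cases l <;> simp
    · rename_i hh
      exact ⟨fun _ _ => rfl, fun h => h.resolve_right (mt hiff.2 hh)⟩
  have hkeep : ∀ (ρ : Env) (τ : Memory), (∀ b, b ≠ 17 → τ b = σ b) →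
      ∀ b, b ≠ 17 → c.den k ρ τ b = σ b := fun ρ τ hτ b hb =>
    (Cmd.den_of_notMem_writes k _ _ _ (by simpa [c, Cmd.writes, Cmd.seqs] using hb)).trans (hτ b hb)
  have hsearch : ∀ (τ : Memory) (w : LineVertex (Fin k)), (∀ b, b ≠ 17 → τ b = σ b) →
      ∀ τ', τ' = (Cmd.for 0 vertices (.for 1 vertices (.for 2 vertices (.for 3 (.num 4)
        (.for 4 (.num 4) (.for 5 (.num 4) c)))))).den k (Function.update ρ 11 (enc w)) τ →
      ((∀ b, b ≠ 17 → τ' b = σ b) ∧ ∀ i, i ≠ enc w → τ' 17 i = τ 17 i) ∧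
      ((fun l : Fin 3 => dec (σ 13 (enc w) l)) ∈ span F (g '' {u | Contributes N u w}) →
        IsCombination dec g (Contributes N · w) (fun l => dec (σ 13 (enc w) l)) (τ' 17 (enc w))) := by
    rintro τ w hτ _ rfl
    let I (τ' : Memory) : Prop := (∀ b, b ≠ 17 → τ' b = σ b) ∧ ∀ i, i ≠ enc w → τ' 17 i = τ 17 i
    let D (τ' : Memory) : Prop :=
      IsCombination dec g (Contributes N · w) (fun l => dec (σ 13 (enc w) l)) (τ' 17 (enc w))
    obtain ⟨h1, h2⟩ := Cmd.den_for_find (k := k) (x := 0) (b := vertices)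
      (ρ := Function.update ρ 11 (enc w)) (σ := τ) I D _ ⟨hτ, fun _ _ => rfl⟩
      fun a τ₁ ha hI₁ => Cmd.den_for_find (b := vertices) I D _ hI₁ fun b τ₂ hb hI₂ =>
      Cmd.den_for_find (b := vertices) I D _ hI₂ fun c' τ₃ hc' hI₃ =>
      Cmd.den_for_find (b := .num 4) I D _ hI₃ fun x τ₄ hx hI₄ =>
      Cmd.den_for_find (b := .num 4) I D _ hI₄ fun y τ₅ hy hI₅ =>
      Cmd.den_for_find (b := .num 4) (c := c) I D (fun z => IsCombination dec g (Contributes N · w)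
        (fun l => dec (σ 13 (enc w) l)) (Function.update (Function.update (Function.update
          (Function.update (Function.update (Function.update (Function.update ρ 11 (enc w)) 0 a) 1 b)
          2 c') 3 x) 4 y) 5 z)) hI₅ fun z τ₆ hz hI₆ => by
            obtain ⟨h1, h2⟩ := hrun (Function.update (Function.update (Function.update
              (Function.update (Function.update (Function.update (Function.update ρ 11 (enc w)) 0 a)
              1 b) 2 c') 3 x) 4 y) 5 z) τ₆ (w := w) (by simp) (by simpa using ha)
              (by simpa using hb) (by simpa using hc') (by simpa using hx) (by simpa using hy)
              (by simpa using hz) hI₆.1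
            exact ⟨⟨hkeep _ _ hI₆.1, fun i hi => (h1 i hi).trans (hI₆.2 i hi)⟩, h2⟩
    refine ⟨h1, fun hw => h2 (.inr ?_)⟩
    have : Nonempty (LineVertex (Fin k)) := ⟨w⟩
    obtain ⟨p, q, r, a, b, d, hp, hq, hr, hl⟩ := SumDigraph.mem_span_iff_exists_three.1 hw
    obtain ⟨a, ha, rfl⟩ := hc.surj a
    obtain ⟨b, hb, rfl⟩ := hc.surj b
    obtain ⟨d, hd, rfl⟩ := hc.surj d
    rw [hc.eq_zero_iff ha] at hp
    rw [hc.eq_zero_iff hb] at hq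
    rw [hc.eq_zero_iff hd] at hr
    exact ⟨enc p, enc_lt p, enc q, enc_lt q, enc r, enc_lt r, a, ha, b, hb, d, hd, p, q, r,
      by simp, by simp, by simp, by simpa, by simpa, by simpa, by simpa using hp, by simpa using hq,
      by simpa using hr, by simpa using hl⟩
  have := Cmd.den_for_induction (k := k) (x := 11) (b := vertices)
    (c := .for 0 vertices (.for 1 vertices (.for 2 vertices (.for 3 (.num 4)
        (.for 4 (.num 4) (.for 5 (.num 4) c)))))) (ρ := ρ) (σ := σ)
    (fun m τ => (∀ b, b ≠ 17 → τ b = σ b) ∧ ∀ w : LineVertex (Fin k), enc w < m →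
      (fun l : Fin 3 => dec (σ 13 (enc w) l)) ∈ span F (g '' {u | Contributes N u w}) →
        IsCombination dec g (Contributes N · w) (fun l => dec (σ 13 (enc w) l)) (τ 17 (enc w)))
    ⟨fun _ _ => rfl, by simp⟩ (by
      rintro m τ hm ⟨hτ, ih⟩
      obtain ⟨w, rfl⟩ := exists_enc hm
      obtain ⟨⟨h1, h2⟩, h3⟩ := hsearch τ w hτ _ rfl
      refine ⟨h1, fun w' hw' hs => ?_⟩
      rcases eq_or_ne w' w with rfl | hne
      · exact h3 hs
      · have hne' := enc_injective.ne hne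
        rw [h2 _ hne']
        exact ih w' (by omega) hs)
  exact this.2 v (enc_lt v) hv

end SumAlgorithm

namespace SumAlgorithm

open LoopLang RAM SumNetwork Relation Module Submodule

variable {n k : ℕ} {N : SumNetwork (Fin n) (Fin k)} {F : Type*} [Field F]
  {dec : ℕ → F} {σ : Memory} {P : Finset (LineVertex (Fin k))}
  {g : LineVertex (Fin k) → Fin 3 → F} {ρ : Env}

/-! #### Writing the coefficients -/

/-- The value of `valueT`. -/
def valueAt (σ : Memory) (v u : ℕ) : ℕ := (valueT (.const v) (.const u)).eval (fun _ => 0) σ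

theorem eval_valueT {s t : Tm} {v u : ℕ} (hs : s.eval ρ σ = v) (ht : t.eval ρ σ = u) :
    (valueT s t).eval ρ σ = valueAt σ v u := by
  simp only [valueAt, valueT, addT, ifEqT, Tm.eval, hs, ht]

theorem valueAt_congr {τ : Memory} (h11 : τ 11 = σ 11) (h17 : τ 17 = σ 17) (v u : ℕ) :
    valueAt τ v u = valueAt σ v u := by
  simp only [valueAt, valueT, addT, ifEqT, Tm.eval, h11, h17]

theorem dec_valueAt (hT : HasTables N σ) (hc : IsCoding dec) {v : ℕ} (h3 : σ 17 v 3 < 4)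
    (h4 : σ 17 v 4 < 4) (h5 : σ 17 v 5 < 4) (u : ℕ) :
    dec (valueAt σ v u) = (if u = σ 17 v 0 then dec (σ 17 v 3) else 0) +
      (if u = σ 17 v 1 then dec (σ 17 v 4) else 0) +
      if u = σ 17 v 2 then dec (σ 17 v 5) else 0 := by
  have key : ∀ {c p : ℕ}, c < 4 →
      c - (u - p + (p - u) + (u - p + (p - u)) + (u - p + (p - u) + (u - p + (p - u)))) =
        if u = p then c else 0 := by
    intro c p hc
    split <;> omega
  have hlt : ∀ {c p : ℕ}, c < 4 → (if u = p then c else 0) < 4 := by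
    intro c p hc
    split <;> omega
  have hd : ∀ {c p : ℕ}, dec (if u = p then c else 0) = if u = p then dec c else 0 := by
    intro c p
    split
    · rfl
    · exact hc.zero
  simp only [valueAt, valueT, addT, ifEqT, Tm.eval, key h3, key h4, key h5]
  rw [hT.add _ (hlt h3) _ (hlt h4), hT.add _ (addCode_lt _ (hlt h3) _ (hlt h4)) _ (hlt h5),
    hc.add _ (addCode_lt _ (hlt h3) _ (hlt h4)) _ (hlt h5), hc.add _ (hlt h3) _ (hlt h4), hd, hd, hd]

/-- A stored triple becomes a coefficient function on all vertices, supported on the permitted ones,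
in the form required by `solves_of_multicast`. -/
theorem IsCombination.value (hT : HasTables N σ) (hc : IsCoding dec) {v : ℕ}
    {S : LineVertex (Fin k) → Prop} {y : Fin 3 → F}
    (h : IsCombination dec g S y (σ 17 v)) :
    (∀ u, ¬ S u → dec (valueAt σ v (enc u)) = 0) ∧
      ∀ l, ∑ u, dec (valueAt σ v (enc u)) * g u l = y l := by
  obtain ⟨p, q, r, h0, h1, h2, h3, h4, h5, hp, hq, hr, hl⟩ := h
  have hval : ∀ u : LineVertex (Fin k), dec (valueAt σ v (enc u)) =
      (if u = p then dec (σ 17 v 3) else 0) + (if u = q then dec (σ 17 v 4) else 0) +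
        if u = r then dec (σ 17 v 5) else 0 := by
    intro u
    rw [dec_valueAt hT hc h3 h4 h5, h0, h1, h2]
    simp only [enc_injective.eq_iff]
  have hz : ∀ {u p : LineVertex (Fin k)} {x : ℕ}, ¬ S u → (x = 0 ∨ S p) →
      (if u = p then dec x else 0) = 0 := by
    rintro u p x hu hp
    split
    · rename_i h
      subst h
      rw [hp.resolve_right hu, hc.zero]
    · rfl
  refine ⟨fun u hu => ?_, fun l => ?_⟩
  · rw [hval, hz hu hp, hz hu hq, hz hu hr, add_zero, add_zero]
  · simp [hval, add_mul, Finset.sum_add_distrib, ← hl]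

/-- The body of the loops that write the coefficients. -/
theorem den_coeffC (hT : HasTables N σ) {u v : LineVertex (Fin k)} (hu : ρ 0 = enc u)
    (hv : ρ 1 = enc v) :
    let τ := coeffC.den k ρ σ
    ((N.line.Shared v → τ 5 (enc u) (enc v) = valueAt σ (enc v) (enc u)) ∧
      (∀ j, N.line.Own j v →
        (SumDigraph.First enc (fun x => N.line.arc u x ∧ N.line.Own j x) v →
          (N.line.Own j u → τ 5 (enc u) (enc v) = 1) ∧
          (¬ N.line.Own j u → τ 5 (enc u) (enc v) = valueAt σ (enc (N.line.term j)) (enc u))) ∧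
        (¬ SumDigraph.First enc (fun x => N.line.arc u x ∧ N.line.Own j x) v →
          τ 5 (enc u) (enc v) = 0)) ∧
      ((∀ j, ¬ N.line.Reach v (N.line.term j)) → τ 5 (enc u) (enc v) = 0)) ∧
    ∀ i j, i ≠ enc u ∨ j ≠ enc v → τ 5 i j = σ 5 i j := by
  classical
  -- `Q j` triggers a write in pass `j`. It can hold for at most one `j`, so passes do not overwrite
  -- each other, and if it holds for none, `base` remains.
  let Q (j : Fin 3) : Prop := N.line.Own j v ∧
    SumDigraph.First enc (fun x => N.line.arc u x ∧ N.line.Own j x) v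
  let V (j : Fin 3) : ℕ :=
    if N.line.Own j u then 1 else valueAt σ (enc (N.line.term j)) (enc u)
  let base : ℕ := if N.line.Shared v then valueAt σ (enc v) (enc u) else 0
  let G (τ : Memory) : Prop := (∀ b, b ≠ 5 → τ b = σ b) ∧
    ∀ i j, i ≠ enc u ∨ j ≠ enc v → τ 5 i j = σ 5 i j
  have hG : ∀ τ x, G τ → G (τ.write 5 (enc u) (enc v) x) := by
    rintro τ x ⟨h1, h2⟩
    refine ⟨fun b hb => (write_of_ne _ _ _ hb).trans (h1 b hb), fun i j hij => ?_⟩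
    rw [write_apply, if_neg (by omega), h2 i j hij]
  have hTG : ∀ {τ}, G τ → HasTables N τ := fun hτ => hT.congr fun a ha => hτ.1 a (by omega)
  have hVG : ∀ {τ : Memory}, G τ → ∀ v u, valueAt τ v u = valueAt σ v u := fun hτ =>
    valueAt_congr (hτ.1 11 (by decide)) (hτ.1 17 (by decide))
  have hown : ∀ {j j' : Fin 3}, N.line.Own j v → N.line.Own j' v → j = j' := by
    intro j j' h h'
    by_contra hne
    exact h.2 ⟨j, j', hne, h.1, h'.1⟩
  obtain ⟨σ₁, hσ₁, hG₁, hb₁⟩ : ∃ σ₁, σ₁ = (Cmd.ite (sharedF (.var 1))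
      (.set 5 (.var 0) (.var 1) (valueT (.var 1) (.var 0))) .skip).den k ρ
      (σ.write 5 (enc u) (enc v) 0) ∧ G σ₁ ∧ σ₁ 5 (enc u) (enc v) = base := by
    refine ⟨_, rfl, ?_⟩
    have hG₀ : G (σ.write 5 (enc u) (enc v) 0) := hG σ 0 ⟨fun _ _ => rfl, fun _ _ _ => rfl⟩
    have hiff := holds_sharedF (ρ := ρ) (s := .var 1) (u := v) (hTG hG₀) hv
    rw [Cmd.den]
    split
    · rename_i hh
      rw [Cmd.den, eval_valueT (ρ := ρ) (s := .var 1) (t := .var 0) hv hu, hVG hG₀]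
      simp only [Tm.eval, hu, hv]
      exact ⟨hG _ _ hG₀, by simp [write_apply, base, hiff.1 hh]⟩
    · rename_i hh
      exact ⟨hG₀, by simp [Cmd.den, write_apply, base, mt hiff.2 hh]⟩
  have hden : coeffC.den k ρ σ = (Cmd.for 2 (.num 3) (.ite
    (.and (ownF (.var 2) (.var 1))
      (firstF (fun x => .and (arcF (.var 0) x) (ownF (.var 2) x)) (.var 1)))
    (.ite (ownF (.var 2) (.var 0)) (.set 5 (.var 0) (.var 1) (.const 1))
      (.set 5 (.var 0) (.var 1) (valueT (termT (.var 2)) (.var 0)))) .skip)).den k ρ σ₁ := by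
    rw [hσ₁, ← hu, ← hv]
    rfl
  have := Cmd.den_for_induction (k := k) (x := 2) (b := .num 3) (ρ := ρ) (σ := σ₁)
    (c := .ite (.and (ownF (.var 2) (.var 1))
      (firstF (fun x => .and (arcF (.var 0) x) (ownF (.var 2) x)) (.var 1)))
    (.ite (ownF (.var 2) (.var 0)) (.set 5 (.var 0) (.var 1) (.const 1))
      (.set 5 (.var 0) (.var 1) (valueT (termT (.var 2)) (.var 0)))) .skip)
    (fun m τ => G τ ∧ (∀ j : Fin 3, (j : ℕ) < m → Q j → τ 5 (enc u) (enc v) = V j) ∧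
      ((∀ j : Fin 3, (j : ℕ) < m → ¬ Q j) → τ 5 (enc u) (enc v) = base))
    ⟨hG₁, by simp, fun _ => hb₁⟩ (by
      rintro m τ hm ⟨hGτ, h1, h2⟩
      obtain ⟨j, rfl⟩ : ∃ j : Fin 3, (j : ℕ) = m := ⟨⟨m, hm⟩, rfl⟩
      set ρ' := Function.update ρ 2 (j : ℕ) with hρ'
      have hu' : (Tm.var 0).eval ρ' τ = enc u := by simp [hρ', hu]
      have hv' : (Tm.var 1).eval ρ' τ = enc v := by simp [hρ', hv]
      have hj' : (Tm.var 2).eval ρ' τ = j := by simp [hρ']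
      have hQ : (Fm.and (ownF (.var 2) (.var 1))
          (firstF (fun x => .and (arcF (.var 0) x) (ownF (.var 2) x)) (.var 1))).Holds k ρ' τ ↔
          Q j := by
        rw [Fm.Holds, holds_ownF (hTG hGτ) hj' hv', holds_firstF (v := v)
          (q := fun x => N.line.arc u x ∧ N.line.Own j x)]
        · rw [Fm.Holds, holds_arcF (hTG hGτ) hu' hv', holds_ownF (hTG hGτ) hj' hv']
        · intro x
          rw [Fm.Holds, holds_arcF (hTG hGτ) (u := u) (v := x) (by simp [hρ', hu]) (by simp),
            holds_ownF (hTG hGτ) (j := j) (u := x) (by simp [hρ']) (by simp)]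
        · intro i
          simp [hρ', hv]
      have hlt : ∀ i : Fin 3, (i : ℕ) < j + 1 → i = j ∨ (i : ℕ) < j := by
        intro i hi
        rcases eq_or_ne i j with h | h
        · exact .inl h
        · have : (i : ℕ) ≠ j := fun h' => h (Fin.ext h')
          exact .inr (by omega)
      rw [Cmd.den]
      split
      · rename_i hh
        have hq := hQ.1 hh
        have hset : ∀ τ', τ' = τ.write 5 (enc u) (enc v) (V j) → G τ' ∧
            (∀ i : Fin 3, (i : ℕ) < j + 1 → Q i → τ' 5 (enc u) (enc v) = V i) ∧
            ((∀ i : Fin 3, (i : ℕ) < j + 1 → ¬ Q i) → τ' 5 (enc u) (enc v) = base) := by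
          rintro _ rfl
          refine ⟨hG _ _ hGτ, fun i _ hi => ?_, fun h => (h j (by omega) hq).elim⟩
          obtain rfl := hown hi.1 hq.1
          simp [write_apply]
        apply hset
        have hiff := holds_ownF (hTG hGτ) hj' hu'
        rw [Cmd.den]
        split
        · rename_i ho
          rw [Cmd.den, hu', hv', Tm.eval]
          simp only [V, hiff.1 ho, if_true]
        · rename_i ho
          rw [Cmd.den, eval_valueT (eval_termT (hTG hGτ).toHasArcs j hj') hu', hVG hGτ, hu', hv']
          simp only [V, mt hiff.2 ho, if_false]
      · rename_i hh
        have hq := mt hQ.2 hh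
        refine ⟨hGτ, fun i hi hqi => ?_, fun h => h2 fun i hi => h i (by omega)⟩
        rcases hlt i hi with rfl | hi
        · exact (hq hqi).elim
        · exact h1 i hi hqi)
  rw [← hden] at this
  obtain ⟨hGτ, h1, h2⟩ := this
  have hno : (∀ j, ¬ Q j) → coeffC.den k ρ σ 5 (enc u) (enc v) = base := fun h => h2 fun j _ => h j
  refine ⟨⟨fun hs => ?_, fun j hj => ⟨fun hf => ?_, fun hf => ?_⟩, fun hn => ?_⟩, hGτ.2⟩
  · rw [hno fun j hj => hj.1.2 hs]
    simp [base, hs]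
  · rw [h1 j j.2 ⟨hj, hf⟩]
    exact ⟨fun h => by simp [V, h], fun h => by simp [V, h]⟩
  · rw [hno]
    · simp [base, hj.2]
    · intro i hi
      obtain rfl := hown hj hi.1
      exact hf hi.2
  · rw [hno fun j hj => hn j hj.1.1]
    have : ¬ N.line.Shared v := fun ⟨j, _, _, h, _⟩ => hn j h
    simp [base, this]

/-- The run is followed through its four phases: vectors for the sources, vectors for all shared
vertices, descriptions of these vectors and of the decodings, and finally the table of coefficients,
which satisfies `IsMulticastCode`. -/
theorem exists_solves_multicastC (hD : N.line.IsGood) (hub : ¬ ∃ y z, N.line.IsHubPair y z)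
    (hc : IsCoding dec) (hT : HasTables N σ) (h13 : ∀ i j, σ 13 i j = 0)
    (h14 : ∀ i j, σ 14 i j = 0) :
    ∃ c : LineVertex (Fin k) → LineVertex (Fin k) → F, N.line.Solves c ∧
      ∀ u v, N.line.arc u v → c u v = dec (multicastC.den k ρ σ 5 (enc u) (enc v)) := by
  classical
  obtain ⟨g₀, hR₀, hg₀⟩ := den_initC (ρ := ρ) hT hc h13 h14
  obtain ⟨P, g, hp, hR, hP⟩ := den_processC (ρ := ρ) hD hR₀ (SumDigraph.partial_init hD hub hg₀) hc
  set σ₁ := processC.den k ρ (initC.den k ρ σ)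
  have hsol := fun v => den_solveC (ρ := ρ) hR hc hP v
  have hR₂ : Repr N dec (solveC.den k ρ σ₁) P g := hR.congr fun a ha =>
    Cmd.den_of_notMem_writes k _ _ _ (by
      rcases ha with rfl | rfl | rfl | rfl | rfl | rfl | rfl <;> decide)
  set σ₂ := solveC.den k ρ σ₁
  have hsh : ∀ v, N.line.Shared v → (∀ i, v ≠ N.line.src i) →
      IsCombination dec g (N.line.arc · v) (g v) (σ₂ 17 (enc v)) := by
    intro v hv hvs
    have hgv : (fun l : Fin 3 => dec (σ₁ 13 (enc v) l)) = g v := funext (hR.vec v (hP v hv))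
    have hcon : (Contributes N · v) = (N.line.arc · v) := by
      funext u
      refine propext ⟨?_, fun h => .inl ⟨hv, h⟩⟩
      rintro (h | ⟨j, rfl, -⟩)
      · exact h.2
      · exact (hD.not_shared_term j hv).elim
    have := hsol v
    rw [hgv, hcon] at this
    exact this (hp.mem_span v (hP v hv) hvs)
  have hterm : ∀ j, IsCombination dec g (N.line.Gate j) (fun _ => 1)
      (σ₂ 17 (enc (N.line.term j))) := by
    intro j
    have hgv : (fun l : Fin 3 => dec (σ₁ 13 (enc (N.line.term j)) l)) = fun _ => 1 := by
      funext l
      rw [hR.term j l l.2, hc.one]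
    have hcon : (Contributes N · (N.line.term j)) = N.line.Gate j := by
      funext u
      refine propext ⟨?_, fun h => .inr ⟨j, rfl, h⟩⟩
      rintro (h | ⟨j', hj, h⟩)
      · exact (hD.not_shared_term j h.1).elim
      · rwa [hD.term_injective hj]
    have := hsol (N.line.term j)
    rw [hgv, hcon] at this
    refine this ?_
    change _ ∈ span F (g '' {u | N.line.Gate j u})
    rw [(hp.isOpen j).span_eq_top hP]
    exact mem_top
  obtain ⟨-, hfill⟩ := den_fill (k := k) (ρ := ρ) (σ := σ₂) (c := coeffC) (fun u v x =>
    (N.line.Shared v → x = valueAt σ₂ (enc v) (enc u)) ∧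
      (∀ j, N.line.Own j v →
        (SumDigraph.First enc (fun x => N.line.arc u x ∧ N.line.Own j x) v →
          (N.line.Own j u → x = 1) ∧
          (¬ N.line.Own j u → x = valueAt σ₂ (enc (N.line.term j)) (enc u))) ∧
        (¬ SumDigraph.First enc (fun x => N.line.arc u x ∧ N.line.Own j x) v → x = 0)) ∧
      ((∀ j, ¬ N.line.Reach v (N.line.term j)) → x = 0)) (by
    intro τ hτ u v
    obtain ⟨h1, h2⟩ := den_coeffC (ρ := Function.update (Function.update ρ 0 (enc u)) 1 (enc v))
      (hR₂.tables.congr fun a ha => hτ a (by omega)) (u := u) (v := v) (by simp) (by simp)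
    simp only [valueAt_congr (hτ 11 (by decide)) (hτ 17 (by decide))] at h1
    exact ⟨fun b hb => Cmd.den_of_notMem_writes k _ _ _
      (by simpa [coeffC, Cmd.writes] using hb), h1, h2⟩)
  have hσ₃ : multicastC.den k ρ σ = (Cmd.for 0 vertices (.for 1 vertices coeffC)).den k ρ σ₂ := rfl
  rw [← hσ₃] at hfill
  set σ₃ := multicastC.den k ρ σ
  let val (v u : LineVertex (Fin k)) : F := dec (valueAt σ₂ (enc v) (enc u))
  -- Off the arcs the table may contain anything, for instance in columns of sources, so it is cut
  -- down to the arcs.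
  let c (u v : LineVertex (Fin k)) : F :=
    if N.line.arc u v then dec (σ₃ 5 (enc u) (enc v)) else 0
  have hval := fun v hv hvs => (hsh v hv hvs).value hR₂.tables hc
  have hdec := fun j => (hterm j).value hR₂.tables hc
  refine ⟨c, SumDigraph.solves_of_multicast hD enc_injective (o := enc) (val := val) (g := g) ?_
    hp.src (fun u v hv hvs => (hval v hv hvs).1 u) (fun v l hv hvs => (hval v hv hvs).2 l)
    (fun j => (hdec j).1) (fun j => (hdec j).2), fun u v huv => if_pos huv⟩
  constructor
  · intro u v hv hvs
    by_cases huv : N.line.arc u v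
    · simp only [c, if_pos huv, val, (hfill u v).1 hv]
    · simp only [c, if_neg huv, val, (hval v hv hvs).1 u huv]
  · exact fun u i => if_neg (hD.not_arc_src u i)
  · intro u v j hv hu hf
    simp only [c, if_pos hf.1.1, (((hfill u v).2.1 j hv).1 hf).1 hu, hc.one]
  · intro u v j hv hu hf
    simp only [c, if_pos hf.1.1, (((hfill u v).2.1 j hv).1 hf).2 hu, val]
  · intro u v j hv hf
    simp only [c, ((hfill u v).2.1 j hv).2 hf, hc.zero, ite_self]
  · intro u v hn
    simp only [c, (hfill u v).2.2 hn, hc.zero, ite_self]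

end SumAlgorithm

/-! ### The field with four elements -/

theorem binaryPoly_seven : binaryPoly 7 = Polynomial.X ^ 2 + Polynomial.X + 1 := by
  have : Nat.size 7 = 3 := by decide
  simp [binaryPoly, this, Finset.sum_range_succ, Nat.testBit]
  ring

theorem binaryPoly_zero : binaryPoly 0 = 0 := by
  simp [binaryPoly]

theorem binaryPoly_one : binaryPoly 1 = 1 := by
  have : Nat.size 1 = 1 := by decide
  simp [binaryPoly, this]

theorem binaryPoly_two : binaryPoly 2 = Polynomial.X := by
  have : Nat.size 2 = 2 := by decide
  simp [binaryPoly, this, Finset.sum_range_succ, Nat.testBit]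

theorem binaryPoly_three : binaryPoly 3 = Polynomial.X + 1 := by
  have : Nat.size 3 = 2 := by decide
  simp [binaryPoly, this, Finset.sum_range_succ, Nat.testBit]
  ring

theorem natDegree_binaryPoly_seven : (binaryPoly 7).natDegree = 2 := by
  rw [binaryPoly_seven]
  compute_degree!

theorem irreducible_binaryPoly_seven : Irreducible (binaryPoly 7) := by
  -- A polynomial of degree 2 or 3 without roots is irreducible.
  have key : ∀ a : ZMod 2, a ^ 2 + a + 1 ≠ 0 := by decide
  have : Fact (Nat.Prime 2) := ⟨Nat.prime_two⟩
  rw [Polynomial.irreducible_iff_roots_eq_zero_of_degree_le_three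
    (by rw [natDegree_binaryPoly_seven]) (by rw [natDegree_binaryPoly_seven]; decide)]
  rw [Multiset.eq_zero_iff_forall_notMem]
  intro a ha
  have := Polynomial.isRoot_of_mem_roots ha
  rw [binaryPoly_seven, Polynomial.IsRoot] at this
  simp only [Polynomial.eval_add, Polynomial.eval_pow, Polynomial.eval_X, Polynomial.eval_one] at this
  exact key a this

namespace SumAlgorithm

open LoopLang RAM SumNetwork

/-- Both tables are verified on all pairs, using only characteristic 2 and `r ^ 2 = r + 1`. -/
theorem isCoding_of_root {F : Type*} [Field F] {dec : ℕ → F} {r : F} (h2 : (2 : F) = 0)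
    (hr : r ^ 2 + r + 1 = 0) (h0 : dec 0 = 0) (h1 : dec 1 = 1) (hdec2 : dec 2 = r)
    (h3 : dec 3 = r + 1) (hsurj : ∀ a, ∃ x < 4, dec x = a) : IsCoding dec where
  surj := hsurj
  zero := h0
  one := h1
  inj := by
    have hr0 : r ≠ 0 := by rintro rfl; simp at hr
    have hr1 : r + 1 ≠ 0 := by
      intro h
      have : r ^ 2 = 0 := by linear_combination hr - h
      exact hr0 (pow_eq_zero_iff (by decide) |>.1 this)
    have h11 : (1 : F) + 1 = 0 := by linear_combination h2
    have hr1' : r ≠ 1 := by rintro rfl; exact hr1 h11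
    intro x hx y hy h
    interval_cases x <;> interval_cases y <;>
      simp only [h0, h1, hdec2, h3] at h <;> grind
  add := by
    intro x hx y hy
    interval_cases x <;> interval_cases y <;>
      simp only [addCode, Nat.reduceXor, h0, h1, hdec2, h3] <;> grind
  mul := by
    intro x hx y hy
    interval_cases x <;> interval_cases y <;>
      norm_num [mulCode, h0, h1, hdec2, h3] <;> grind

theorem isCoding_adjoinRoot [Fact (Irreducible (binaryPoly 7))] :
    IsCoding fun x => AdjoinRoot.mk (binaryPoly 7) (binaryPoly x) := by
  have hm : (binaryPoly 7).Monic := by rw [binaryPoly_seven]; monicity!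
  have h2 : (2 : AdjoinRoot (binaryPoly 7)) = 0 := by
    have := congrArg (AdjoinRoot.of (binaryPoly 7)) (show (2 : ZMod 2) = 0 from rfl)
    rwa [map_ofNat, map_zero] at this
  refine isCoding_of_root (r := AdjoinRoot.mk (binaryPoly 7) Polynomial.X) h2 ?_
    (by rw [binaryPoly_zero, map_zero]) (by rw [binaryPoly_one, map_one]) (by rw [binaryPoly_two])
    (by rw [binaryPoly_three, map_add, map_one]) fun a => ?_
  · rw [← map_pow, ← map_add, ← map_one (AdjoinRoot.mk (binaryPoly 7)), ← map_add,
      ← binaryPoly_seven, AdjoinRoot.mk_self]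
  · obtain ⟨p, rfl⟩ := AdjoinRoot.mk_surjective a
    have hp : AdjoinRoot.mk (binaryPoly 7) p = AdjoinRoot.mk (binaryPoly 7) (p %ₘ binaryPoly 7) := by
      conv_lhs => rw [← Polynomial.modByMonic_add_div p (binaryPoly 7)]
      simp
    have hdeg : (p %ₘ binaryPoly 7).natDegree ≤ 1 := by
      have := Polynomial.natDegree_modByMonic_lt p hm (by
        intro h
        have := natDegree_binaryPoly_seven
        rw [h] at this
        simp at this)
      rw [natDegree_binaryPoly_seven] at this
      omega
    obtain ⟨a, b, hab⟩ := Polynomial.exists_eq_X_add_C_of_natDegree_le_one hdeg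
    have key : ∀ a : ZMod 2, a = 0 ∨ a = 1 := by decide
    rw [hp, hab]
    rcases key a with rfl | rfl <;> rcases key b with rfl | rfl
    · exact ⟨0, by decide, by simp [binaryPoly_zero]⟩
    · exact ⟨1, by decide, by simp [binaryPoly_one]⟩
    · exact ⟨2, by decide, by simp [binaryPoly_two]⟩
    · exact ⟨3, by decide, by simp [binaryPoly_three]⟩

/-! ### Correctness of the algorithm -/

variable {n k : ℕ} {N : SumNetwork (Fin n) (Fin k)} {σ : Memory} {ρ : Env}

theorem den_outputC (hk : σ 0 0 1 = k) :
    outputC.den k ρ σ 3 0 0 = 7 ∧ outputC.den k ρ σ 5 = σ 5 ∧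
    ∀ (i : Fin 3) (e : Fin k),
      outputC.den k ρ σ 4 i e = σ 5 (enc (N.line.src i)) e ∧
      outputC.den k ρ σ 6 i e = σ 5 e (enc (N.line.term i)) := by
  have := Cmd.den_for_induction (k := k) (x := 0) (b := .num 3) (c := .for 1 (.edges 0) (.seq
    (.set 4 (.var 0) (.var 1) (.cell 5 (srcT (.var 0)) (.var 1)))
    (.set 6 (.var 0) (.var 1) (.cell 5 (.var 1) (termT (.var 0)))))) (ρ := ρ) (σ := σ)
    (fun m τ => (τ 0 = σ 0 ∧ τ 5 = σ 5) ∧ ∀ (i : Fin 3) (e : Fin k), (i : ℕ) < m →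
      τ 4 i e = σ 5 (enc (N.line.src i)) e ∧ τ 6 i e = σ 5 e (enc (N.line.term i)))
    ⟨⟨rfl, rfl⟩, by simp⟩ (by
      rintro m τ hm ⟨hτ, ih⟩
      obtain ⟨h1, h2, h3⟩ := Cmd.den_for_induction (k := k) (x := 1) (b := .edges 0) (c := .seq
        (.set 4 (.var 0) (.var 1) (.cell 5 (srcT (.var 0)) (.var 1)))
        (.set 6 (.var 0) (.var 1) (.cell 5 (.var 1) (termT (.var 0)))))
        (ρ := Function.update ρ 0 m) (σ := τ)
        (fun l τ => (τ 0 = σ 0 ∧ τ 5 = σ 5) ∧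
          (∀ (i : Fin 3) (e : Fin k), (i : ℕ) < m →
            τ 4 i e = σ 5 (enc (N.line.src i)) e ∧ τ 6 i e = σ 5 e (enc (N.line.term i))) ∧
          ∀ (i : Fin 3) (e : Fin k), (i : ℕ) = m → (e : ℕ) < l →
            τ 4 i e = σ 5 (enc (N.line.src i)) e ∧ τ 6 i e = σ 5 e (enc (N.line.term i)))
        ⟨hτ, ih, by simp⟩ (by
          rintro l τ hl ⟨⟨h0, h5⟩, h1, h2⟩
          have hk' : τ 0 0 1 = k := by rw [h0, hk]
          simp only [Cmd.den, Tm.eval, srcT, termT, numEdges, Function.update_self,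
            Function.update_of_ne (show (0 : ℕ) ≠ 1 by decide)]
          simp only [write_of_ne _ _ _ (show (0 : ℕ) ≠ 4 by decide),
            write_of_ne _ _ _ (show (5 : ℕ) ≠ 4 by decide), hk', h5]
          refine ⟨⟨?_, ?_⟩, fun i e hi => ?_, fun i e hi he => ?_⟩
          · rw [write_of_ne _ _ _ (by decide), write_of_ne _ _ _ (by decide), h0]
          · rw [write_of_ne _ _ _ (by decide), write_of_ne _ _ _ (by decide), h5]
          · simpa [write_apply, hi.ne] using h1 i e hi
          · rcases eq_or_ne (e : ℕ) l with rfl | hne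
            · simp [write_apply, hi, enc_src, enc_term]
            · simpa [write_apply, hne] using h2 i e hi (by omega))
      refine ⟨h1, fun i e hi => ?_⟩
      rcases eq_or_ne (i : ℕ) m with hi' | hi'
      · exact h3 i e hi' (by simp)
      · exact h2 i e (by omega))
  set τ := (Cmd.for 0 (.num 3) (.for 1 (.edges 0) (.seq
    (.set 4 (.var 0) (.var 1) (.cell 5 (srcT (.var 0)) (.var 1)))
    (.set 6 (.var 0) (.var 1) (.cell 5 (.var 1) (termT (.var 0))))))).den k ρ σ
  have hden : outputC.den k ρ σ = τ.write 3 0 0 7 := rfl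
  rw [hden, write_of_ne _ _ _ (show (5 : ℕ) ≠ 3 by decide),
    write_of_ne _ _ _ (show (4 : ℕ) ≠ 3 by decide), write_of_ne _ _ _ (show (6 : ℕ) ≠ 3 by decide)]
  exact ⟨by simp [write_apply], this.1.2, fun i e => this.2 i e i.2⟩

/-- The program branches as the existence proof does. The announced modulus is always the code 7 of
`X ^ 2 + X + 1`, and the coefficients are only claimed along arcs. -/
theorem exists_solves_algorithm {F : Type*} [Field F] {dec : ℕ → F} (hc : IsCoding dec)
    (hD : N.line.IsGood) :
    ∃ c : LineVertex (Fin k) → LineVertex (Fin k) → F, N.line.Solves c ∧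
      algorithm.den k ρ N.input 3 0 0 = 7 ∧
      (∀ (i : Fin 3) (e : Fin k), N.line.arc (N.line.src i) (.inl e) →
        c (N.line.src i) (.inl e) = dec (algorithm.den k ρ N.input 4 i e)) ∧
      (∀ e' e : Fin k, N.line.arc (.inl e') (.inl e) →
        c (.inl e') (.inl e) = dec (algorithm.den k ρ N.input 5 e' e)) ∧
      ∀ (j : Fin 3) (e : Fin k), N.line.arc (.inl e) (N.line.term j) →
        c (.inl e) (N.line.term j) = dec (algorithm.den k ρ N.input 6 j e) := by
  classical
  let prepare : Cmd := .seqs [edgesC, reachC, tableC 11 addCode codePairs,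
    tableC 12 mulCode codePairs]
  have hwr : ∀ a, a ∉ prepare.writes → prepare.den k ρ N.input a = N.input a := fun a ha =>
    Cmd.den_of_notMem_writes k _ _ _ ha
  have hT : HasTables N (prepare.den k ρ N.input) := by
    have h1 := hasArcs_edgesC (N := N) ρ
    have h2 := reach_reachC (ρ := ρ) hD h1
    set σ₁ := edgesC.den k ρ N.input
    set σ₂ := reachC.den k ρ σ₁ with hσ₂
    have h2' : HasArcs N σ₂ := h1.congr (Cmd.den_of_notMem_writes k _ _ _ (by decide))
      (Cmd.den_of_notMem_writes k _ _ _ (by decide))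
    obtain ⟨h3, h4⟩ := den_tableC (k := k) (a := 11) (f := addCode) (l := codePairs) (ρ := ρ) (σ := σ₂)
    set σ₃ := (tableC 11 addCode codePairs).den k ρ σ₂
    obtain ⟨h5, h6⟩ := den_tableC (k := k) (a := 12) (f := mulCode) (l := codePairs) (ρ := ρ) (σ := σ₃)
    have hden : prepare.den k ρ N.input = (tableC 12 mulCode codePairs).den k ρ σ₃ := rfl
    rw [hden]
    refine ⟨h2'.congr ((h5 0 (by decide)).trans (h3 0 (by decide)))
      ((h5 9 (by decide)).trans (h3 9 (by decide))), fun u w => ?_, fun x hx y hy => ?_,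
      fun x hx y hy => ?_⟩
    · rw [h5 10 (by decide), h3 10 (by decide)]
      exact h2 u w
    · rw [h5 11 (by decide), h4, if_pos (mem_codePairs hx hy)]
    · rw [h6, if_pos (mem_codePairs hx hy)]
  have h13 : ∀ i j, prepare.den k ρ N.input 13 i j = 0 := by
    rw [hwr 13 (by decide)]; exact fun _ _ => rfl
  have h14 : ∀ i j, prepare.den k ρ N.input 14 i j = 0 := by
    rw [hwr 14 (by decide)]; exact fun _ _ => rfl
  set σ := prepare.den k ρ N.input
  let choice : Cmd := .ite (.ex 0 vertices (.ex 1 vertices (hubPairF (.var 0) (.var 1)))) hubC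
    multicastC
  have hden : algorithm.den k ρ N.input = outputC.den k ρ (choice.den k ρ σ) := rfl
  have hhub : (Fm.ex 0 vertices (.ex 1 vertices (hubPairF (.var 0) (.var 1)))).Holds k ρ σ ↔
      ∃ y z, N.line.IsHubPair y z := by
    rw [Fm.Holds, vertices_val, exists_lt_iff]
    refine exists_congr fun y => ?_
    rw [Fm.Holds, vertices_val, exists_lt_iff]
    exact exists_congr fun z => holds_hubPairF hT (by simp) (by simp)
  obtain ⟨c, hsol, hcv⟩ : ∃ c : LineVertex (Fin k) → LineVertex (Fin k) → F, N.line.Solves c ∧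
      ∀ u v, N.line.arc u v → c u v = dec (choice.den k ρ σ 5 (enc u) (enc v)) := by
    simp only [choice]
    rw [Cmd.den]
    split
    · rename_i hh
      obtain ⟨y, z, hyz, h⟩ := den_hubC (ρ := ρ) hT (hhub.1 hh)
      refine ⟨fun u v => dec (hubC.den k ρ σ 5 (enc u) (enc v)),
        SumDigraph.solves_of_hub hD enc_injective hyz (fun u v huv => ?_) (fun u v huv => ?_),
        fun _ _ _ => rfl⟩
      · rw [(h u v).1 huv, hc.one]
      · rw [(h u v).2 huv, hc.zero]
    · rename_i hh
      exact exists_solves_multicastC hD (mt hhub.2 hh) hc hT h13 h14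
  obtain ⟨h3, h5, h46⟩ := den_outputC (N := N) (ρ := ρ) (σ := choice.den k ρ σ)
    (by rw [Cmd.den_of_notMem_writes k choice _ _ (by decide)]; exact hT.size)
  rw [hden]
  refine ⟨c, hsol, h3, fun i e h => ?_, fun e' e h => ?_, fun j e h => ?_⟩
  · rw [(h46 i e).1, hcv _ _ h, enc_inl]
  · rw [h5, hcv _ _ h, enc_inl, enc_inl]
  · rw [(h46 j e).2, hcv _ _ h, enc_inl]

end SumAlgorithm

theorem computesSum_outputCode {n k : ℕ} {N : SumNetwork (Fin n) (Fin k)} (hN : N.IsAdmissible)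
    (h2 : N.TwoEdgeDisjointPaths) {ρ : LoopLang.Env} {τ : RAM.Memory}
    (hτ : ∀ a, a ≠ 7 → a ≠ 8 → τ a = SumAlgorithm.algorithm.den k ρ N.input a) :
    Irreducible (outputModulus τ) ∧ N.ComputesSum (outputCode k τ) := by
  have : Fact (Irreducible (binaryPoly 7)) := ⟨irreducible_binaryPoly_seven⟩
  obtain ⟨c, hsol, h3, h4, h5, h6⟩ := SumAlgorithm.exists_solves_algorithm (ρ := ρ)
    SumAlgorithm.isCoding_adjoinRoot (SumNetwork.line_isGood hN h2)
  rw [← hτ 3 (by decide) (by decide)] at h3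
  rw [← hτ 4 (by decide) (by decide)] at h4
  rw [← hτ 5 (by decide) (by decide)] at h5
  rw [← hτ 6 (by decide) (by decide)] at h6
  have hmod : outputModulus τ = binaryPoly 7 := by rw [outputModulus, h3]
  -- The coefficient ring depends on the announced modulus, so the modulus is generalized to a
  -- variable before it is replaced by its value.
  have key : ∀ f : Polynomial (ZMod 2), f = binaryPoly 7 → N.ComputesSum (F := AdjoinRoot f)
      { inject := fun i e => AdjoinRoot.mk f (binaryPoly (τ 4 i e))
        transfer := fun e' e => AdjoinRoot.mk f (binaryPoly (τ 5 e' e))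
        decode := fun j e => AdjoinRoot.mk f (binaryPoly (τ 6 j e)) } := by
    rintro _ rfl
    exact SumNetwork.computesSum_of_solves hN h2 hsol
      (fun i e h => (h4 i e ⟨_, rfl, congrArg some h.symm⟩).symm)
      (fun e' e h => (h5 e' e ⟨_, rfl, congrArg some h.symm⟩).symm)
      (fun j e h => (h6 j e ⟨_, rfl, congrArg some h.symm⟩).symm)
  exact ⟨by rw [hmod]; exact irreducible_binaryPoly_seven, key _ hmod⟩

theorem mainTheorem1 :
    -- existence of the code over every large enough field with `2 ^ m` elements
    (∀ (V : Type*) (E : Type*) [Fintype V] [DecidableEq V] [Fintype E] (N : SumNetwork V E),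
      N.IsAdmissible → N.TwoEdgeDisjointPaths →
        ∃ m₀ : ℕ, ∀ m ≥ m₀, ∃ c : LinearCode E (GaloisField 2 m), N.ComputesSum c) ∧
    -- a polynomial-time algorithm that finds a field with `2 ^ m` elements and a code over it
    (∃ (A : RAM.Program) (P : Polynomial ℕ), ∀ (n k : ℕ) (N : SumNetwork (Fin n) (Fin k)),
      N.IsAdmissible → N.TwoEdgeDisjointPaths →
        ∃ (τ : RAM.Memory) (t : ℕ), RAM.Runs A N.input τ t ∧ t ≤ P.eval (n + k) ∧
          Irreducible (outputModulus τ) ∧ N.ComputesSum (outputCode k τ)) := by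
  constructor
  · intro V E _ _ _ N hN h2
    -- The only requirement on the field is that it has at least four elements.
    refine ⟨2, fun m hm => SumNetwork.exists_computesSum ?_ hN h2⟩
    rw [GaloisField.card 2 m (by omega)]
    exact Nat.pow_le_pow_right (n := 2) (i := 2) (by decide) hm
  -- The cost is a polynomial in the number of edges alone; its coefficients are natural numbers, so
  -- its value at `n + k` is an upper bound.
  · refine ⟨SumAlgorithm.algorithm.compile, SumAlgorithm.algorithm.cost, fun n k N hN h2 => ?_⟩
    have hs : LoopLang.Sim k [] (fun _ => 0) N.input N.input :=
      ⟨fun _ _ _ => rfl, by simp, rfl⟩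
    obtain ⟨τ, t, hr, ht, hs'⟩ :=
      SumAlgorithm.algorithm.runs_compile SumAlgorithm.algorithm_wf hs
    exact ⟨τ, t, hr, ht.trans (LoopLang.eval_mono _ (by omega)),
      computesSum_outputCode hN h2 fun a h7 h8 => hs'.data a h7 h8⟩
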